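/- Let $k$ be an algebraically closed field of characteristic $0$ and let $n\ge 4$. Write $(n+1)\times n$ matrices over $k$ as pairs $(A,a)$, where $A$ is the $n\times n$ matrix formed by the first $n$ rows and $a$ is the last row. Let $Y$ be the $(n+1)\times n$ matrix over $k[y]$ with $y$ on the main diagonal and $0$ elsewhere, and let $\mathfrak X\subseteq \mathrm{Mat}(n+1,n)$ be the reduced closed subscheme of all matrices $B$ such that every $n\times n$ minor of $Y+B$ is divisible by $y^2$; that is, $\mathfrak X=V(\sqrt{\mathfrak I})$, where $\mathfrak I$ is generated by the coefficients of $y^0$ and $y^1$ in the $n\times n$ minors of $Y+W$, with $W$ the generic $(n+1)\times n$ matrix. Let $\mathbb F=\mathrm{Flag}(1,2;k^n)$ be the variety of flags $W_1\subseteq W_2\subseteq k^n$ with $\dim W_1=1$, $\dim W_2=2$, and let $$\widetilde{\mathfrak X}=\{(A,a,W_1,W_2) : AW_2\subseteq W_1,\ AW_1=0,\ aW_2=0\}\subseteq \mathrm{Mat}(n+1,n)\times\mathbb F .$$ Then the following hold. 1. The set $\widetilde{\mathfrak X}$ is the set of $k$-points of a (reduced) closed subvariety of $\mathrm{Mat}(n+1,n)\times\mathbb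 F$, which is the total space of a vector subbundle of rank $n^2-n-1$ of the trivial bundle $\mathrm{Mat}(n+1,n)\times\mathbb F$ over $\mathbb F$. It is irreducible of dimension $n^2+n-4$. 2. The projection $\mathrm{Mat}(n+1,n)\times\mathbb F\to\mathrm{Mat}(n+1,n)$ restricts to a morphism $\rho:\widetilde{\mathfrak X}\to\mathfrak X$, and $\rho$ is a resolution of singularities: $\widetilde{\mathfrak X}$ is smooth over $k$, and $\rho$ is proper and birational. -/

import Mathlib

open CategoryTheory Limits AlgebraicGeometry

universe u

namespace MatrixResolution

noncomputable section

attribute [local instance] MvPolynomial.gradedAlgebra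

/-! ### Reduced closed subschemes -/

/-- The closure of a set `S` of points of a scheme `X`, as a reduced closed subscheme of `X`. -/
abbrev reducedClosure {X : Scheme.{u}} (S : Set X) : Scheme.{u} :=
  (Scheme.IdealSheafData.vanishingIdeal ⟨closure S, isClosed_closure⟩).subscheme

/-- The inclusion of the reduced closed subscheme `reducedClosure S`. -/
abbrev reducedClosureι {X : Scheme.{u}} (S : Set X) : reducedClosure S ⟶ X :=
  (Scheme.IdealSheafData.vanishingIdeal ⟨closure S, isClosed_closure⟩).subschemeι

open Scheme.IdealSheafData in
lemma reducedClosure_ker_le {X Y : Scheme.{u}} (S : Set X) [IsReduced Y] (g : Y ⟶ X)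
    [QuasiCompact g] (h : Set.range g ⊆ S) : (reducedClosureι S).ker ≤ g.ker := by
  have h1 : g.ker.radical = g.ker := by
    apply Scheme.IdealSheafData.ext
    ext1 U
    rw [radical_ideal, g.ker_apply]
    refine Ideal.IsRadical.radical fun x hx ↦ ?_
    obtain ⟨m, hm⟩ := hx
    rw [RingHom.mem_ker, map_pow] at hm
    exact eq_zero_of_pow_eq_zero hm
  rw [← h1, ← vanishingIdeal_support, reducedClosureι, ker_subschemeι]
  apply vanishingIdeal_antimono
  rw [← SetLike.coe_subset_coe, g.support_ker]
  exact closure_mono h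

/-- A morphism from a reduced scheme whose image lies in `S` factors through `reducedClosure S`. -/
def reducedClosureLift {X Y : Scheme.{u}} (S : Set X) [IsReduced Y] (g : Y ⟶ X)
    [QuasiCompact g] (h : Set.range g ⊆ S) : Y ⟶ reducedClosure S :=
  IsClosedImmersion.lift (reducedClosureι S) g (reducedClosure_ker_le S g h)

/-! ### Projective space over a field -/

/-- The projective space over `k` with homogeneous coordinates indexed by `ι`. -/
abbrev projSpace (k : Type u) [Field k] (ι : Type) : Scheme.{u} :=
  Proj (MvPolynomial.homogeneousSubmodule ι k)

/-- The structure morphism of projective space. -/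
def projSpaceStr (k : Type u) [Field k] (ι : Type) : projSpace k ι ⟶ Spec (.of k) :=
  Proj.toSpecZero (MvPolynomial.homogeneousSubmodule ι k) ≫
    Spec.map (CommRingCat.ofHom (algebraMap k (MvPolynomial.homogeneousSubmodule ι k 0)))

/-- Evaluation of polynomials at `w`, with values in the global functions on `Spec k`. -/
def evalAt (k : Type u) [Field k] {ι : Type} (w : ι → k) :
    MvPolynomial ι k →+* Γ(Spec (.of k), ⊤) :=
  (Scheme.ΓSpecIso (.of k)).inv.hom.comp (MvPolynomial.eval w)

lemma map_evalAt_irrelevant (k : Type u) [Field k] {ι : Type} (w : ι → k) (hw : w ≠ 0) :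
    (HomogeneousIdeal.irrelevant (MvPolynomial.homogeneousSubmodule ι k)).toIdeal.map
      (evalAt k w) = ⊤ := by
  obtain ⟨i, hi⟩ := Function.ne_iff.mp hw
  refine Ideal.eq_top_of_isUnit_mem _ (Ideal.mem_map_of_mem _ (x := MvPolynomial.X i) ?_) ?_
  · rw [HomogeneousIdeal.mem_iff, HomogeneousIdeal.mem_irrelevant_iff, GradedRing.proj_apply,
      DirectSum.decompose_of_mem_ne (i := 1) _ (MvPolynomial.isHomogeneous_X k i) one_ne_zero]
  · simp only [evalAt, RingHom.comp_apply, MvPolynomial.eval_X]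
    exact (IsUnit.mk0 _ hi).map _

/-- The `k`-point `[w]` of projective space with homogeneous coordinates `w ≠ 0`. -/
def projPoint (k : Type u) [Field k] {ι : Type} (w : ι → k) (hw : w ≠ 0) :
    Spec (.of k) ⟶ projSpace k ι :=
  Proj.fromOfGlobalSections _ (evalAt k w) (map_evalAt_irrelevant k w hw)

lemma projPoint_str (k : Type u) [Field k] {ι : Type} (w : ι → k) (hw : w ≠ 0) :
    projPoint k w hw ≫ projSpaceStr k ι = 𝟙 _ := by
  rw [projPoint, projSpaceStr, Proj.fromOfGlobalSections_toSpecZero_assoc, ← Spec.map_comp]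
  have : CommRingCat.ofHom (algebraMap k (MvPolynomial.homogeneousSubmodule ι k 0)) ≫
      CommRingCat.ofHom ((evalAt k w).comp (algebraMap _ _)) =
      (Scheme.ΓSpecIso (.of k)).inv := by
    ext x
    simp only [evalAt, CommRingCat.hom_comp, CommRingCat.hom_ofHom, RingHom.comp_apply]
    congr 1
    exact MvPolynomial.eval_C x
  rw [this]
  simp

/-! ### The flag variety -/

/-- A partial flag `W₁ ⊆ W₂ ⊆ kⁿ` with `dim W₁ = 1` and `dim W₂ = 2`. -/
@[ext]
structure LinePlaneFlag (k : Type u) [Field k] (n : ℕ) where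
  /-- the line -/
  W₁ : Submodule k (Fin n → k)
  /-- the plane -/
  W₂ : Submodule k (Fin n → k)
  le : W₁ ≤ W₂
  finrank_W₁ : Module.finrank k W₁ = 1
  finrank_W₂ : Module.finrank k W₂ = 2

/-- The Plücker coordinates `wᵢ vⱼ - wⱼ vᵢ` of `w ∧ v`, as an antisymmetric tensor. -/
def wedge {k : Type u} [Field k] {n : ℕ} (w v : Fin n → k) : Fin n × Fin n → k :=
  fun p ↦ w p.1 * v p.2 - w p.2 * v p.1

lemma wedge_ne_zero {k : Type u} [Field k] {n : ℕ} {w v : Fin n → k}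
    (h : LinearIndependent k ![w, v]) : wedge w v ≠ 0 := by
  intro h0
  have hw : w ≠ 0 := h.ne_zero 0
  obtain ⟨i, hi⟩ := Function.ne_iff.mp hw
  rw [LinearIndependent.pair_iff] at h
  refine hi (h (-v i) (w i) ?_).2
  funext j
  have := congrFun h0 (i, j)
  simp only [wedge, Pi.zero_apply] at this
  simp only [Pi.add_apply, Pi.smul_apply, smul_eq_mul, Pi.zero_apply]
  linear_combination this

lemma LinePlaneFlag.exists_basis {k : Type u} [Field k] {n : ℕ} (W : LinePlaneFlag k n) :
    ∃ w v : Fin n → k, LinearIndependent k ![w, v] ∧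
      W.W₁ = Submodule.span k {w} ∧ W.W₂ = Submodule.span k {w, v} := by
  obtain ⟨w, hw0, hw⟩ := finrank_eq_one_iff'.mp W.finrank_W₁
  have hw0' : (w : Fin n → k) ≠ 0 := fun h ↦ hw0 (Subtype.ext h)
  have h1 : W.W₁ = Submodule.span k {(w : Fin n → k)} := by
    apply le_antisymm
    · intro x hx
      obtain ⟨c, hc⟩ := hw ⟨x, hx⟩
      exact Submodule.mem_span_singleton.mpr ⟨c, congrArg Subtype.val hc⟩
    · exact (Submodule.span_singleton_le_iff_mem _ _).mpr w.2
  have hlt : W.W₁ < W.W₂ := by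
    refine lt_of_le_of_ne W.le fun h ↦ ?_
    have h3 := W.finrank_W₂
    rw [← h, W.finrank_W₁] at h3
    omega
  obtain ⟨v, hv, hvn⟩ := SetLike.exists_of_lt hlt
  have hli : LinearIndependent k ![(w : Fin n → k), v] :=
    (LinearIndependent.pair_iff' hw0').mpr fun c hc ↦
      hvn (hc ▸ W.W₁.smul_mem c w.2)
  refine ⟨w, v, hli, h1, (Submodule.eq_of_le_of_finrank_eq ?_ ?_).symm⟩
  · rw [Submodule.span_le]
    rintro x (rfl | rfl)
    · exact W.le w.2
    · exact hv
  · have h4 := finrank_span_eq_card hli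
    rw [Matrix.range_cons_cons_empty] at h4
    rw [h4, W.finrank_W₂, Fintype.card_fin]

/-- The first vector of a basis `w, v` of `W₂` such that `w` spans `W₁`. -/
def LinePlaneFlag.w {k : Type u} [Field k] {n : ℕ} (W : LinePlaneFlag k n) : Fin n → k :=
  W.exists_basis.choose

/-- The second vector of a basis `w, v` of `W₂` such that `w` spans `W₁`. -/
def LinePlaneFlag.v {k : Type u} [Field k] {n : ℕ} (W : LinePlaneFlag k n) : Fin n → k :=
  W.exists_basis.choose_spec.choose

lemma LinePlaneFlag.linearIndependent {k : Type u} [Field k] {n : ℕ} (W : LinePlaneFlag k n) :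
    LinearIndependent k ![W.w, W.v] :=
  W.exists_basis.choose_spec.choose_spec.1

/-- The product `ℙ(kⁿ) × ℙ(kⁿ ⊗ kⁿ)` over `k`. -/
abbrev flagAmbient (k : Type u) [Field k] (n : ℕ) : Scheme.{u} :=
  pullback (projSpaceStr k (Fin n)) (projSpaceStr k (Fin n × Fin n))

/-- The structure morphism of `ℙ(kⁿ) × ℙ(kⁿ ⊗ kⁿ)`. -/
def flagAmbientStr (k : Type u) [Field k] (n : ℕ) : flagAmbient k n ⟶ Spec (.of k) :=
  pullback.fst _ _ ≫ projSpaceStr k (Fin n)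

/-- The Plücker embedding on `k`-points: the flag `⟨w⟩ ⊆ ⟨w, v⟩` is sent to `([w], [w ∧ v])`.
This does not depend on the choice of `w` and `v`. -/
def LinePlaneFlag.plucker {k : Type u} [Field k] {n : ℕ} (W : LinePlaneFlag k n) :
    Spec (.of k) ⟶ flagAmbient k n :=
  pullback.lift (projPoint k W.w (W.linearIndependent.ne_zero 0))
    (projPoint k (wedge W.w W.v) (wedge_ne_zero W.linearIndependent))
    ((projPoint_str k _ _).trans (projPoint_str k _ _).symm)

/-- The set of points `([w], [w ∧ v])` of `ℙ(kⁿ) × ℙ(kⁿ ⊗ kⁿ)`. -/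
def flagLocus (k : Type u) [Field k] (n : ℕ) : Set (flagAmbient k n) :=
  ⋃ W : LinePlaneFlag k n, Set.range W.plucker

/-- The flag variety `Flag(1,2;kⁿ)`, in its Plücker embedding: the closed subvariety of
`ℙ(kⁿ) × ℙ(kⁿ ⊗ kⁿ)` whose `k`-points are the points `([w], [w ∧ v])`. -/
abbrev flagVariety (k : Type u) [Field k] (n : ℕ) : Scheme.{u} :=
  reducedClosure (flagLocus k n)

/-- The structure morphism of the flag variety. -/
def flagStr (k : Type u) [Field k] (n : ℕ) : flagVariety k n ⟶ Spec (.of k) :=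
  reducedClosureι (flagLocus k n) ≫ flagAmbientStr k n

instance quasiCompact_of_field {k : Type u} [Field k] {X : Scheme.{u}} (f : Spec (.of k) ⟶ X) :
    QuasiCompact f :=
  ⟨fun _ _ _ ↦ (Set.toFinite _).isCompact⟩

/-- The `k`-point of the flag variety given by a flag. -/
def LinePlaneFlag.point {k : Type u} [Field k] {n : ℕ} (W : LinePlaneFlag k n) :
    Spec (.of k) ⟶ flagVariety k n :=
  reducedClosureLift _ W.plucker (Set.subset_iUnion (fun W : LinePlaneFlag k n ↦
    Set.range W.plucker) W)

/-! ### Matrices and the incidence variety -/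

/-- The index set of the coordinates on the space of `(n+1) × n` matrices. -/
abbrev MatIdx (n : ℕ) : Type u := ULift.{u} (Fin (n + 1) × Fin n)

/-- `Mat(n+1,n) × S` as a scheme over `S`. -/
abbrev matSpace (n : ℕ) (S : Scheme.{u}) : Scheme.{u} := 𝔸(MatIdx.{u} n; S)

/-- The point of `Mat(n+1,n) × S` given by a `k`-point `x` of `S` and a matrix `B` over `k`. -/
def matPoint {k : Type u} [Field k] {n : ℕ} {S : Scheme.{u}}
    (x : Spec (.of k) ⟶ S) (B : Matrix (Fin (n + 1)) (Fin n) k) :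
    Spec (.of k) ⟶ matSpace n S :=
  AffineSpace.homOfVector x fun p ↦ (Scheme.ΓSpecIso (.of k)).inv (B p.down.1 p.down.2)

/-- The square matrix `A` formed by the first `n` rows of `B`. -/
def topBlock {k : Type u} {n : ℕ} (B : Matrix (Fin (n + 1)) (Fin n) k) :
    Matrix (Fin n) (Fin n) k :=
  B.submatrix Fin.castSucc id

/-- The last row `a` of `B`, as a `1 × n` matrix. -/
def lastRow {k : Type u} {n : ℕ} (B : Matrix (Fin (n + 1)) (Fin n) k) :
    Matrix (Fin 1) (Fin n) k :=
  B.submatrix (fun _ ↦ Fin.last n) id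

/-- The conditions `A W₂ ⊆ W₁`, `A W₁ = 0`, `a W₂ = 0`, for `B` obtained by stacking `A` on `a`. -/
def Incident {k : Type u} [Field k] {n : ℕ} (B : Matrix (Fin (n + 1)) (Fin n) k)
    (W : LinePlaneFlag k n) : Prop :=
  W.W₂.map (topBlock B).mulVecLin ≤ W.W₁ ∧
    W.W₁.map (topBlock B).mulVecLin = ⊥ ∧
    W.W₂.map (lastRow B).mulVecLin = ⊥

/-- The set of points `(A, a, W₁, W₂)` of `Mat(n+1,n) × Flag(1,2;kⁿ)` with
`A W₂ ⊆ W₁`, `A W₁ = 0`, `a W₂ = 0`. -/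
def incidenceLocus (k : Type u) [Field k] (n : ℕ) : Set (matSpace n (flagVariety k n)) :=
  {x | ∃ (B : Matrix (Fin (n + 1)) (Fin n) k) (W : LinePlaneFlag k n),
    Incident B W ∧ x ∈ Set.range (matPoint W.point B)}

/-- The incidence variety, as a reduced closed subscheme of `Mat(n+1,n) × Flag(1,2;kⁿ)`. -/
abbrev incidenceVariety (k : Type u) [Field k] (n : ℕ) : Scheme.{u} :=
  reducedClosure (incidenceLocus k n)

/-- The inclusion of the incidence variety in `Mat(n+1,n) × Flag(1,2;kⁿ)`. -/
abbrev incidenceι (k : Type u) [Field k] (n : ℕ) :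
    incidenceVariety k n ⟶ matSpace n (flagVariety k n) :=
  reducedClosureι (incidenceLocus k n)

/-- The projection of the incidence variety to `Mat(n+1,n)`. -/
def incidenceProj (k : Type u) [Field k] (n : ℕ) :
    incidenceVariety k n ⟶ matSpace n (Spec (.of k)) :=
  incidenceι k n ≫ AffineSpace.map (MatIdx n) (flagStr k n)

/-! ### The variety `𝔛` -/

/-- The matrix `Y + W` over `k[w][y]`, where `W` is the generic `(n+1) × n` matrix, and `Y` has
`y` on the main diagonal and `0` elsewhere. -/
def genericShift (k : Type u) [Field k] (n : ℕ) :
    Matrix (Fin (n + 1)) (Fin n) (Polynomial (MvPolynomial (MatIdx.{u} n) k)) :=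
  .of fun i j ↦ (if i = j.castSucc then Polynomial.X else 0) +
    Polynomial.C (MvPolynomial.X ⟨(i, j)⟩)

/-- The ideal of `k[w]` generated by the coefficients of `y⁰` and `y¹` in the `n × n` minors
of `Y + W`. -/
def minorIdeal (k : Type u) [Field k] (n : ℕ) : Ideal (MvPolynomial (MatIdx.{u} n) k) :=
  Ideal.span {f | ∃ (i : Fin (n + 1)) (d : ℕ), d < 2 ∧
    f = ((genericShift k n).submatrix i.succAbove id).det.coeff d}

/-- The variety `𝔛` of all `W` such that `y²` divides the `n × n` minors of `Y + W`, as a reduced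
affine scheme. -/
abbrev minorVariety (k : Type u) [Field k] (n : ℕ) : Scheme.{u} :=
  Spec (.of (MvPolynomial (MatIdx.{u} n) k ⧸ (minorIdeal k n).radical))

/-- The inclusion of `𝔛` in `Mat(n+1,n)`. -/
def minorVarietyι (k : Type u) [Field k] (n : ℕ) :
    minorVariety k n ⟶ matSpace n (Spec (.of k)) :=
  Spec.map (CommRingCat.ofHom (Ideal.Quotient.mk (minorIdeal k n).radical)) ≫
    (AffineSpace.SpecIso (MatIdx n) (.of k)).inv

/-! ### Vector subbundles and resolutions of singularities -/

/-- The closed immersion `i : E ⟶ 𝔸(ι; B)` is the total space of a vector subbundle of rank `r` of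
the trivial vector bundle with fibre `𝔸^ι` on `B`: every point of `B` has an open neighbourhood `U`
such that `E` restricted to `U` is the isomorphic image of the trivial bundle `𝔸^r` on `U` under the
linear map given by a matrix `M` of functions on `U`. -/
structure IsVectorSubbundle {ι : Type u} {B E : Scheme.{u}} (i : E ⟶ 𝔸(ι; B)) (r : ℕ) : Prop where
  isClosedImmersion : IsClosedImmersion i
  exists_trivialization : ∀ b : B, ∃ U : B.Opens, b ∈ U ∧
    ∃ (M : ι → ULift.{u} (Fin r) → Γ(U, ⊤))
      (e : 𝔸(ULift.{u} (Fin r); U) ≅ ((i ≫ 𝔸(ι; B) ↘ B) ⁻¹ᵁ U : E.Opens)),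
      e.hom ≫ ((i ≫ 𝔸(ι; B) ↘ B) ⁻¹ᵁ U).ι ≫ i =
        AffineSpace.homOfVector (𝔸(ULift.{u} (Fin r); U) ↘ (U : Scheme.{u}) ≫ U.ι) fun s ↦
          ∑ c, (𝔸(ULift.{u} (Fin r); U) ↘ (U : Scheme.{u})).appTop (M s c) *
            AffineSpace.coord (U : Scheme.{u}) c

/-- The morphism `f : Z ⟶ X` is a resolution of singularities of the reduced `S`-scheme `X`
(for `S` the spectrum of a field of characteristic zero and `s` the structure morphism of `X`):
`Z` is smooth over `S`, and `f` is proper and birational, that is, an isomorphism over a dense open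
subset of `X` with dense preimage in `Z`. -/
structure IsResolutionOfSingularities {Z X S : Scheme.{u}} (f : Z ⟶ X) (s : X ⟶ S) : Prop where
  isReduced : IsReduced X
  smooth : Smooth (f ≫ s)
  isProper : IsProper f
  birational : ∃ U : X.Opens, Dense (U : Set X) ∧ Dense ((f ⁻¹ᵁ U : Z.Opens) : Set Z) ∧
    IsIso (f ∣_ U)

end

end MatrixResolution

namespace MatrixResolution

noncomputable section

attribute [local instance] MvPolynomial.gradedAlgebra

/-! Choose a basis `w`, `v` of `W₂` with `w` spanning `W₁`. Incidence of `B` with the flag says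
exactly that `B w = 0` and `B v = c (w, 0)` for some scalar `c` (`incident_ofPair_iff`). Where `wᵢ`
and `wᵢ vⱼ - wⱼ vᵢ` are nonzero, the basis has a unique normalization `wᵢ = 1`, `vᵢ = 0`, `vⱼ = 1`,
with `2n - 3` free entries. A Plücker relation shows that these affine spaces cover the flag variety
(`exists_mem_range_of_mem_closure`, `exists_flagChart`). Over such a chart, an incident matrix is
freely given by `c` and its columns other than `i` and `j`, that is, by `1 + (n - 2)(n + 1) = n² - n
- 1` linear coordinates (`exists_incidenceChart`). This gives the bundle structure, smoothness and
the dimension. Irreducibility follows because the charts are irreducible and have a point in common.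

The image is `𝔛` by column operations on `M`, which is `Y + B` with one row removed. If `B` is
incident, then `M w = y w'` and `M v = y v' + c w'`; replacing two columns by these leaves the
determinant unchanged and makes it divisible by `y²` (`minorsDvd_of_mulVec`). Conversely, the
coefficients of `y⁰` give a kernel vector `w`, and those of `y¹` give either a second kernel vector
or a solution of `B v = (w, 0)` (`exists_incident_of_minorsDvd`). Since rational points are dense,
this yields the factorization through `𝔛` and the surjectivity of `ρ`; properness comes from that of
the flag variety.

For birationality no inverse is written down. Where `cornerPoly` is invertible, Cramer's rule
recovers the normalized `w`, `v` from `B` over any commutative ring (`eq_of_isUnit_cornerPoly`), so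
`ρ` is a monomorphism there. A proper monomorphism is a closed immersion, and a surjective closed
immersion into a reduced scheme is an isomorphism (`isIso_resolution_restrict`). A nilpotent Jordan
block shows that this open set meets `𝔛`. -/

/-- The indices other than `i`. -/
abbrev OtherIdx {ι : Type} (i : ι) : Type u := ULift.{u} {l : ι // l ≠ i}

open Classical in
/-- The vector with `i`-th coordinate `1` and other coordinates given by `c`. -/
def extendOne {ι : Type} {R : Type*} [CommRing R] (i : ι) (c : OtherIdx.{u} i → R) (l : ι) : R :=
  if h : l = i then 1 else c ⟨l, h⟩

/-! ### Dehomogenization of polynomials. -/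

section extendOne

variable {ι : Type} {R S : Type*} [CommRing R] [CommRing S] (i : ι)

@[simp]
lemma extendOne_self (c : OtherIdx.{u} i → R) : extendOne i c i = 1 := by
  simp [extendOne]

lemma extendOne_of_ne (c : OtherIdx.{u} i → R) {l : ι} (h : l ≠ i) :
    extendOne i c l = c ⟨l, h⟩ := by
  simp [extendOne, h]

@[simp]
lemma extendOne_other (c : OtherIdx.{u} i → R) (l : OtherIdx.{u} i) :
    extendOne i c l.down = c l :=
  extendOne_of_ne i c l.down.2

lemma map_extendOne (f : R →+* S) (c : OtherIdx.{u} i → R) (l : ι) :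
    f (extendOne i c l) = extendOne i (f ∘ c) l := by
  unfold extendOne
  split_ifs <;> simp

lemma extendOne_restrict (w : ι → R) (h : w i = 1) :
    extendOne i (fun l : OtherIdx.{u} i ↦ w l.down) = w := by
  ext l
  by_cases hl : l = i
  · subst hl; simp [h]
  · rw [extendOne_of_ne _ _ hl]

end extendOne

/-- Each monomial of degree `d` absorbs one factor `t` per variable. With `t` the image of `X i`,
this compares a form with its dehomogenization. -/
lemma map_mul_pow_of_isHomogeneous {R S : Type*} [CommSemiring R] [CommSemiring S] {ι : Type*}
    (A B : MvPolynomial ι R →+* S) (t : S) (hC : ∀ c, A (.C c) = B (.C c))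
    (hX : ∀ l, A (.X l) * t = B (.X l)) {a : MvPolynomial ι R} {d : ℕ} (ha : a.IsHomogeneous d) :
    A a * t ^ d = B a := by
  conv_lhs => rw [← MvPolynomial.support_sum_monomial_coeff a]
  conv_rhs => rw [← MvPolynomial.support_sum_monomial_coeff a]
  rw [map_sum, map_sum, Finset.sum_mul]
  refine Finset.sum_congr rfl fun m hm ↦ ?_
  have hd : m.degree = d := by
    rw [Finsupp.degree_eq_weight_one]
    exact ha (MvPolynomial.mem_support_iff.mp hm)
  rw [MvPolynomial.monomial_eq, map_mul, map_mul, hC, mul_assoc]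
  congr 1
  rw [Finsupp.prod, map_prod, map_prod, ← hd, Finsupp.degree_apply, ← Finset.prod_pow_eq_pow_sum,
    ← Finset.prod_mul_distrib]
  refine Finset.prod_congr rfl fun l _ ↦ ?_
  rw [map_pow, map_pow, ← mul_pow, hX]

section chart

variable (k : Type u) [Field k] {ι : Type} (i : ι)

lemma X_mem_homogeneousSubmodule :
    (MvPolynomial.X i : MvPolynomial ι k) ∈ MvPolynomial.homogeneousSubmodule ι k 1 :=
  MvPolynomial.isHomogeneous_X k i

/-- The degree zero part of `k[X]_(X i)`. -/
abbrev ProjAway : Type u :=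
  HomogeneousLocalization.Away (MvPolynomial.homogeneousSubmodule ι k) (MvPolynomial.X i)

/-- The ring homomorphism from `k[X]` localized at `X i` which sets `X i` to `1`. -/
def dehomogLocalization : Localization.Away (MvPolynomial.X i : MvPolynomial ι k) →+*
    MvPolynomial (OtherIdx.{u} i) k :=
  IsLocalization.Away.lift (S := Localization.Away (MvPolynomial.X i : MvPolynomial ι k))
    (MvPolynomial.X i)
    (g := (MvPolynomial.aeval (R := k) (extendOne i (MvPolynomial.X))).toRingHom)
    (by simp)

lemma dehomogLocalization_mk (a : MvPolynomial ι k) (s : Submonoid.powers (MvPolynomial.X i)) :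
    dehomogLocalization k i (Localization.mk a s) =
      MvPolynomial.aeval (extendOne i (MvPolynomial.X : OtherIdx.{u} i → _)) a := by
  obtain ⟨_, n, rfl⟩ := s
  rw [Localization.mk_eq_mk', dehomogLocalization, IsLocalization.Away.lift,
    IsLocalization.lift_mk'_spec]
  simp

/-- Dehomogenization with respect to the variable `X i`. -/
def dehomog : ProjAway k i →+* MvPolynomial (OtherIdx.{u} i) k :=
  (dehomogLocalization k i).comp (algebraMap _ _)

lemma dehomog_mk (d : ℕ) (a : MvPolynomial ι k)
    (ha : a ∈ MvPolynomial.homogeneousSubmodule ι k (d • 1)) :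
    dehomog k i (.mk _ (X_mem_homogeneousSubmodule k i) d a ha) =
      MvPolynomial.aeval (extendOne i (MvPolynomial.X : OtherIdx.{u} i → _)) a := by
  rw [dehomog, RingHom.comp_apply, HomogeneousLocalization.algebraMap_apply,
    HomogeneousLocalization.Away.val_mk, dehomogLocalization_mk]

/-- The function `X l / X i`. -/
def ratio (l : ι) : ProjAway k i :=
  .mk _ (X_mem_homogeneousSubmodule k i) 1 (MvPolynomial.X l) (X_mem_homogeneousSubmodule k l)

/-- The structure map of `k[X]_(X i)`. -/
def awayAlgebraMap : k →+* ProjAway k i :=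
  (HomogeneousLocalization.fromZeroRingHom _ _).comp
    (algebraMap k (MvPolynomial.homogeneousSubmodule ι k 0))

lemma awayAlgebraMap_val (c : k) :
    (awayAlgebraMap k i c).val = Localization.mk (MvPolynomial.C c) 1 :=
  rfl

lemma dehomog_awayAlgebraMap (c : k) :
    dehomog k i (awayAlgebraMap k i c) = MvPolynomial.C c := by
  rw [dehomog, RingHom.comp_apply, HomogeneousLocalization.algebraMap_apply, awayAlgebraMap_val,
    dehomogLocalization_mk]
  simp

/-- Homogenization. -/
def homog : MvPolynomial (OtherIdx.{u} i) k →+* ProjAway k i :=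
  MvPolynomial.eval₂Hom (awayAlgebraMap k i) fun l ↦ ratio k i l.down

lemma dehomog_homog (p : MvPolynomial (OtherIdx.{u} i) k) : dehomog k i (homog k i p) = p := by
  suffices (dehomog k i).comp (homog k i) = RingHom.id _ from congr($this p)
  apply MvPolynomial.ringHom_ext
  · simp [homog, dehomog_awayAlgebraMap]
  · intro l
    simp only [homog, ratio, RingHom.comp_apply, MvPolynomial.coe_eval₂Hom, MvPolynomial.eval₂_X,
      RingHom.id_apply]
    rw [dehomog_mk, MvPolynomial.aeval_X, extendOne_other]

/-- A fraction `a / X i ^ d` is hit by `a` with `X i` set to `1`; the comparison is made in the full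
localization, where `map_mul_pow_of_isHomogeneous` supplies the factor `X i ^ d`. -/
lemma homog_surjective : Function.Surjective (homog.{u} k i) := by
  intro x
  obtain ⟨d, a, ha, rfl⟩ := HomogeneousLocalization.Away.mk_surjective _
    (X_mem_homogeneousSubmodule k i) x
  refine ⟨MvPolynomial.aeval (R := k) (extendOne i (MvPolynomial.X (R := k))) a, ?_⟩
  have ha' : a.IsHomogeneous d := by
    simpa [smul_eq_mul, mul_one] using ha
  have h := map_mul_pow_of_isHomogeneous
    (((algebraMap (ProjAway k i) (Localization.Away (MvPolynomial.X i : MvPolynomial ι k))).comp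
      (homog.{u} k i)).comp (MvPolynomial.aeval (R := k) (extendOne i (MvPolynomial.X (R := k)))).toRingHom)
    (algebraMap _ (Localization.Away (MvPolynomial.X i : MvPolynomial ι k)))
    (algebraMap _ _ (MvPolynomial.X i : MvPolynomial ι k)) (fun c ↦ ?_) (fun l ↦ ?_) ha'
  · rw [HomogeneousLocalization.ext_iff_val, HomogeneousLocalization.Away.val_mk,
      Localization.mk_eq_mk', IsLocalization.eq_mk'_iff_mul_eq, ← h, map_pow]
    rfl
  · simp only [RingHom.comp_apply, AlgHom.toRingHom_eq_coe, RingHom.coe_coe, homog]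
    rw [← MvPolynomial.algebraMap_eq, AlgHom.commutes, MvPolynomial.algebraMap_eq,
      MvPolynomial.coe_eval₂Hom, MvPolynomial.eval₂_C, HomogeneousLocalization.algebraMap_apply,
      awayAlgebraMap_val, Localization.mk_one_eq_algebraMap]
    rfl
  · simp only [RingHom.comp_apply, AlgHom.toRingHom_eq_coe, RingHom.coe_coe, homog]
    rw [MvPolynomial.aeval_X]
    by_cases hl : l = i
    · subst hl
      rw [extendOne_self, map_one, map_one, one_mul]
    · rw [extendOne_of_ne _ _ hl, MvPolynomial.coe_eval₂Hom, MvPolynomial.eval₂_X,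
        HomogeneousLocalization.algebraMap_apply, ratio, HomogeneousLocalization.Away.val_mk,
        Localization.mk_eq_mk']
      convert IsLocalization.mk'_spec .. using 2
      simp

lemma dehomog_bijective : Function.Bijective (dehomog.{u} k i) :=
  Function.bijective_iff_has_inverse.mpr ⟨homog k i, fun x ↦ by
    obtain ⟨y, rfl⟩ := homog_surjective k i x
    rw [dehomog_homog], dehomog_homog k i⟩

end chart

/-! ### Functions and rational points on affine space. -/

section

variable (k : Type u) [Field k]

/-- The function on affine space over `k` given by a polynomial. -/
def polyFun (σ : Type u) : MvPolynomial σ k →+* Γ(𝔸(σ; Spec (.of k)), ⊤) :=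
  MvPolynomial.eval₂Hom ((Scheme.ΓSpecIso (.of k)).inv ≫
    (𝔸(σ; Spec (.of k)) ↘ Spec (.of k)).appTop).hom (AffineSpace.coord _)

lemma SpecIso_hom_appTop_inv {σ : Type u} (p : MvPolynomial σ k) :
    (AffineSpace.SpecIso σ (.of k)).hom.appTop
      ((Scheme.ΓSpecIso (.of (MvPolynomial σ k))).inv p) = polyFun k σ p := by
  rw [AffineSpace.SpecIso_hom_appTop]
  simp [polyFun]

lemma SpecIso_hom_preimage_basicOpen {σ : Type u} (p : MvPolynomial σ k) :
    (AffineSpace.SpecIso σ (.of k)).hom ⁻¹ᵁ PrimeSpectrum.basicOpen p =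
      Scheme.basicOpen _ (polyFun k σ p) := by
  rw [← SpecIso_hom_appTop_inv, ← Scheme.preimage_basicOpen_top]
  rw [basicOpen_eq_of_affine]

/-- The `k`-point of affine space with coordinates `c`. -/
def affinePoint {σ : Type u} (c : σ → k) : Spec (.of k) ⟶ 𝔸(σ; Spec (.of k)) :=
  AffineSpace.homOfVector (𝟙 _) fun s ↦ (Scheme.ΓSpecIso (.of k)).inv (c s)

@[simp]
lemma affinePoint_over {σ : Type u} (c : σ → k) :
    affinePoint k c ≫ 𝔸(σ; Spec (.of k)) ↘ Spec (.of k) = 𝟙 _ :=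
  AffineSpace.homOfVector_over _ _

lemma affinePoint_appTop_coord {σ : Type u} (c : σ → k) (s : σ) :
    (affinePoint k c).appTop (AffineSpace.coord _ s) = (Scheme.ΓSpecIso (.of k)).inv (c s) :=
  AffineSpace.homOfVector_appTop_coord _ _ _

lemma affinePoint_appTop_polyFun {σ : Type u} (c : σ → k) (p : MvPolynomial σ k) :
    (affinePoint k c).appTop (polyFun k σ p) = (Scheme.ΓSpecIso (.of k)).inv (p.eval c) := by
  suffices ((affinePoint k c).appTop.hom.comp (polyFun k σ)) =
    (Scheme.ΓSpecIso (.of k)).inv.hom.comp (MvPolynomial.eval c) from congr($this p)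
  apply MvPolynomial.ringHom_ext
  · intro a
    have h := affinePoint_over k c
    have := congr(Scheme.Hom.appTop $h ((Scheme.ΓSpecIso (.of k)).inv a))
    simp only [Scheme.Hom.comp_appTop, CommRingCat.comp_apply, Scheme.Hom.id_appTop] at this
    simpa [polyFun] using this
  · intro s
    simpa [polyFun] using affinePoint_appTop_coord k c s

lemma exists_affinePoint {σ : Type u} (x : Spec (.of k) ⟶ 𝔸(σ; Spec (.of k)))
    (hx : x ≫ 𝔸(σ; Spec (.of k)) ↘ Spec (.of k) = 𝟙 _) : ∃ c : σ → k, x = affinePoint k c := by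
  refine ⟨fun s ↦ (Scheme.ΓSpecIso (.of k)).hom (x.appTop (AffineSpace.coord _ s)), ?_⟩
  apply AffineSpace.hom_ext
  · simpa using hx
  · intro s
    rw [affinePoint_appTop_coord]
    simp

/-- The unique point of `Spec k`. -/
def fieldPoint : Spec (.of k) := IsLocalRing.closedPoint k

variable {k} in
/-- A `k`-point lies in the basic open subset of `h` if and only if `h` does not vanish there. -/
lemma mem_basicOpen_iff_appTop_ne_zero {Y : Scheme.{u}} (x : Spec (.of k) ⟶ Y) (h : Γ(Y, ⊤))
    (p : Spec (.of k)) : x p ∈ Y.basicOpen h ↔ x.appTop h ≠ 0 := by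
  change p ∈ x ⁻¹ᵁ Y.basicOpen h ↔ _
  rw [Scheme.preimage_basicOpen_top]
  constructor
  · intro hp h0
    rw [h0, Scheme.basicOpen_zero] at hp
    exact hp
  · intro h0
    let e := (Scheme.ΓSpecIso (.of k)).commRingCatIsoToRingEquiv
    have h1 : IsUnit (x.appTop h) := by
      rw [← MulEquiv.isUnit_map e]
      exact IsUnit.mk0 _ ((map_ne_zero_iff e e.injective).mpr h0)
    rw [Scheme.basicOpen_of_isUnit _ h1]
    trivial

end

/-! ### Affine charts, rational points and properness of projective space. -/

section chart

variable (k : Type u) [Field k] {ι : Type} (i : ι)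

instance : IsIso (Spec.map (CommRingCat.ofHom (dehomog.{u} k i))) := by
  have : IsIso (CommRingCat.ofHom (dehomog.{u} k i)) := by
    rw [ConcreteCategory.isIso_iff_bijective]
    exact dehomog_bijective k i
  infer_instance

/-- The affine chart of projective space on which the `i`-th coordinate does not vanish. -/
def chartι : 𝔸(OtherIdx.{u} i; Spec (.of k)) ⟶ projSpace k ι :=
  (AffineSpace.SpecIso (OtherIdx i) (.of k)).hom ≫ Spec.map (CommRingCat.ofHom (dehomog k i)) ≫
    Proj.awayι _ (MvPolynomial.X i) (X_mem_homogeneousSubmodule k i) one_pos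

instance : IsOpenImmersion (chartι k i) := by
  unfold chartι; infer_instance

lemma opensRange_chartι : (chartι k i).opensRange =
    Proj.basicOpen (MvPolynomial.homogeneousSubmodule ι k) (MvPolynomial.X i) := by
  rw [← Proj.opensRange_awayι _ _ (X_mem_homogeneousSubmodule k i) one_pos]
  exact (Scheme.Hom.opensRange_comp_of_isIso _ _).trans (Scheme.Hom.opensRange_comp_of_isIso _ _)

lemma chartι_str : chartι k i ≫ projSpaceStr k ι =
    𝔸(OtherIdx.{u} i; Spec (.of k)) ↘ Spec (.of k) := by
  rw [chartι, projSpaceStr, Category.assoc, Category.assoc, Proj.awayι_toSpecZero_assoc,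
    ← Spec.map_comp, ← Spec.map_comp, ← Iso.eq_inv_comp, AffineSpace.SpecIso_inv_over]
  congr 1
  refine CommRingCat.hom_ext (RingHom.ext fun c ↦ ?_)
  exact dehomog_awayAlgebraMap k i c

lemma chartι_preimage_basicOpen (r : MvPolynomial ι k)
    (hr : r ∈ MvPolynomial.homogeneousSubmodule ι k 1) :
    chartι k i ⁻¹ᵁ Proj.basicOpen _ r = Scheme.basicOpen _
      (polyFun k _ (MvPolynomial.aeval (extendOne i (MvPolynomial.X (R := k))) r)) := by
  rw [chartι, Scheme.Hom.comp_preimage, Scheme.Hom.comp_preimage,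
    Proj.awayι_preimage_basicOpen _ _ one_pos hr one_pos, ← SpecIso_hom_preimage_basicOpen]
  congr 1
  refine congrArg PrimeSpectrum.basicOpen ((dehomog_mk k i _ _ _).trans ?_)
  rw [pow_one]

variable {k} in
lemma projPoint_preimage_basicOpen (w : ι → k) (hw : w ≠ 0) (r : MvPolynomial ι k)
    (hr : r ∈ MvPolynomial.homogeneousSubmodule ι k 1) (p : Spec (.of k)) :
    projPoint k w hw p ∈ Proj.basicOpen _ r ↔ r.eval w ≠ 0 := by
  change p ∈ projPoint k w hw ⁻¹ᵁ Proj.basicOpen _ r ↔ _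
  rw [projPoint, Proj.fromOfGlobalSections_preimage_basicOpen _ _ _ one_pos hr]
  refine (mem_basicOpen_iff_appTop_ne_zero (𝟙 _) (evalAt k w r) p).trans ?_
  simp [evalAt]

variable {k} in
lemma chartι_point_basicOpen (c : OtherIdx.{u} i → k) (r : MvPolynomial ι k)
    (hr : r ∈ MvPolynomial.homogeneousSubmodule ι k 1) (p : Spec (.of k)) :
    (affinePoint k c ≫ chartι k i) p ∈ Proj.basicOpen _ r ↔ r.eval (extendOne i c) ≠ 0 := by
  change affinePoint k c p ∈ chartι k i ⁻¹ᵁ Proj.basicOpen _ r ↔ _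
  rw [chartι_preimage_basicOpen _ _ _ hr, mem_basicOpen_iff_appTop_ne_zero,
    affinePoint_appTop_polyFun]
  have : MvPolynomial.eval c (MvPolynomial.aeval (extendOne i (MvPolynomial.X (R := k))) r) =
      MvPolynomial.eval (extendOne i c) r := by
    suffices (MvPolynomial.eval c).comp (MvPolynomial.aeval (extendOne i
      (MvPolynomial.X (R := k)))).toRingHom = MvPolynomial.eval (extendOne i c) from congr($this r)
    apply MvPolynomial.ringHom_ext
    · simp
    · intro l
      simp only [AlgHom.toRingHom_eq_coe, RingHom.comp_apply, RingHom.coe_coe,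
        MvPolynomial.aeval_X, map_extendOne, MvPolynomial.eval_X]
      congr 1
      ext s
      simp
  rw [this, ne_eq, map_eq_zero_iff]
  exact (Scheme.ΓSpecIso (.of k)).symm.commRingCatIsoToRingEquiv.injective

/-- Two `k`-points of projective space. -/
lemma projPoint_eq (w : ι → k) (hw : w ≠ 0) (hi : w i ≠ 0) :
    projPoint k w hw = affinePoint k (fun l : OtherIdx.{u} i ↦ w l.down / w i) ≫ chartι k i := by
  have hr : Set.range (projPoint k w hw) ⊆ Set.range (chartι.{u} k i) := by
    rintro _ ⟨p, rfl⟩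
    change _ ∈ (chartι k i).opensRange
    rw [opensRange_chartι, projPoint_preimage_basicOpen _ _ _ (X_mem_homogeneousSubmodule k i)]
    simpa
  obtain ⟨c, hc⟩ := exists_affinePoint k (IsOpenImmersion.lift (chartι.{u} k i) _ hr) (by
    rw [← chartι_str, IsOpenImmersion.lift_fac_assoc, projPoint_str])
  have h1 : projPoint k w hw = affinePoint k c ≫ chartι k i := by
    rw [← hc, IsOpenImmersion.lift_fac]
  rw [h1]
  congr 2
  ext l
  -- The linear form `w i * X l - w l * X i` vanishes at `[w]`. Testing it at the chart point with
  -- unknown coordinates `c` gives `w i * c l = w l`.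
  have hm : MvPolynomial.C (w i) * MvPolynomial.X (l.down : ι) -
      MvPolynomial.C (w l.down) * MvPolynomial.X i ∈ MvPolynomial.homogeneousSubmodule ι k 1 :=
    Submodule.sub_mem _ (MvPolynomial.isHomogeneous_C_mul_X _ _)
      (MvPolynomial.isHomogeneous_C_mul_X _ _)
  have h2 := projPoint_preimage_basicOpen w hw _ hm (fieldPoint k)
  rw [h1, chartι_point_basicOpen _ _ _ hm, not_iff_not] at h2
  simp only [map_sub, map_mul, MvPolynomial.eval_C, MvPolynomial.eval_X, extendOne_other,
    extendOne_self] at h2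
  rw [eq_div_iff hi]
  linear_combination h2.mpr (by ring)

lemma adjoin_range_X_homogeneousSubmodule_zero :
    Algebra.adjoin (MvPolynomial.homogeneousSubmodule ι k 0)
      (Set.range (MvPolynomial.X : ι → MvPolynomial ι k)) = ⊤ := by
  rw [eq_top_iff]
  rintro p -
  induction p using MvPolynomial.induction_on with
  | C a =>
    exact Subalgebra.algebraMap_mem _ (algebraMap k (MvPolynomial.homogeneousSubmodule ι k 0) a)
  | add p q hp hq => exact add_mem hp hq
  | mul_X p i hp => exact mul_mem hp (Algebra.subset_adjoin ⟨i, rfl⟩)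

lemma iSup_basicOpen_X : ⨆ i, Proj.basicOpen (MvPolynomial.homogeneousSubmodule ι k)
    (MvPolynomial.X i) = ⊤ :=
  Proj.iSup_basicOpen_eq_top' _ _ (fun i ↦ ⟨1, X_mem_homogeneousSubmodule k i⟩)
    (adjoin_range_X_homogeneousSubmodule_zero k)

lemma exists_mem_opensRange_chartι (x : projSpace k ι) :
    ∃ i, x ∈ (chartι.{u} k i).opensRange := by
  have : x ∈ (⊤ : (projSpace k ι).Opens) := trivial
  rw [← iSup_basicOpen_X, TopologicalSpace.Opens.mem_iSup] at this
  obtain ⟨i, hi⟩ := this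
  exact ⟨i, by rwa [opensRange_chartι]⟩

instance [Finite ι] : Algebra.FiniteType (MvPolynomial.homogeneousSubmodule ι k 0)
    (MvPolynomial ι k) :=
  ⟨Subalgebra.fg_def.mpr ⟨_, Set.finite_range _, adjoin_range_X_homogeneousSubmodule_zero k⟩⟩

/-- Forms of degree zero are constants; this transfers properness of `Proj` over its degree zero
part to properness over `k`. -/
instance : IsIso (Spec.map (CommRingCat.ofHom (algebraMap k
    (MvPolynomial.homogeneousSubmodule ι k 0)))) := by
  have : IsIso (CommRingCat.ofHom (algebraMap k (MvPolynomial.homogeneousSubmodule ι k 0))) := by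
    rw [ConcreteCategory.isIso_iff_bijective]
    refine ⟨fun a b hab ↦ MvPolynomial.C_injective ι k congr(($hab).1), fun ⟨x, hx⟩ ↦ ?_⟩
    refine ⟨x.coeff 0, Subtype.ext ?_⟩
    exact (MvPolynomial.totalDegree_eq_zero_iff_eq_C.mp
      ((MvPolynomial.totalDegree_zero_iff_isHomogeneous _).mpr hx)).symm
  infer_instance

instance [Finite ι] : IsProper (projSpaceStr k ι) := by
  unfold projSpaceStr; infer_instance

end chart

/-! ### Reduced closed subschemes determined by their underlying sets. -/

section closed

open Scheme.IdealSheafData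

/-- Reducedness of the source makes the kernel radical, and a radical ideal sheaf is determined by
its support, here the closure of the image. -/
lemma ker_eq_vanishingIdeal {X Y : Scheme.{u}} [IsReduced Y] (g : Y ⟶ X) [QuasiCompact g] :
    g.ker = vanishingIdeal ⟨closure (Set.range g), isClosed_closure⟩ := by
  have h1 : g.ker.radical = g.ker := by
    apply Scheme.IdealSheafData.ext
    ext1 U
    rw [radical_ideal, g.ker_apply]
    refine Ideal.IsRadical.radical fun x hx ↦ ?_
    obtain ⟨m, hm⟩ := hx
    rw [RingHom.mem_ker, map_pow] at hm
    exact eq_zero_of_pow_eq_zero hm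
  rw [← h1, ← vanishingIdeal_support]
  congr 1
  exact TopologicalSpace.Closeds.ext g.support_ker

lemma ker_le_ker_of_range_subset {X Y Z : Scheme.{u}} (f : X ⟶ Z) (g : Y ⟶ Z) [IsReduced X]
    [IsReduced Y] [QuasiCompact f] [QuasiCompact g] (h : Set.range g ⊆ Set.range f) :
    f.ker ≤ g.ker := by
  rw [ker_eq_vanishingIdeal, ker_eq_vanishingIdeal]
  apply vanishingIdeal_antimono
  rw [← SetLike.coe_subset_coe]
  exact closure_mono h

instance isReduced_vanishingIdeal_subscheme {X : Scheme.{u}} (Z : TopologicalSpace.Closeds X) :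
    IsReduced (vanishingIdeal Z).subscheme := by
  have (i : X.affineOpens) : AlgebraicGeometry.IsReduced
      ((vanishingIdeal Z).subschemeCover.openCover.X i) := by
    have : _root_.IsReduced (Γ(X, i.1) ⧸ (vanishingIdeal Z).ideal i) := by
      rw [← Ideal.isRadical_iff_quotient_reduced, vanishingIdeal_ideal]
      exact PrimeSpectrum.isRadical_vanishingIdeal _
    exact inferInstanceAs (AlgebraicGeometry.IsReduced (Spec (.of (Γ(X, i.1) ⧸ (vanishingIdeal Z).ideal i))))
  have (i : (vanishingIdeal Z).subschemeCover.openCover.I₀) : AlgebraicGeometry.IsReduced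
      ((vanishingIdeal Z).subschemeCover.openCover.X i) := this i
  exact IsReduced.of_openCover _ (vanishingIdeal Z).subschemeCover.openCover

lemma range_reducedClosureι {X : Scheme.{u}} (S : Set X) :
    Set.range (reducedClosureι S) = closure S := by
  rw [reducedClosureι, range_subschemeι, coe_support_vanishingIdeal]
  rfl

/-- The identity is a closed immersion, and a separated second factor can be cancelled. Both the
flag charts and the bundle charts are shown to be closed by an explicit retraction. -/
lemma isClosedImmersion_of_comp_eq_id_of_isSeparated {X Y : Scheme.{u}} (f : X ⟶ Y) (g : Y ⟶ X)
    [IsSeparated g] (h : f ≫ g = 𝟙 X) : IsClosedImmersion f := by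
  have : IsClosedImmersion (f ≫ g) := h ▸ inferInstance
  exact IsClosedImmersion.of_comp f g

/-- Two closed immersions of reduced schemes with the same image are isomorphic. -/
lemma exists_iso_of_range_eq {X Y Z : Scheme.{u}} (f : X ⟶ Z) (g : Y ⟶ Z) [IsReduced X]
    [IsReduced Y] [IsClosedImmersion f] [IsClosedImmersion g] (h : Set.range g = Set.range f) :
    ∃ e : Y ≅ X, e.hom ≫ f = g :=
  ⟨⟨IsClosedImmersion.lift f g (ker_le_ker_of_range_subset f g h.le),
    IsClosedImmersion.lift g f (ker_le_ker_of_range_subset g f h.ge),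
    by rw [← cancel_mono g]; simp, by rw [← cancel_mono f]; simp⟩, by simp⟩

/-- The device that turns a parametrization into a chart. Density puts the image inside `closure S`;
closedness of `φ` in `V` together with `h1` gives the reverse inclusion. So `Y` and the part of
`reducedClosure S` over `V` are reduced closed subschemes of `V` with the same points. -/
lemma exists_iso_reducedClosure {X V Y : Scheme.{u}} (S : Set X) (j : V ⟶ X) [IsOpenImmersion j]
    (φ : Y ⟶ V) [IsClosedImmersion φ] [IsReduced Y] (h1 : S ∩ Set.range j ⊆ Set.range (φ ≫ j))
    (h2 : Dense ((φ ≫ j) ⁻¹' S)) :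
    ∃ e : Y ≅ (reducedClosureι S ⁻¹ᵁ j.opensRange : (reducedClosure S).Opens),
      e.hom ≫ (reducedClosureι S ⁻¹ᵁ j.opensRange).ι ≫ reducedClosureι S = φ ≫ j := by
  have hφ : Set.range (φ ≫ j) = closure S ∩ Set.range j := by
    apply subset_antisymm
    · refine Set.subset_inter ?_ ?_
      · rintro _ ⟨y, rfl⟩
        exact closure_mono (Set.image_preimage_subset _ _)
          (image_closure_subset_closure_image (φ ≫ j).continuous ⟨y, h2 y, rfl⟩)
      · rintro _ ⟨y, rfl⟩
        exact ⟨φ y, rfl⟩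
    · rintro _ ⟨hx, z, rfl⟩
      have hz : z ∈ closure (j ⁻¹' S) := by
        rwa [← j.isOpenEmbedding.isOpenMap.preimage_closure_eq_closure_preimage j.continuous]
      have h3 : j ⁻¹' S ⊆ Set.range φ := by
        intro w hw
        obtain ⟨y, hy⟩ := h1 ⟨hw, w, rfl⟩
        exact ⟨y, j.isOpenEmbedding.injective hy⟩
      obtain ⟨y, rfl⟩ := closure_minimal h3 φ.isClosedEmbedding.isClosed_range hz
      exact ⟨y, rfl⟩
  obtain ⟨e, he⟩ := exists_iso_of_range_eq (reducedClosureι S ∣_ j.opensRange)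
    (φ ≫ j.isoOpensRange.hom) (by
      apply (Set.image_injective.mpr j.opensRange.ι.isOpenEmbedding.injective)
      rw [← Set.range_comp, ← Set.range_comp]
      change Set.range ((φ ≫ j.isoOpensRange.hom) ≫ j.opensRange.ι) =
        Set.range ((reducedClosureι S ∣_ j.opensRange) ≫ j.opensRange.ι)
      rw [Category.assoc, Scheme.Hom.isoOpensRange_hom_ι, hφ, morphismRestrict_ι,
        Scheme.Hom.comp_base, TopCat.coe_comp, Set.range_comp, Scheme.Opens.range_ι]
      change _ = reducedClosureι S '' (reducedClosureι S ⁻¹' Set.range j)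
      rw [Set.image_preimage_eq_range_inter, range_reducedClosureι])
  refine ⟨e, ?_⟩
  rw [← morphismRestrict_ι, reassoc_of% he, Scheme.Hom.isoOpensRange_hom_ι]

end closed

/-! ### Density of rational points. -/

section points

variable {k : Type u} [Field k]

lemma eq_fieldPoint (p : Spec (.of k)) : p = fieldPoint k :=
  Subsingleton.elim _ _

lemma range_eq_singleton {Y : Scheme.{u}} (x : Spec (.of k) ⟶ Y) :
    Set.range x = {x (fieldPoint k)} := by
  ext y
  constructor
  · rintro ⟨p, rfl⟩
    rw [eq_fieldPoint p]
    rfl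
  · rintro rfl
    exact ⟨_, rfl⟩

variable [IsAlgClosed k]

/-- A scheme locally of finite type over a field is Jacobson, so `Z` contains a closed point, which
is rational because `k` is algebraically closed. -/
lemma exists_point_mem {Y : Scheme.{u}} (h : Y ⟶ Spec (.of k)) [LocallyOfFiniteType h] {Z : Set Y}
    (hZ : IsLocallyClosed Z) (hne : Z.Nonempty) :
    ∃ x : Spec (.of k) ⟶ Y, x ≫ h = 𝟙 _ ∧ x (fieldPoint k) ∈ Z := by
  have : JacobsonSpace Y := LocallyOfFiniteType.jacobsonSpace h
  have h1 := JacobsonSpace.closure_inter_closedPoints_eq_closure hZ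
  have h2 : (Z ∩ closedPoints Y).Nonempty := by
    rw [← closure_nonempty_iff, h1]
    exact hne.mono subset_closure
  obtain ⟨y, hy, hy' : IsClosed {y}⟩ := h2
  exact ⟨pointOfClosedPoint h y hy', pointOfClosedPoint_comp _ _ _, by
    rwa [pointOfClosedPoint_apply h y hy' (fieldPoint k)]⟩

lemma dense_of_forall_point_mem {Y : Scheme.{u}} (h : Y ⟶ Spec (.of k)) [LocallyOfFiniteType h]
    {D : Set Y} (hD : ∀ x : Spec (.of k) ⟶ Y, x ≫ h = 𝟙 _ → x (fieldPoint k) ∈ D) : Dense D := by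
  rw [dense_iff_inter_open]
  intro U hU hne
  obtain ⟨x, hx, hx'⟩ := exists_point_mem h hU.isLocallyClosed hne
  exact ⟨_, hx', hD x hx⟩

end points

/-! ### Dimension and irreducibility from open covers. -/

section topology

open TopologicalSpace Topology

/-- Every irreducible closed set meets some chart, and passing to an open set that it meets
preserves its coheight. -/
lemma topologicalKrullDim_eq_of_isOpenEmbedding_cover {X ι : Type*} [TopologicalSpace X] [Nonempty ι]
    {Y : ι → Type*} [∀ i, TopologicalSpace (Y i)] (f : ∀ i, Y i → X)
    (hf : ∀ i, IsOpenEmbedding (f i)) (hcover : ∀ x, ∃ i, x ∈ Set.range (f i)) {d : WithBot ℕ∞}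
    (hd : ∀ i, topologicalKrullDim (Y i) = d) : topologicalKrullDim X = d := by
  apply le_antisymm
  · rw [topologicalKrullDim, Order.krullDim_eq_iSup_coheight]
    refine iSup_le fun Z ↦ ?_
    obtain ⟨x, hx⟩ := Z.isIrreducible.nonempty
    obtain ⟨i, y, rfl⟩ := hcover x
    obtain ⟨T, hT⟩ := (IrreducibleCloseds.orderIsoOfIsOpenEmbedding (f i) (hf i)).surjective
      ⟨Z, y, hx⟩
    have h1 : IrreducibleCloseds.map (f i) (hf i).continuous T = Z := congr(($hT).1)
    rw [← h1, (hf i).coheight_map, ← hd i]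
    exact Order.coheight_le_krullDim T
  · inhabit ι
    rw [← hd default]
    exact (hf default).isInducing.topologicalKrullDim_le

lemma irreducibleSpace_of_isOpenEmbedding_cover {X ι : Type*} [TopologicalSpace X]
    {Y : ι → Type*} [∀ i, TopologicalSpace (Y i)] [∀ i, IrreducibleSpace (Y i)] (f : ∀ i, Y i → X)
    (hf : ∀ i, IsOpenEmbedding (f i)) (hcover : ∀ x, ∃ i, x ∈ Set.range (f i)) (x₀ : X)
    (hx₀ : ∀ i, x₀ ∈ Set.range (f i)) : IrreducibleSpace X := by
  have : Nonempty X := ⟨x₀⟩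
  have : PreirreducibleSpace X := by
    refine ⟨fun U V hU hV ⟨x, _, hx⟩ ⟨y, _, hy⟩ ↦ ?_⟩
    -- A nonempty open set is dense in each irreducible chart it meets, and all charts contain `x₀`.
    -- Hence any two nonempty open sets can be compared inside a single chart.
    have key (W : Set X) (hW : IsOpen W) (w : X) (hw : w ∈ W) : x₀ ∈ closure W := by
      obtain ⟨i, z, rfl⟩ := hcover w
      obtain ⟨z₀, rfl⟩ := hx₀ i
      have : Dense (f i ⁻¹' W) := (hW.preimage (hf i).continuous).dense ⟨z, hw⟩
      exact closure_mono (Set.image_preimage_subset _ _)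
        (image_closure_subset_closure_image (hf i).continuous ⟨z₀, this z₀, rfl⟩)
    obtain ⟨i, z, rfl⟩ := hcover x
    have h1 : (f i ⁻¹' V).Nonempty := by
      obtain ⟨z₀, rfl⟩ := hx₀ i
      obtain ⟨_, ⟨z', rfl⟩, hv⟩ := mem_closure_iff.mp (key V hV y hy) _ (hf i).isOpen_range ⟨z₀, rfl⟩
      exact ⟨z', hv⟩
    obtain ⟨z', h2, h3⟩ := (hU.preimage (hf i).continuous).dense ⟨z, hx⟩ |>.inter_open_nonempty _
      (hV.preimage (hf i).continuous) h1
    exact ⟨f i z', trivial, h3, h2⟩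
  exact ⟨inferInstance⟩

end topology

/-! ### Normalized bases of flags. -/

section coordinates

variable {n : ℕ} (i j : Fin n)

/-- The index set of the coordinates on the chart `wᵢ ≠ 0`, `wᵢ vⱼ - wⱼ vᵢ ≠ 0` of the flag
variety. -/
abbrev FlagIdx : Type u := ULift.{u} ({l : Fin n // l ≠ i} ⊕ {l : Fin n // l ≠ i ∧ l ≠ j})

variable {R S : Type*} [CommRing R] [CommRing S]

/-- The vector spanning the line, with `i`-th coordinate `1`. -/
def lineVec (t : FlagIdx.{u} i j → R) (l : Fin n) : R :=
  if h : l = i then 1 else t ⟨.inl ⟨l, h⟩⟩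

/-- The second vector spanning the plane, with `i`-th coordinate `0` and `j`-th coordinate `1`. -/
def planeVec (t : FlagIdx.{u} i j → R) (l : Fin n) : R :=
  if h : l = i then 0 else if h' : l = j then 1 else t ⟨.inr ⟨l, h, h'⟩⟩

lemma map_lineVec (f : R →+* S) (t : FlagIdx.{u} i j → R) (l : Fin n) :
    f (lineVec i j t l) = lineVec i j (f ∘ t) l := by
  unfold lineVec
  split_ifs <;> simp

lemma map_planeVec (f : R →+* S) (t : FlagIdx.{u} i j → R) (l : Fin n) :
    f (planeVec i j t l) = planeVec i j (f ∘ t) l := by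
  unfold planeVec
  split_ifs <;> simp

@[simp] lemma lineVec_self (t : FlagIdx.{u} i j → R) : lineVec i j t i = 1 := by
  simp [lineVec]

@[simp] lemma planeVec_left (t : FlagIdx.{u} i j → R) : planeVec i j t i = 0 := by
  simp [planeVec]

lemma planeVec_right (hij : i ≠ j) (t : FlagIdx.{u} i j → R) : planeVec i j t j = 1 := by
  simp [planeVec, hij.symm]

lemma lineVec_inl (t : FlagIdx.{u} i j → R) (l : {l : Fin n // l ≠ i}) :
    lineVec i j t l = t ⟨.inl l⟩ := by
  simp [lineVec, l.2]

lemma planeVec_inr (t : FlagIdx.{u} i j → R) (l : {l : Fin n // l ≠ i ∧ l ≠ j}) :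
    planeVec i j t l = t ⟨.inr l⟩ := by
  simp [planeVec, l.2.1, l.2.2]

/-- The Plücker coordinates over a commutative ring. -/
def pairWedge (w v : Fin n → R) (p : Fin n × Fin n) : R :=
  w p.1 * v p.2 - w p.2 * v p.1

/-- Because `w i = 1` and `v i = 0`, the Plücker coordinates `(i, l)` are the entries of `v`. This
is why the normalized basis can be read off from the Plücker coordinates. -/
lemma pairWedge_left (t : FlagIdx.{u} i j → R) (l : Fin n) :
    pairWedge (lineVec i j t) (planeVec i j t) (i, l) = planeVec i j t l := by
  simp [pairWedge]

lemma FlagIdx.ext_of_vec {t t' : FlagIdx.{u} i j → R} (h : lineVec i j t = lineVec i j t')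
    (h' : planeVec i j t = planeVec i j t') : t = t' := by
  ext ⟨s | s⟩
  · rw [← lineVec_inl i j t, h, lineVec_inl]
  · rw [← planeVec_inr i j t, h', planeVec_inr]

/-- The coordinates of a pair of normalized vectors. -/
def flagCoord (w v : Fin n → R) : FlagIdx.{u} i j → R
  | ⟨.inl l⟩ => w l
  | ⟨.inr l⟩ => v l

lemma lineVec_flagCoord {w v : Fin n → R} (hw : w i = 1) :
    lineVec i j (flagCoord.{u} i j w v) = w := by
  ext l
  unfold lineVec
  split_ifs with h
  · rw [h, hw]
  · rfl

lemma planeVec_flagCoord {w v : Fin n → R} (hi : v i = 0) (hj : v j = 1) :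
    planeVec i j (flagCoord.{u} i j w v) = v := by
  ext l
  unfold planeVec
  split_ifs with h h'
  · rw [h, hi]
  · rw [h', hj]
  · rfl

end coordinates

/-! ### Flags spanned by pairs of vectors. -/

section flags

variable {k : Type u} [Field k] {n : ℕ}

/-- The flag spanned by two linearly independent vectors. -/
def LinePlaneFlag.ofPair (w v : Fin n → k) (h : LinearIndependent k ![w, v]) :
    LinePlaneFlag k n where
  W₁ := Submodule.span k {w}
  W₂ := Submodule.span k {w, v}
  le := Submodule.span_mono (by simp)
  finrank_W₁ := finrank_span_singleton (h.ne_zero 0)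
  finrank_W₂ := by
    have h4 := finrank_span_eq_card h
    rwa [Matrix.range_cons_cons_empty, Fintype.card_fin] at h4

lemma LinePlaneFlag.eq_ofPair (W : LinePlaneFlag k n) {w v : Fin n → k}
    (h : LinearIndependent k ![w, v]) (hw : w ∈ W.W₁) (hv : v ∈ W.W₂) : W = ofPair w v h := by
  ext1
  · refine (Submodule.eq_of_le_of_finrank_eq ?_ ?_).symm
    · rwa [ofPair, Submodule.span_singleton_le_iff_mem]
    · rw [(ofPair w v h).finrank_W₁, W.finrank_W₁]
  · refine (Submodule.eq_of_le_of_finrank_eq ?_ ?_).symm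
    · rw [ofPair, Submodule.span_le]
      rintro x (rfl | rfl)
      exacts [W.le hw, hv]
    · rw [(ofPair w v h).finrank_W₂, W.finrank_W₂]

lemma LinePlaneFlag.W₁_eq (W : LinePlaneFlag k n) : W.W₁ = Submodule.span k {W.w} :=
  W.exists_basis.choose_spec.choose_spec.2.1

lemma LinePlaneFlag.W₂_eq (W : LinePlaneFlag k n) : W.W₂ = Submodule.span k {W.w, W.v} :=
  W.exists_basis.choose_spec.choose_spec.2.2

lemma linearIndependent_pair_of_wedge_ne_zero {w v : Fin n → k} {p : Fin n × Fin n}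
    (h : wedge w v p ≠ 0) : LinearIndependent k ![w, v] := by
  rw [LinearIndependent.pair_iff]
  intro s t hst
  have h1 := congrFun hst p.1
  have h2 := congrFun hst p.2
  simp only [Pi.add_apply, Pi.smul_apply, smul_eq_mul, Pi.zero_apply] at h1 h2
  simp only [wedge] at h
  constructor
  · refine (mul_eq_zero.mp (?_ : s * _ = 0)).resolve_right h
    linear_combination v p.2 * h1 - v p.1 * h2
  · refine (mul_eq_zero.mp (?_ : t * _ = 0)).resolve_right h
    linear_combination w p.1 * h2 - w p.2 * h1

lemma projPoint_smul {ι : Type} {w : ι → k} (hw : w ≠ 0) {a : k} (ha : a ≠ 0) (hw' : a • w ≠ 0) :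
    projPoint k (a • w) hw' = projPoint k w hw := by
  obtain ⟨i, hi⟩ := Function.ne_iff.mp hw
  rw [projPoint_eq k i w hw hi, projPoint_eq k i _ _ (by simpa [ha] using hi)]
  congr 2
  ext l
  simp [mul_div_mul_left _ _ ha]

lemma projPoint_congr {ι : Type} {w w' : ι → k} (h : w = w') (hw : w ≠ 0) (hw' : w' ≠ 0) :
    projPoint k w hw = projPoint k w' hw' := by
  subst h; rfl

lemma ne_zero_of_linearIndependent_pair {w v : Fin n → k} (h : LinearIndependent k ![w, v]) :
    w ≠ 0 :=
  h.ne_zero 0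

lemma LinePlaneFlag.plucker_eq (W : LinePlaneFlag k n) : W.plucker =
    pullback.lift (projPoint k W.w (ne_zero_of_linearIndependent_pair W.linearIndependent))
      (projPoint k (wedge W.w W.v) (wedge_ne_zero W.linearIndependent))
      ((projPoint_str k _ _).trans (projPoint_str k _ _).symm) :=
  rfl

/-- `plucker` is defined through a chosen basis. Any other adapted basis differs by `w ↦ a w`, `v ↦
b w + c v`, which scales `w ∧ v` by `a * c`. -/
lemma plucker_ofPair (w v : Fin n → k) (h : LinearIndependent k ![w, v]) :
    (LinePlaneFlag.ofPair w v h).plucker =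
      pullback.lift (projPoint k w (ne_zero_of_linearIndependent_pair h)) (projPoint k (wedge w v) (wedge_ne_zero h))
        ((projPoint_str k _ _).trans (projPoint_str k _ _).symm) := by
  set W := LinePlaneFlag.ofPair w v h with hW
  obtain ⟨a, ha⟩ : ∃ a : k, a • w = W.w := by
    rw [← Submodule.mem_span_singleton]
    change W.w ∈ W.W₁
    rw [W.W₁_eq]
    exact Submodule.mem_span_singleton_self _
  obtain ⟨b, c, hbc⟩ : ∃ b c : k, b • w + c • v = W.v := by
    rw [← Submodule.mem_span_pair]
    change W.v ∈ W.W₂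
    rw [W.W₂_eq]
    exact Submodule.subset_span (by simp)
  have hwedge : wedge W.w W.v = (a * c) • wedge w v := by
    rw [← ha, ← hbc]
    ext p
    simp only [wedge, Pi.smul_apply, Pi.add_apply, smul_eq_mul]
    ring
  have hne := wedge_ne_zero W.linearIndependent
  rw [hwedge] at hne
  have hac : a * c ≠ 0 := fun h0 ↦ hne (by rw [h0, zero_smul])
  rw [LinePlaneFlag.plucker_eq]
  congr 1
  · rw [← projPoint_smul _ (left_ne_zero_of_mul hac)
      (smul_ne_zero (left_ne_zero_of_mul hac)
        (ne_zero_of_linearIndependent_pair h))]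
    exact projPoint_congr ha.symm _ _
  · rw [← projPoint_smul _ hac hne]
    exact projPoint_congr hwedge _ _

variable (i j : Fin n) (hij : i ≠ j)

include hij in
lemma linearIndependent_lineVec_planeVec (t : FlagIdx.{u} i j → k) :
    LinearIndependent k ![lineVec i j t, planeVec i j t] :=
  linearIndependent_pair_of_wedge_ne_zero (p := (i, j)) (by
    simp [wedge, planeVec_right i j hij])

/-- The flag with the given coordinates. -/
def flagOf (t : FlagIdx.{u} i j → k) : LinePlaneFlag k n :=
  .ofPair _ _ (linearIndependent_lineVec_planeVec i j hij t)

lemma exists_flagOf_of_wedge_ne_zero (W : LinePlaneFlag k n) {w v : Fin n → k} (hw : w ∈ W.W₁)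
    (hv : v ∈ W.W₂) (hi : w i ≠ 0) (h : wedge w v (i, j) ≠ 0) :
    ∃ t : FlagIdx.{u} i j → k, W = flagOf i j hij t := by
  simp only [wedge] at h
  -- The combination `w i • v - v i • w` has `i`-th entry `0` and `j`-th entry `w i * v j - w j * v
  -- i`; dividing by the latter normalizes it.
  refine ⟨flagCoord i j ((w i)⁻¹ • w)
    ((w i * v j - w j * v i)⁻¹ • (w i • v - v i • w)), ?_⟩
  apply LinePlaneFlag.eq_ofPair
  · rw [lineVec_flagCoord _ _ (by simp [hi])]
    exact W.W₁.smul_mem _ hw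
  · rw [planeVec_flagCoord _ _ (by simp; right; ring)
      (by simp only [Pi.smul_apply, Pi.sub_apply, smul_eq_mul]; field_simp)]
    exact W.W₂.smul_mem _ (W.W₂.sub_mem (W.W₂.smul_mem _ hv) (W.W₂.smul_mem _ (W.le hw)))

end flags

/-! ### Charts of the Plücker embedding. -/

section chart

variable (k : Type u) [Field k] {n : ℕ} (i : Fin n) (p : Fin n × Fin n)

/-- The product of two charts of projective space. -/
abbrev ambientChart : Scheme.{u} :=
  pullback (𝔸(OtherIdx.{u} i; Spec (.of k)) ↘ Spec (.of k))
    (𝔸(OtherIdx.{u} p; Spec (.of k)) ↘ Spec (.of k))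

/-- The inclusion of the product of two charts of projective space. -/
def ambientι : ambientChart k i p ⟶ flagAmbient k n :=
  pullback.map _ _ _ _ (chartι k i) (chartι k p) (𝟙 _)
    (by rw [chartι_str, Category.comp_id]) (by rw [chartι_str, Category.comp_id])

instance : IsOpenImmersion (ambientι k i p) := by
  unfold ambientι; infer_instance

lemma range_ambientι : Set.range (ambientι k i p) =
    (pullback.fst (projSpaceStr k (Fin n)) (projSpaceStr k (Fin n × Fin n))) ⁻¹'
      Set.range (chartι.{u} k i) ∩
    (pullback.snd (projSpaceStr k (Fin n)) (projSpaceStr k (Fin n × Fin n))) ⁻¹'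
      Set.range (chartι.{u} k p) :=
  Scheme.Pullback.range_map _ _ _ _ _ _ (𝟙 _)
    (by rw [chartι_str, Category.comp_id]) (by rw [chartι_str, Category.comp_id])

lemma exists_mem_range_ambientι (x : flagAmbient k n) : ∃ i p, x ∈ Set.range (ambientι k i p) := by
  obtain ⟨i, hi⟩ := exists_mem_opensRange_chartι k
    ((pullback.fst (projSpaceStr k (Fin n)) (projSpaceStr k (Fin n × Fin n))) x)
  obtain ⟨p, hp⟩ := exists_mem_opensRange_chartι k
    ((pullback.snd (projSpaceStr k (Fin n)) (projSpaceStr k (Fin n × Fin n))) x)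
  exact ⟨i, p, by rw [range_ambientι]; exact ⟨hi, hp⟩⟩

variable {k} in
lemma plucker_mem_range_ambientι (W : LinePlaneFlag k n) :
    W.plucker (fieldPoint k) ∈ Set.range (ambientι k i p) ↔ W.w i ≠ 0 ∧ wedge W.w W.v p ≠ 0 := by
  rw [range_ambientι]
  change (W.plucker ≫ pullback.fst (projSpaceStr k (Fin n)) (projSpaceStr k (Fin n × Fin n)))
      (fieldPoint k) ∈ (chartι.{u} k i).opensRange ∧
    (W.plucker ≫ pullback.snd (projSpaceStr k (Fin n)) (projSpaceStr k (Fin n × Fin n)))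
      (fieldPoint k) ∈ (chartι.{u} k p).opensRange ↔ _
  rw [LinePlaneFlag.plucker_eq, pullback.lift_fst, pullback.lift_snd, opensRange_chartι,
    opensRange_chartι, projPoint_preimage_basicOpen _ _ _ (X_mem_homogeneousSubmodule k i),
    projPoint_preimage_basicOpen _ _ _ (X_mem_homogeneousSubmodule k p)]
  simp

variable (j : Fin n)

/-- The structure morphism of a product of charts. -/
def ambientChartStr : ambientChart k i p ⟶ Spec (.of k) :=
  pullback.fst _ _ ≫ 𝔸(OtherIdx.{u} i; Spec (.of k)) ↘ Spec (.of k)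

/-- The closed immersion of a chart of the flag variety in a chart of the ambient space. -/
def flagToAmbientChart : 𝔸(FlagIdx.{u} i j; Spec (.of k)) ⟶ ambientChart k i (i, j) :=
  pullback.lift
    (AffineSpace.homOfVector (𝔸(FlagIdx.{u} i j; Spec (.of k)) ↘ Spec (.of k))
      fun l ↦ lineVec i j (AffineSpace.coord _) l.down)
    (AffineSpace.homOfVector (𝔸(FlagIdx.{u} i j; Spec (.of k)) ↘ Spec (.of k))
      fun q ↦ pairWedge (lineVec i j (AffineSpace.coord _)) (planeVec i j (AffineSpace.coord _))
        q.down)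
    (by rw [AffineSpace.homOfVector_over, AffineSpace.homOfVector_over])

lemma flagToAmbientChart_str : flagToAmbientChart k i j ≫ ambientChartStr k i (i, j) =
    𝔸(FlagIdx.{u} i j; Spec (.of k)) ↘ Spec (.of k) := by
  rw [flagToAmbientChart, ambientChartStr, pullback.lift_fst_assoc, AffineSpace.homOfVector_over]

lemma ambientι_str : ambientι k i p ≫ flagAmbientStr k n = ambientChartStr k i p := by
  rw [ambientι, flagAmbientStr, ambientChartStr, pullback.lift_fst_assoc, Category.assoc,
    chartι_str]

/-- The projection of a chart of the ambient space to affine space. -/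
def ambientChartProj : ambientChart k i (i, j) ⟶ 𝔸(FlagIdx.{u} i j; Spec (.of k)) :=
  AffineSpace.homOfVector (ambientChartStr k i (i, j)) fun
    | ⟨.inl l⟩ => (pullback.fst _ _ : ambientChart k i (i, j) ⟶ _).appTop
        (AffineSpace.coord _ ⟨l⟩)
    | ⟨.inr l⟩ => (pullback.snd _ _ : ambientChart k i (i, j) ⟶ _).appTop
        (AffineSpace.coord _ ⟨(i, l), fun h ↦ l.2.2 (congrArg Prod.snd h)⟩)

lemma flagToAmbientChart_proj : flagToAmbientChart k i j ≫ ambientChartProj k i j = 𝟙 _ := by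
  apply AffineSpace.hom_ext
  · rw [ambientChartProj, Category.assoc, AffineSpace.homOfVector_over, flagToAmbientChart_str,
      Category.id_comp]
  · rintro ⟨l | l⟩
    · rw [Scheme.Hom.comp_appTop, CommRingCat.comp_apply, ambientChartProj,
        AffineSpace.homOfVector_appTop_coord, ← CommRingCat.comp_apply, ← Scheme.Hom.comp_appTop,
        flagToAmbientChart, pullback.lift_fst, AffineSpace.homOfVector_appTop_coord, lineVec_inl]
      simp
    · rw [Scheme.Hom.comp_appTop, CommRingCat.comp_apply, ambientChartProj,
        AffineSpace.homOfVector_appTop_coord, ← CommRingCat.comp_apply, ← Scheme.Hom.comp_appTop,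
        flagToAmbientChart, pullback.lift_snd, AffineSpace.homOfVector_appTop_coord,
        pairWedge_left, planeVec_inr]
      simp

instance : IsSeparated (ambientChartProj k i j) := by
  have : IsSeparated (ambientChartProj k i j ≫
      𝔸(FlagIdx.{u} i j; Spec (.of k)) ↘ Spec (.of k)) := by
    rw [ambientChartProj, AffineSpace.homOfVector_over, ambientChartStr]
    infer_instance
  exact IsSeparated.of_comp _ (𝔸(FlagIdx.{u} i j; Spec (.of k)) ↘ Spec (.of k))

instance : IsClosedImmersion (flagToAmbientChart k i j) :=
  isClosedImmersion_of_comp_eq_id_of_isSeparated _ _ (flagToAmbientChart_proj k i j)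

end chart

section

variable (k : Type u) [Field k]

lemma comp_homOfVector_eq_affinePoint {σ : Type u} {Y : Scheme.{u}} (x : Spec (.of k) ⟶ Y)
    (g : Y ⟶ Spec (.of k)) (v : σ → Γ(Y, ⊤)) (c : σ → k) (hg : x ≫ g = 𝟙 _)
    (hv : ∀ s, x.appTop (v s) = (Scheme.ΓSpecIso (.of k)).inv (c s)) :
    x ≫ AffineSpace.homOfVector g v = affinePoint k c := by
  apply AffineSpace.hom_ext
  · rw [Category.assoc, AffineSpace.homOfVector_over, hg, affinePoint_over]
  · intro s
    rw [Scheme.Hom.comp_appTop, CommRingCat.comp_apply, AffineSpace.homOfVector_appTop_coord, hv,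
      affinePoint_appTop_coord]

lemma affinePoint_injective {σ : Type u} : Function.Injective (affinePoint k (σ := σ)) := by
  intro c c' h
  ext s
  have h1 := affinePoint_appTop_coord k c s
  rw [h, affinePoint_appTop_coord] at h1
  exact ((Scheme.ΓSpecIso (.of k)).symm.commRingCatIsoToRingEquiv.injective h1).symm

end

section

variable (k : Type u) [Field k] {n : ℕ} (i j : Fin n)

lemma appTop_lineVec {X Y : Scheme.{u}} (f : X ⟶ Y) (t : FlagIdx.{u} i j → Γ(Y, ⊤)) (l : Fin n) :
    f.appTop (lineVec i j t l) = lineVec i j (fun s ↦ f.appTop (t s)) l :=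
  map_lineVec i j f.appTop.hom t l

lemma appTop_planeVec {X Y : Scheme.{u}} (f : X ⟶ Y) (t : FlagIdx.{u} i j → Γ(Y, ⊤)) (l : Fin n) :
    f.appTop (planeVec i j t l) = planeVec i j (fun s ↦ f.appTop (t s)) l :=
  map_planeVec i j f.appTop.hom t l

lemma affinePoint_appTop_lineVec (t : FlagIdx.{u} i j → k) (l : Fin n) :
    (affinePoint k t).appTop (lineVec i j (AffineSpace.coord _) l) =
      (Scheme.ΓSpecIso (.of k)).inv (lineVec i j t l) := by
  rw [appTop_lineVec]
  simp only [affinePoint_appTop_coord]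
  exact (map_lineVec i j (Scheme.ΓSpecIso (.of k)).inv.hom t l).symm

lemma affinePoint_appTop_planeVec (t : FlagIdx.{u} i j → k) (l : Fin n) :
    (affinePoint k t).appTop (planeVec i j (AffineSpace.coord _) l) =
      (Scheme.ΓSpecIso (.of k)).inv (planeVec i j t l) := by
  rw [appTop_planeVec]
  simp only [affinePoint_appTop_coord]
  exact (map_planeVec i j (Scheme.ΓSpecIso (.of k)).inv.hom t l).symm

variable (hij : i ≠ j)

lemma flagOf_plucker (t : FlagIdx.{u} i j → k) :
    (flagOf i j hij t).plucker = affinePoint k t ≫ flagToAmbientChart k i j ≫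
      ambientι k i (i, j) := by
  rw [flagOf, plucker_ofPair, ambientι, flagToAmbientChart]
  apply pullback.hom_ext
  · simp only [pullback.lift_fst, Category.assoc, pullback.map, pullback.lift_fst_assoc]
    rw [projPoint_eq k i _ _ (by simp), ← Category.assoc]
    congr 1
    refine (comp_homOfVector_eq_affinePoint k _ _ _ _ (affinePoint_over k t) fun s ↦ ?_).symm
    rw [affinePoint_appTop_lineVec]
    simp
  · simp only [pullback.lift_snd, Category.assoc, pullback.map, pullback.lift_snd_assoc]
    rw [projPoint_eq k (i, j) _ _ (by simp [wedge, planeVec_right i j hij]), ← Category.assoc]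
    congr 1
    refine (comp_homOfVector_eq_affinePoint k _ _ _ _ (affinePoint_over k t) fun s ↦ ?_).symm
    simp only [pairWedge, map_sub, map_mul, affinePoint_appTop_lineVec,
      affinePoint_appTop_planeVec, wedge, lineVec_self, planeVec_left, planeVec_right i j hij,
      mul_zero, sub_zero, mul_one, div_one]

lemma exists_flagOf_of_plucker_mem (W : LinePlaneFlag k n)
    (h : W.plucker (fieldPoint k) ∈ Set.range (ambientι k i (i, j))) :
    ∃ t : FlagIdx.{u} i j → k, W = flagOf i j hij t := by
  rw [plucker_mem_range_ambientι] at h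
  refine exists_flagOf_of_wedge_ne_zero i j hij W (w := W.w) (v := W.v) ?_ ?_ h.1 h.2
  · rw [W.W₁_eq]
    exact Submodule.mem_span_singleton_self _
  · rw [W.W₂_eq]
    exact Submodule.subset_span (by simp)

variable {k} in
lemma exists_plucker_mem (W : LinePlaneFlag k n) :
    ∃ i j, i ≠ j ∧ W.plucker (fieldPoint k) ∈ Set.range (ambientι k i (i, j)) := by
  obtain ⟨i, hi⟩ := Function.ne_iff.mp (ne_zero_of_linearIndependent_pair W.linearIndependent)
  have h : ∃ j, wedge W.w W.v (i, j) ≠ 0 := by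
    by_contra! h
    have h2 := LinearIndependent.pair_iff.mp W.linearIndependent (-W.v i) (W.w i) (by
      funext j
      have := h j
      simp only [wedge] at this
      simp only [Pi.add_apply, Pi.smul_apply, smul_eq_mul, Pi.zero_apply]
      linear_combination this)
    exact hi h2.2
  obtain ⟨j, hj⟩ := h
  refine ⟨i, j, ?_, (plucker_mem_range_ambientι i (i, j) W).mpr ⟨hi, hj⟩⟩
  rintro rfl
  exact hj (by simp [wedge])

/-- Two flags with the same image lie in the same chart, where the chart maps are monomorphisms and
so determine the coordinates. -/
lemma plucker_injective : Function.Injective (LinePlaneFlag.plucker (k := k) (n := n)) := by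
  intro W W' h
  obtain ⟨i, j, hij, hW⟩ := exists_plucker_mem W
  obtain ⟨t, rfl⟩ := exists_flagOf_of_plucker_mem k i j hij W hW
  rw [h] at hW
  obtain ⟨t', rfl⟩ := exists_flagOf_of_plucker_mem k i j hij W' hW
  rw [flagOf_plucker, flagOf_plucker, ← Category.assoc, ← Category.assoc, cancel_mono,
    cancel_mono] at h
  rw [affinePoint_injective k h]

end

/-! ### The charts cover the closure of the flag locus. -/

section cover

variable (k : Type u) [Field k] {n : ℕ} (i : Fin n) (p : Fin n × Fin n)

lemma flagLocus_eq : flagLocus k n = {x | ∃ W : LinePlaneFlag k n, W.plucker (fieldPoint k) = x} := by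
  ext x
  simp [flagLocus, range_eq_singleton, eq_comm]

lemma chartι_preimage_range {ι : Type} (q r : ι) :
    chartι.{u} k q ⁻¹ᵁ (chartι.{u} k r).opensRange =
      Scheme.basicOpen _ (extendOne q (AffineSpace.coord (Spec (.of k))) r) := by
  rw [opensRange_chartι, chartι_preimage_basicOpen _ _ _ (X_mem_homogeneousSubmodule k r),
    MvPolynomial.aeval_X, map_extendOne]
  congr 2
  ext s
  simp [polyFun]

/-- The coordinates of the first factor. -/
def fstCoord (l : Fin n) : Γ(ambientChart.{u} k i p, ⊤) :=
  extendOne i (fun s ↦ (pullback.fst _ _ : ambientChart.{u} k i p ⟶ _).appTop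
    (AffineSpace.coord _ s)) l

/-- The coordinates of the second factor. -/
def sndCoord (q : Fin n × Fin n) : Γ(ambientChart.{u} k i p, ⊤) :=
  extendOne p (fun s ↦ (pullback.snd _ _ : ambientChart.{u} k i p ⟶ _).appTop
    (AffineSpace.coord _ s)) q

lemma ambientι_mem_range_of_mem_basicOpen (q : Fin n × Fin n) (z : ambientChart k i p)
    (hz : z ∈ (ambientChart k i p).basicOpen (sndCoord k i p q)) :
    ambientι k i p z ∈ Set.range (ambientι k i q) := by
  rw [range_ambientι]
  constructor
  · have h : ambientι k i p z ∈ Set.range (ambientι k i p) := ⟨z, rfl⟩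
    rw [range_ambientι] at h
    exact h.1
  · have h1 : sndCoord k i p q = (pullback.snd _ _ : ambientChart.{u} k i p ⟶ _).appTop
        (extendOne p (AffineSpace.coord _) q) :=
      (map_extendOne p (pullback.snd _ _ : ambientChart.{u} k i p ⟶ _).appTop.hom _ _).symm
    rw [h1, ← Scheme.preimage_basicOpen_top, ← chartι_preimage_range] at hz
    change (ambientι k i p ≫ pullback.snd _ _) z ∈ Set.range (chartι k q)
    rw [ambientι, pullback.map, pullback.lift_snd]
    exact hz

lemma appTop_fstCoord {W : LinePlaneFlag k n} (y : Spec (.of k) ⟶ ambientChart k i p)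
    (hy : y ≫ ambientι k i p = W.plucker) (l : Fin n) : y.appTop (fstCoord k i p l) =
      (Scheme.ΓSpecIso (.of k)).inv (W.w l / W.w i) := by
  have h := plucker_mem_range_ambientι i p W
  rw [← hy] at h
  have hi := (h.mp ⟨_, rfl⟩).1
  have h1 : y ≫ pullback.fst _ _ = affinePoint k (fun l ↦ W.w l.down / W.w i) := by
    rw [← cancel_mono (chartι k i), ← projPoint_eq k i W.w
      (ne_zero_of_linearIndependent_pair W.linearIndependent) hi]
    have := congr($hy ≫ pullback.fst _ _)
    rw [LinePlaneFlag.plucker_eq, pullback.lift_fst, ambientι, pullback.map, Category.assoc,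
      pullback.lift_fst] at this
    rw [Category.assoc, this]
  have h2 : y.appTop (fstCoord k i p l) = extendOne i (fun s ↦ (y ≫ pullback.fst _ _).appTop
      (AffineSpace.coord _ s)) l := map_extendOne i y.appTop.hom _ _
  rw [h2, h1]
  simp only [affinePoint_appTop_coord]
  refine (map_extendOne i (Scheme.ΓSpecIso (.of k)).inv.hom
    (fun l : OtherIdx.{u} i ↦ W.w l.down / W.w i) l).symm.trans ?_
  rw [extendOne_restrict i (fun l ↦ W.w l / W.w i) (div_self hi)]

lemma appTop_sndCoord {W : LinePlaneFlag k n} (y : Spec (.of k) ⟶ ambientChart k i p)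
    (hy : y ≫ ambientι k i p = W.plucker) (q : Fin n × Fin n) : y.appTop (sndCoord k i p q) =
      (Scheme.ΓSpecIso (.of k)).inv (wedge W.w W.v q / wedge W.w W.v p) := by
  have h := plucker_mem_range_ambientι i p W
  rw [← hy] at h
  have hi := (h.mp ⟨_, rfl⟩).2
  have h1 : y ≫ pullback.snd _ _ =
      affinePoint k (fun q ↦ wedge W.w W.v q.down / wedge W.w W.v p) := by
    rw [← cancel_mono (chartι k p), ← projPoint_eq k p _ (wedge_ne_zero W.linearIndependent) hi]
    have := congr($hy ≫ pullback.snd _ _)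
    rw [LinePlaneFlag.plucker_eq, pullback.lift_snd, ambientι, pullback.map, Category.assoc,
      pullback.lift_snd] at this
    rw [Category.assoc, this]
  have h2 : y.appTop (sndCoord k i p q) = extendOne p (fun s ↦ (y ≫ pullback.snd _ _).appTop
      (AffineSpace.coord _ s)) q := map_extendOne p y.appTop.hom _ _
  rw [h2, h1]
  simp only [affinePoint_appTop_coord]
  refine (map_extendOne p (Scheme.ΓSpecIso (.of k)).inv.hom
    (fun q : OtherIdx.{u} p ↦ wedge W.w W.v q.down / wedge W.w W.v p) q).symm.trans ?_
  rw [extendOne_restrict p (fun q ↦ wedge W.w W.v q / wedge W.w W.v p) (div_self hi)]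

lemma exists_lift_of_mem_range {Y X : Scheme.{u}} (f : Y ⟶ X) [IsOpenImmersion f]
    (x : Spec (.of k) ⟶ X) (h : x (fieldPoint k) ∈ Set.range f) :
    ∃ y : Spec (.of k) ⟶ Y, y ≫ f = x := by
  have h' : Set.range x ⊆ Set.range f := by
    rw [range_eq_singleton]
    exact Set.singleton_subset_iff.mpr h
  exact ⟨IsOpenImmersion.lift f x h', IsOpenImmersion.lift_fac _ _ _⟩

/-- The closure of the flag locus is covered by the charts. -/
lemma exists_mem_range_of_mem_closure (x : flagAmbient k n) (hx : x ∈ closure (flagLocus k n)) :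
    ∃ i j, i ≠ j ∧ x ∈ Set.range (ambientι k i (i, j)) := by
  obtain ⟨i, ⟨j, l⟩, z, rfl⟩ := exists_mem_range_ambientι k x
  have hz : z ∈ closure (ambientι k i (j, l) ⁻¹' flagLocus k n) := by
    rwa [← (ambientι k i (j, l)).isOpenEmbedding.isOpenMap.preimage_closure_eq_closure_preimage
      (ambientι k i (j, l)).continuous]
  -- With `p = w ∧ v`, this is the relation `wⱼ pᵢₗ - wₗ pᵢⱼ = wᵢ pⱼₗ`, normalized by `wᵢ = pⱼₗ =
  -- 1`. It holds on flags, hence on their closure, and there it prevents `pᵢₗ` and `pᵢⱼ` from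
  -- vanishing together.
  set h := fstCoord k i (j, l) j * sndCoord k i (j, l) (i, l) -
    fstCoord k i (j, l) l * sndCoord k i (j, l) (i, j) - 1 with hh
  have hzh : z ∉ (ambientChart k i (j, l)).basicOpen h := by
    have hcl : IsClosed ((ambientChart k i (j, l)).basicOpen h : Set (ambientChart k i (j, l)))ᶜ :=
      ((ambientChart k i (j, l)).basicOpen h).isOpen.isClosed_compl
    refine closure_minimal ?_ hcl hz
    intro y hy
    rw [Set.mem_preimage, flagLocus_eq] at hy
    obtain ⟨W, hW⟩ := hy
    obtain ⟨y', hy'⟩ := exists_lift_of_mem_range k (ambientι k i (j, l)) W.plucker ⟨y, hW.symm⟩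
    have : y' (fieldPoint k) = y := by
      apply (ambientι k i (j, l)).isOpenEmbedding.injective
      rw [← hW, ← hy']
      rfl
    rw [← this]
    change ¬ (y' (fieldPoint k) ∈ (ambientChart k i (j, l)).basicOpen h)
    rw [mem_basicOpen_iff_appTop_ne_zero, not_not, hh]
    simp only [map_sub, map_mul, appTop_fstCoord k i (j, l) y' hy',
      appTop_sndCoord k i (j, l) y' hy', map_one]
    rw [← map_mul, ← map_mul, ← map_sub, ← map_one (Scheme.ΓSpecIso (.of k)).inv.hom, ← map_sub]
    convert map_zero (Scheme.ΓSpecIso (.of k)).inv.hom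
    have h3 := (plucker_mem_range_ambientι i (j, l) W).mp ⟨y, hW.symm⟩
    have h4 := h3.1
    have h5 := h3.2
    simp only [wedge] at h5 ⊢
    field_simp
    ring
  have key (q : Fin n × Fin n) (a : Fin n) (hq : q = (i, a))
      (hzq : z ∈ (ambientChart k i (j, l)).basicOpen (sndCoord k i (j, l) q)) :
      ∃ i' j', i' ≠ j' ∧ ambientι k i (j, l) z ∈ Set.range (ambientι k i' (i', j')) := by
    subst hq
    have h1 := ambientι_mem_range_of_mem_basicOpen k i (j, l) (i, a) z hzq
    refine ⟨i, a, ?_, h1⟩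
    -- The open chart contains an actual flag, whose Plücker coordinate `(i, a)` is nonzero;
    -- antisymmetry then excludes `a = i`.
    obtain ⟨_, hy, hy'⟩ := mem_closure_iff.mp hx _ (ambientι k i (i, a)).isOpenEmbedding.isOpen_range h1
    rw [flagLocus_eq] at hy'
    obtain ⟨W, rfl⟩ := hy'
    have h2 := ((plucker_mem_range_ambientι i (i, a) W).mp hy).2
    rintro rfl
    exact h2 (by simp [wedge])
  -- The constant `1` is a sum of three functions, so one of them is nonzero at `z`, and it cannot
  -- be `-h`.
  have h1 : z ∈ (ambientChart k i (j, l)).basicOpen (fstCoord k i (j, l) j *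
      sndCoord k i (j, l) (i, l) + (-fstCoord k i (j, l) l * sndCoord k i (j, l) (i, j) + -h)) := by
    have : fstCoord k i (j, l) j * sndCoord k i (j, l) (i, l) +
        (-fstCoord k i (j, l) l * sndCoord k i (j, l) (i, j) + -h) = 1 := by
      rw [hh]; ring
    rw [this, Scheme.basicOpen_one]
    trivial
  rcases Scheme.basicOpen_add_le _ _ _ h1 with h1 | h1
  · change z ∈ (ambientChart k i (j, l)).basicOpen _ at h1
    rw [Scheme.basicOpen_mul] at h1
    exact key _ l rfl h1.2
  · rcases Scheme.basicOpen_add_le _ _ _ h1 with h1 | h1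
    · change z ∈ (ambientChart k i (j, l)).basicOpen _ at h1
      rw [Scheme.basicOpen_mul] at h1
      exact key _ j rfl h1.2
    · change z ∈ (ambientChart k i (j, l)).basicOpen _ at h1
      rw [neg_eq_neg_one_mul, Scheme.basicOpen_mul] at h1
      exact absurd h1.2 hzh

end cover

/-! ### The flag variety, its charts and its rational points. -/

section flagVariety

variable (k : Type u) [Field k] {n : ℕ}

lemma reducedClosureLift_ι {X Y : Scheme.{u}} (S : Set X) [IsReduced Y] (g : Y ⟶ X)
    [QuasiCompact g] (h : Set.range g ⊆ S) :
    reducedClosureLift S g h ≫ reducedClosureι S = g :=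
  IsClosedImmersion.lift_fac ..

variable {k} in
lemma LinePlaneFlag.point_ι (W : LinePlaneFlag k n) :
    W.point ≫ reducedClosureι (flagLocus k n) = W.plucker :=
  reducedClosureLift_ι ..

variable {k} in
lemma LinePlaneFlag.plucker_str (W : LinePlaneFlag k n) : W.plucker ≫ flagAmbientStr k n = 𝟙 _ := by
  rw [plucker_eq, flagAmbientStr, pullback.lift_fst_assoc, projPoint_str]

variable {k} in
lemma LinePlaneFlag.point_str (W : LinePlaneFlag k n) : W.point ≫ flagStr k n = 𝟙 _ := by
  rw [flagStr, ← Category.assoc, point_ι, plucker_str]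

lemma point_injective : Function.Injective (LinePlaneFlag.point (k := k) (n := n)) := by
  intro W W' h
  apply plucker_injective
  rw [← W.point_ι, h, W'.point_ι]

instance : IsProper (flagStr k n) := by
  unfold flagStr flagAmbientStr; infer_instance

variable [IsAlgClosed k] (i j : Fin n) (hij : i ≠ j)

-- `exists_iso_reducedClosure` applies: flags in the ambient chart have normalized coordinates, and
-- conversely every rational point of the affine space is a flag, so the preimage of the locus is
-- dense.
include hij in
lemma exists_flagChart : ∃ (c : 𝔸(FlagIdx.{u} i j; Spec (.of k)) ⟶ flagVariety k n)
    (_ : IsOpenImmersion c), c ≫ reducedClosureι _ = flagToAmbientChart k i j ≫ ambientι k i (i, j) ∧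
      c.opensRange = reducedClosureι _ ⁻¹ᵁ (ambientι k i (i, j)).opensRange := by
  obtain ⟨e, he⟩ := exists_iso_reducedClosure (flagLocus k n) (ambientι k i (i, j))
    (flagToAmbientChart k i j) (by
      rintro x ⟨hx, hx'⟩
      rw [flagLocus_eq] at hx
      obtain ⟨W, rfl⟩ := hx
      obtain ⟨t, rfl⟩ := exists_flagOf_of_plucker_mem k i j hij W hx'
      rw [flagOf_plucker]
      exact ⟨affinePoint k t (fieldPoint k), rfl⟩) (by
      refine dense_of_forall_point_mem (𝔸(FlagIdx.{u} i j; Spec (.of k)) ↘ Spec (.of k))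
        fun x hx ↦ ?_
      obtain ⟨t, rfl⟩ := exists_affinePoint k x hx
      rw [flagLocus_eq]
      refine ⟨flagOf i j hij t, ?_⟩
      rw [flagOf_plucker]
      rfl)
  refine ⟨e.hom ≫ Scheme.Opens.ι _, inferInstance, ?_, ?_⟩
  · rw [Category.assoc, he]
  · rw [Scheme.Hom.opensRange_comp_of_isIso, Scheme.Opens.opensRange_ι]

/-- The chart of the flag variety on which `wᵢ` and `wᵢ vⱼ - wⱼ vᵢ` do not vanish. -/
def flagChart : 𝔸(FlagIdx.{u} i j; Spec (.of k)) ⟶ flagVariety k n :=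
  (exists_flagChart k i j hij).choose

instance : IsOpenImmersion (flagChart k i j hij) :=
  (exists_flagChart k i j hij).choose_spec.choose

lemma flagChart_ι : flagChart k i j hij ≫ reducedClosureι _ =
    flagToAmbientChart k i j ≫ ambientι k i (i, j) :=
  (exists_flagChart k i j hij).choose_spec.choose_spec.1

lemma opensRange_flagChart : (flagChart k i j hij).opensRange =
    reducedClosureι _ ⁻¹ᵁ (ambientι k i (i, j)).opensRange :=
  (exists_flagChart k i j hij).choose_spec.choose_spec.2

lemma flagChart_str : flagChart k i j hij ≫ flagStr k n =
    𝔸(FlagIdx.{u} i j; Spec (.of k)) ↘ Spec (.of k) := by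
  rw [flagStr, ← Category.assoc, flagChart_ι, Category.assoc, ambientι_str, flagToAmbientChart_str]

lemma affinePoint_flagChart (t : FlagIdx.{u} i j → k) :
    affinePoint k t ≫ flagChart k i j hij = (flagOf i j hij t).point := by
  rw [← cancel_mono (reducedClosureι _), LinePlaneFlag.point_ι, flagOf_plucker, Category.assoc,
    flagChart_ι]

lemma exists_mem_opensRange_flagChart (x : flagVariety k n) :
    ∃ i j hij, x ∈ (flagChart k i j hij).opensRange := by
  obtain ⟨i, j, hij, h⟩ := exists_mem_range_of_mem_closure k (reducedClosureι (flagLocus k n) x) (by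
    rw [← range_reducedClosureι]
    exact ⟨x, rfl⟩)
  exact ⟨i, j, hij, by rw [opensRange_flagChart]; exact h⟩

/-- Taking the closure adds no rational points, since each lies in a chart and has normalized
coordinates there. -/
lemma exists_flag_of_point (x : Spec (.of k) ⟶ flagVariety k n) (hx : x ≫ flagStr k n = 𝟙 _) :
    ∃ W : LinePlaneFlag k n, W.point = x := by
  obtain ⟨i, j, hij, h⟩ := exists_mem_opensRange_flagChart k (x (fieldPoint k))
  obtain ⟨y, rfl⟩ := exists_lift_of_mem_range k (flagChart k i j hij) x h
  obtain ⟨t, rfl⟩ := exists_affinePoint k y (by rw [← hx, Category.assoc, flagChart_str])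
  exact ⟨_, (affinePoint_flagChart k i j hij t).symm⟩

variable {k} in
lemma point_mem_opensRange_flagChart (W : LinePlaneFlag k n) :
    W.point (fieldPoint k) ∈ (flagChart k i j hij).opensRange ↔
      W.w i ≠ 0 ∧ wedge W.w W.v (i, j) ≠ 0 := by
  rw [opensRange_flagChart, ← plucker_mem_range_ambientι, ← LinePlaneFlag.point_ι]
  rfl

theorem bijOn_point : Set.BijOn (fun W : LinePlaneFlag k n ↦ W.point) Set.univ
    {x | x ≫ flagStr k n = 𝟙 (Spec (.of k))} :=
  ⟨fun W _ ↦ W.point_str, (point_injective k).injOn, fun x hx ↦ by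
    obtain ⟨W, hW⟩ := exists_flag_of_point k x hx
    exact ⟨W, trivial, hW⟩⟩

end flagVariety

/-! ### Linear parametrization of the matrices incident to a flag. -/

section linearAlgebra

open Matrix

variable {R S : Type*} [CommRing R] [CommRing S] {n : ℕ}

/-- The vector `w` with a zero appended. -/
def appendZero (w : Fin n → R) : Fin (n + 1) → R :=
  Fin.snoc w 0

@[simp] lemma appendZero_castSucc (w : Fin n → R) (q : Fin n) :
    appendZero w q.castSucc = w q := by
  simp [appendZero]

@[simp] lemma appendZero_last (w : Fin n → R) : appendZero w (Fin.last n) = 0 := by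
  simp [appendZero]

lemma map_appendZero (f : R →+* S) (w : Fin n → R) (p : Fin (n + 1)) :
    f (appendZero w p) = appendZero (f ∘ w) p := by
  refine Fin.lastCases ?_ (fun q ↦ ?_) p <;> simp

section incident

variable {k : Type u} [Field k]

/-- All conditions are tested on the basis. The zero appended to `w` encodes `a v = 0`, and `A W₂ ⊆
W₁` reduces to `A v` being a multiple of `w`, because `A w = 0`. -/
lemma incident_ofPair_iff (B : Matrix (Fin (n + 1)) (Fin n) k) {w v : Fin n → k}
    (h : LinearIndependent k ![w, v]) : Incident B (.ofPair w v h) ↔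
      B *ᵥ w = 0 ∧ ∃ c : k, B *ᵥ v = c • appendZero w := by
  have htop (x : Fin n → k) (q : Fin n) : (topBlock B *ᵥ x) q = (B *ᵥ x) q.castSucc := rfl
  have hlast (x : Fin n → k) (q : Fin 1) : (lastRow B *ᵥ x) q = (B *ᵥ x) (Fin.last n) := rfl
  have hspan {m : ℕ} (f : (Fin n → k) →ₗ[k] (Fin m → k)) :
      (Submodule.span k {w, v}).map f = ⊥ ↔ f w = 0 ∧ f v = 0 := by
    rw [Submodule.map_span, Submodule.span_eq_bot, Set.image_pair]
    simp only [Set.mem_insert_iff, Set.mem_singleton_iff, forall_eq_or_imp, forall_eq]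
  simp only [Incident, LinePlaneFlag.ofPair]
  rw [hspan, Submodule.map_span, Submodule.map_span, Submodule.span_le, Submodule.span_eq_bot]
  simp only [Set.image_pair, Set.image_singleton, Set.mem_singleton_iff, forall_eq,
    Matrix.mulVecLin_apply, Set.insert_subset_iff, Set.singleton_subset_iff, SetLike.mem_coe,
    Submodule.mem_span_singleton]
  constructor
  · rintro ⟨⟨-, c, hc⟩, hw, hw', hv'⟩
    refine ⟨?_, c, ?_⟩
    · ext p
      refine Fin.lastCases ?_ (fun q ↦ ?_) p
      · exact congrFun hw' 0
      · exact congrFun hw q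
    · ext p
      refine Fin.lastCases ?_ (fun q ↦ ?_) p
      · rw [Pi.smul_apply, appendZero_last, smul_zero]
        exact congrFun hv' 0
      · rw [Pi.smul_apply, appendZero_castSucc]
        exact (congrFun hc q).symm
  · rintro ⟨hw, c, hv⟩
    refine ⟨⟨⟨0, ?_⟩, c, ?_⟩, ?_, ?_, ?_⟩
    · ext q
      rw [htop, hw]
      simp
    · ext q
      rw [htop, hv]
      simp
    · ext q
      rw [htop, hw]
      rfl
    · ext q
      rw [hlast, hw]
      rfl
    · ext q
      rw [hlast, hv]
      simp

end incident

section parametrization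

variable (i j : Fin n)

/-- The index set of the coordinates on the fibres of the incidence variety. -/
abbrev BundleIdx (i j : Fin n) : Type := Unit ⊕ ({l : Fin n // l ≠ i ∧ l ≠ j} × Fin (n + 1))

/-- The row vector with `planeRow · w = 0`, `planeRow · v = 1` vanishing outside `{i, j}`. -/
def planeRow (w : Fin n → R) (q : Fin n) : R :=
  (if q = j then 1 else 0) - w j * (if q = i then 1 else 0)

/-- The row vector orthogonal to `w` and `v` which agrees with the `l`-th unit vector outside
`{i, j}`. -/
def freeRow (w v : Fin n → R) (l q : Fin n) : R :=
  (if q = l then 1 else 0) - v l * (if q = j then 1 else 0) +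
    (w j * v l - w l) * (if q = i then 1 else 0)

/-- The coefficients of the linear parametrization of the matrices incident to the flag spanned by
the normalized vectors `w` and `v`. -/
def bundleCoeff (w v : Fin n → R) (s : Fin (n + 1) × Fin n) : BundleIdx i j → R
  | .inl _ => appendZero w s.1 * planeRow i j w s.2
  | .inr (l, p) => (if s.1 = p then 1 else 0) * freeRow i j w v l s.2

lemma map_bundleCoeff (f : R →+* S) (w v : Fin n → R) (s : Fin (n + 1) × Fin n)
    (c : BundleIdx i j) : f (bundleCoeff i j w v s c) = bundleCoeff i j (f ∘ w) (f ∘ v) s c := by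
  obtain _ | ⟨l, p⟩ := c <;>
    simp [bundleCoeff, planeRow, freeRow, map_appendZero, apply_ite f]

/-- The matrix with coordinates `z`. -/
def bundleMatrix (w v : Fin n → R) (z : BundleIdx i j → R) : Matrix (Fin (n + 1)) (Fin n) R :=
  .of fun p q ↦ ∑ c, bundleCoeff i j w v (p, q) c * z c

variable {i j} {w v : Fin n → R} (hij : i ≠ j) (hw : w i = 1) (hvi : v i = 0) (hvj : v j = 1)

lemma bundleMatrix_apply (z : BundleIdx i j → R) (p : Fin (n + 1)) (q : Fin n) :
    bundleMatrix i j w v z p q = appendZero w p * planeRow i j w q * z (.inl ()) +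
      ∑ l : {l : Fin n // l ≠ i ∧ l ≠ j}, freeRow i j w v l q * z (.inr (l, p)) := by
  simp only [bundleMatrix, Matrix.of_apply, Fintype.sum_sum_type, Finset.univ_unique,
    Finset.sum_singleton, Fintype.sum_prod_type]
  congr 1
  refine Finset.sum_congr rfl fun l _ ↦ ?_
  rw [Finset.sum_eq_single p]
  · simp [bundleCoeff]
  · intro p' _ hp
    simp [bundleCoeff, hp.symm]
  · simp

lemma sum_planeRow_mul (x : Fin n → R) : ∑ q, planeRow i j w q * x q = x j - w j * x i := by
  simp [planeRow, sub_mul, Finset.sum_sub_distrib]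

lemma sum_freeRow_mul (l : Fin n) (x : Fin n → R) :
    ∑ q, freeRow i j w v l q * x q = x l - v l * x j + (w j * v l - w l) * x i := by
  simp [freeRow, sub_mul, add_mul, mul_assoc, Finset.sum_sub_distrib, Finset.sum_add_distrib]

lemma bundleMatrix_mulVec (z : BundleIdx i j → R) (x : Fin n → R) (p : Fin (n + 1)) :
    (bundleMatrix i j w v z *ᵥ x) p = appendZero w p * (x j - w j * x i) * z (.inl ()) +
      ∑ l : {l : Fin n // l ≠ i ∧ l ≠ j}, (x l.1 - v l * x j + (w j * v l - w l) * x i) *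
        z (.inr (l, p)) := by
  have h : ∑ l : {l : Fin n // l ≠ i ∧ l ≠ j}, (x l.1 - v l * x j + (w j * v l - w l) * x i) *
      z (.inr (l, p)) = ∑ q, ∑ l : {l : Fin n // l ≠ i ∧ l ≠ j},
        freeRow i j w v l q * z (.inr (l, p)) * x q := by
    rw [Finset.sum_comm]
    refine Finset.sum_congr rfl fun l _ ↦ ?_
    rw [← sum_freeRow_mul, Finset.sum_mul]
    exact Finset.sum_congr rfl fun q _ ↦ by ring
  rw [h, ← sum_planeRow_mul, mulVec, dotProduct, Finset.mul_sum, Finset.sum_mul,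
    ← Finset.sum_add_distrib]
  refine Finset.sum_congr rfl fun q _ ↦ ?_
  rw [bundleMatrix_apply, add_mul, Finset.sum_mul]
  ring

include hw in
lemma bundleMatrix_mulVec_line (z : BundleIdx i j → R) : bundleMatrix i j w v z *ᵥ w = 0 := by
  ext p
  rw [bundleMatrix_mulVec, hw, Pi.zero_apply]
  rw [Finset.sum_eq_zero fun l _ ↦ by ring]
  ring

include hvi hvj in
lemma bundleMatrix_mulVec_plane (z : BundleIdx i j → R) :
    bundleMatrix i j w v z *ᵥ v = z (.inl ()) • appendZero w := by
  ext p
  rw [bundleMatrix_mulVec, hvi, hvj, Pi.smul_apply, smul_eq_mul]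
  rw [Finset.sum_eq_zero fun l _ ↦ by ring]
  ring

/-- The coordinates of a matrix. -/
def bundleCoords (i j : Fin n) (B : Matrix (Fin (n + 1)) (Fin n) R) (c : R) : BundleIdx i j → R
  | .inl _ => c
  | .inr (l, p) => B p l.1

include hij in
lemma sum_eq_add_add_sum_other (f : Fin n → R) :
    ∑ q, f q = f i + f j + ∑ l : {l : Fin n // l ≠ i ∧ l ≠ j}, f l := by
  rw [← Finset.add_sum_erase _ f (Finset.mem_univ i), ← Finset.add_sum_erase _ f
    (Finset.mem_erase.mpr ⟨hij.symm, Finset.mem_univ j⟩), add_assoc]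
  congr 2
  exact Finset.sum_subtype _ (fun x ↦ by simp [and_comm]) f

-- The scalar is entry `i` of `B v = c (w, 0)`, because `w i = 1`. In columns other than `i` and
-- `j`, `planeRow` vanishes and `freeRow` is a unit vector, so the remaining coordinates are matrix
-- entries.
include hw hvi hvj in
lemma bundleCoords_bundleMatrix (z : BundleIdx i j → R) (c : BundleIdx i j) :
    bundleCoords i j (bundleMatrix i j w v z)
      (∑ q, bundleMatrix i j w v z i.castSucc q * v q) c = z c := by
  obtain _ | ⟨l, p⟩ := c
  · have := congrFun (bundleMatrix_mulVec_plane (w := w) hvi hvj z) i.castSucc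
    rw [Pi.smul_apply, appendZero_castSucc, hw, smul_eq_mul, mul_one] at this
    exact this
  · simp only [bundleCoords]
    rw [bundleMatrix_apply, Finset.sum_eq_single l]
    · simp [planeRow, freeRow, l.2.1, l.2.2]
    · intro l' _ hl
      have : l.1 ≠ l'.1 := fun h ↦ hl (Subtype.ext h.symm)
      simp [freeRow, l.2.1, l.2.2, this]
    · simp

-- The two matrices agree outside columns `i` and `j` and have equal values on `v` and `w`. As `v i
-- = 0` and `v j = 1`, the values on `v` settle column `j`; then `w i = 1` settles column `i`.
include hij hw hvi hvj in
lemma bundleMatrix_bundleCoords {B : Matrix (Fin (n + 1)) (Fin n) R} {c : R} (h1 : B *ᵥ w = 0)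
    (h2 : B *ᵥ v = c • appendZero w) : bundleMatrix i j w v (bundleCoords i j B c) = B := by
  set B' := bundleMatrix i j w v (bundleCoords i j B c) with hB'
  have h1' : B' *ᵥ w = 0 := bundleMatrix_mulVec_line hw _
  have h2' : B' *ᵥ v = c • appendZero w := bundleMatrix_mulVec_plane hvi hvj _
  have h3 (p) (l : {l : Fin n // l ≠ i ∧ l ≠ j}) : B' p l = B p l :=
    bundleCoords_bundleMatrix hw hvi hvj (bundleCoords i j B c) (.inr (l, p))
  have hj (p) : B' p j = B p j := by
    have e := congrFun (h2'.trans h2.symm) p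
    rw [mulVec, mulVec, dotProduct, dotProduct, sum_eq_add_add_sum_other hij,
      sum_eq_add_add_sum_other hij, hvi, hvj] at e
    simp only [h3] at e
    linear_combination e
  have hi (p) : B' p i = B p i := by
    have e := congrFun (h1'.trans h1.symm) p
    rw [mulVec, mulVec, dotProduct, dotProduct, sum_eq_add_add_sum_other hij,
      sum_eq_add_add_sum_other hij, hw, hj] at e
    simp only [h3] at e
    linear_combination e
  ext p q
  by_cases hqi : q = i
  · rw [hqi, hi]
  by_cases hqj : q = j
  · rw [hqj, hj]
  · exact h3 p ⟨q, hqi, hqj⟩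

include hij in
lemma card_ne_and_ne : Fintype.card {l : Fin n // l ≠ i ∧ l ≠ j} = n - 2 := by
  have : Finset.univ.filter (fun l : Fin n ↦ l ≠ i ∧ l ≠ j) = {i, j}ᶜ := by
    ext; simp
  rw [Fintype.card_subtype, this, Finset.card_compl, Finset.card_pair hij, Fintype.card_fin]

include hij in
lemma card_bundleIdx : Fintype.card (BundleIdx i j) = n ^ 2 - n - 1 := by
  have h2 : 2 ≤ n := by
    by_contra h
    exact hij (Fin.ext (by omega))
  obtain ⟨m, rfl⟩ := Nat.exists_eq_add_of_le h2
  rw [Fintype.card_sum, Fintype.card_prod, card_ne_and_ne hij, Fintype.card_unit, Fintype.card_fin]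
  -- Writing `n ^ 2` as `n + 1` plus the desired count makes the truncated subtractions exact.
  have : (2 + m) ^ 2 = (2 + m) + 1 + (1 + m * (2 + m + 1)) := by ring
  rw [this, Nat.sub_sub, Nat.add_sub_cancel_left, Nat.add_sub_cancel_left]

end parametrization

end linearAlgebra

/-! ### Divisibility of the minors by `y²` and incident flags. -/

section minors

open Matrix

/-- The matrix `Y + B`. -/
def shiftMatrix {R : Type*} [CommRing R] {n : ℕ} (B : Matrix (Fin (n + 1)) (Fin n) R) :
    Matrix (Fin (n + 1)) (Fin n) (Polynomial R) :=
  .of fun i j ↦ (if i = j.castSucc then Polynomial.X else 0) + Polynomial.C (B i j)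

/-- The `n × n` minors of `Y + B` are divisible by `y²`. -/
def MinorsDvd {R : Type*} [CommRing R] {n : ℕ} (B : Matrix (Fin (n + 1)) (Fin n) R) : Prop :=
  ∀ i : Fin (n + 1), Polynomial.X ^ 2 ∣ ((shiftMatrix B).submatrix i.succAbove id).det

/-- Cramer's rule with right-hand side `M *ᵥ x`. -/
lemma det_updateCol_mulVec {R : Type*} [CommRing R] {n : ℕ} (M : Matrix (Fin n) (Fin n) R)
    (i : Fin n) (x : Fin n → R) : (M.updateCol i (M *ᵥ x)).det = M.det * x i := by
  rw [← cramer_apply, cramer_eq_adjugate_mulVec, mulVec_mulVec, adjugate_mul, smul_mulVec,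
    one_mulVec, Pi.smul_apply, smul_eq_mul]

lemma shiftMatrix_mulVec {R : Type*} [CommRing R] {n : ℕ} (B : Matrix (Fin (n + 1)) (Fin n) R)
    (x : Fin n → R) : shiftMatrix B *ᵥ (fun q ↦ (Polynomial.C (x q) : Polynomial R)) =
      (Polynomial.X : Polynomial R) • (fun p ↦ Polynomial.C (appendZero x p)) +
        fun p ↦ Polynomial.C ((B *ᵥ x) p) := by
  ext1 p
  simp only [mulVec, dotProduct, shiftMatrix, of_apply, add_mul, Finset.sum_add_distrib,
    Pi.add_apply, Pi.smul_apply, smul_eq_mul, map_sum, map_mul]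
  congr 1
  refine Fin.lastCases ?_ (fun q ↦ ?_) p
  · simp [(Fin.castSucc_ne_last _).symm]
  · simp [ite_mul, Fin.castSucc_inj]

/-- Replacing column `i` by `M w = y w'` and column `j` by `M v = y v' + c w'` does not change the
determinant. The term with `c` has two proportional columns; the other carries `y²`. -/
lemma minorsDvd_of_mulVec {R : Type*} [CommRing R] {n : ℕ} {B : Matrix (Fin (n + 1)) (Fin n) R}
    {i j : Fin n} (hij : i ≠ j) {w v : Fin n → R} (hw : w i = 1) (hvi : v i = 0) (hvj : v j = 1)
    {c : R} (h1 : B *ᵥ w = 0) (h2 : B *ᵥ v = c • appendZero w) : MinorsDvd B := by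
  intro a
  set M := (shiftMatrix B).submatrix a.succAbove id with hM
  have hmul (x : Fin n → R) : M *ᵥ (fun q ↦ (Polynomial.C (x q) : Polynomial R)) = fun p ↦
      (shiftMatrix B *ᵥ (fun q ↦ (Polynomial.C (x q) : Polynomial R))) (a.succAbove p) := rfl
  set w' : Fin n → Polynomial R := fun p ↦ Polynomial.C (appendZero w (a.succAbove p))
  set v' : Fin n → Polynomial R := fun p ↦ Polynomial.C (appendZero v (a.succAbove p))
  have e1 : M *ᵥ (fun q ↦ Polynomial.C (w q)) = (Polynomial.X : Polynomial R) • w' := by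
    rw [hmul, shiftMatrix_mulVec, h1]
    ext1 p
    simp [w']
  have e2 : M *ᵥ (fun q ↦ Polynomial.C (v q)) = (Polynomial.X : Polynomial R) • v' + Polynomial.C c • w' := by
    rw [hmul, shiftMatrix_mulVec, h2]
    ext1 p
    simp [w', v']
  set N := M.updateCol i (M *ᵥ (fun q ↦ Polynomial.C (w q))) with hN
  have d1 : N.det = M.det := by
    rw [hN, det_updateCol_mulVec, hw, map_one, mul_one]
  -- The modified column `i` does not enter, because `v i = 0`.
  have e3 : N *ᵥ (fun q ↦ Polynomial.C (v q)) = M *ᵥ (fun q ↦ Polynomial.C (v q)) := by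
    ext1 p
    simp only [mulVec, dotProduct]
    refine Finset.sum_congr rfl fun q _ ↦ ?_
    by_cases hq : q = i
    · rw [hq, hvi, map_zero, mul_zero, mul_zero]
    · rw [hN, updateCol_ne hq]
  have d2 : (N.updateCol j (N *ᵥ (fun q ↦ Polynomial.C (v q)))).det = M.det := by
    rw [det_updateCol_mulVec, d1, hvj, map_one, mul_one]
  rw [← d2, e3, e2, det_updateCol_add, det_updateCol_smul, det_updateCol_smul, hN, e1,
    updateCol_comm _ hij, updateCol_comm _ hij, det_updateCol_smul, det_updateCol_smul]
  have d3 : ((M.updateCol j w').updateCol i w').det = 0 := by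
    refine det_zero_of_column_eq hij fun p ↦ ?_
    simp [hij.symm]
  rw [d3]
  exact ⟨((M.updateCol j v').updateCol i w').det, by ring⟩

variable {k : Type u} [Field k] {n : ℕ}

/-- Injectivity means that the rows span `kⁿ`. There are `n + 1` of them, so one is in the span of
the others; deleting it leaves a basis. -/
lemma exists_det_ne_zero_of_injective (B : Matrix (Fin (n + 1)) (Fin n) k)
    (hB : ∀ x, B *ᵥ x = 0 → x = 0) : ∃ i : Fin (n + 1), (B.submatrix i.succAbove id).det ≠ 0 := by
  have hinj : Function.Injective B.mulVec := fun x y hxy ↦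
    sub_eq_zero.mp (hB _ (by rw [mulVec_sub, sub_eq_zero]; exact hxy))
  have hspan : Submodule.span k (Set.range B.row) = ⊤ := by
    apply Submodule.eq_top_of_finrank_eq
    rw [← rank_eq_finrank_span_row, Module.finrank_fin_fun]
    simpa using (mulVec_injective_iff.mp hinj).rank_matrix
  have hdep : ¬LinearIndependent k B.row := fun h ↦ by
    have := h.fintype_card_le_finrank
    simp at this
  rw [linearIndependent_iff_notMem_span] at hdep
  push Not at hdep
  obtain ⟨i, hi⟩ := hdep
  refine ⟨i, IsUnit.ne_zero ((isUnit_iff_isUnit_det _).mp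
    (linearIndependent_rows_iff_isUnit.mp ?_))⟩
  refine linearIndependent_of_top_le_span_of_card_eq_finrank ?_ (by simp)
  rw [← hspan, Submodule.span_le]
  have hsub : Submodule.span k (B.row '' (Set.univ \ {i})) ≤
      Submodule.span k (Set.range (B.submatrix i.succAbove id).row) := by
    refine Submodule.span_mono ?_
    rintro _ ⟨p, hp, rfl⟩
    obtain ⟨q, rfl⟩ := Fin.exists_succAbove_eq (x := p) (y := i) (by simpa using hp)
    exact ⟨q, rfl⟩
  rintro _ ⟨p, rfl⟩
  by_cases hp : p = i
  · rw [hp]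
    exact hsub hi
  · exact hsub (Submodule.subset_span ⟨p, by simpa using hp, rfl⟩)

lemma exists_incident_of_minorsDvd (B : Matrix (Fin (n + 1)) (Fin n) k)
    (hB : MinorsDvd B) : ∃ W : LinePlaneFlag k n, Incident B W := by
  have hcoeff (i : Fin (n + 1)) (d : ℕ) (hd : d < 2) :
      ((shiftMatrix B).submatrix i.succAbove id).det.coeff d = 0 :=
    Polynomial.X_pow_dvd_iff.mp (hB i) d hd
  have heval (i : Fin (n + 1)) : ((shiftMatrix B).submatrix i.succAbove id).map
      (Polynomial.evalRingHom 0) = B.submatrix i.succAbove id := by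
    ext p q
    simp only [shiftMatrix, map_apply, submatrix_apply, of_apply, Polynomial.coe_evalRingHom, id]
    split_ifs <;> simp
  suffices ∃ w v : Fin n → k, LinearIndependent k ![w, v] ∧
      B *ᵥ w = 0 ∧ ∃ c : k, B *ᵥ v = c • appendZero w by
    obtain ⟨w, v, h, h'⟩ := this
    exact ⟨.ofPair w v h, (incident_ofPair_iff B h).mpr h'⟩
  -- The coefficients of `y⁰` are the maximal minors of `B`; their vanishing makes `B`
  -- non-injective.
  obtain ⟨w, hw, hw0⟩ : ∃ w, B *ᵥ w = 0 ∧ w ≠ 0 := by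
    by_contra! h
    obtain ⟨i, hi⟩ := exists_det_ne_zero_of_injective B h
    apply hi
    rw [← heval, ← RingHom.mapMatrix_apply, ← RingHom.map_det, Polynomial.coe_evalRingHom,
      ← Polynomial.coeff_zero_eq_eval_zero, hcoeff i 0 two_pos]
  have hpair (v : Fin n → k) (hv : ∀ a : k, a • w ≠ v) : LinearIndependent k ![w, v] :=
    (LinearIndependent.pair_iff' hw0).mpr hv
  by_cases hker : ∃ v, B *ᵥ v = 0 ∧ ∀ a : k, a • w ≠ v
  · obtain ⟨v, hv, hwv⟩ := hker
    exact ⟨w, v, hpair v hwv, hw, 0, by rw [hv, zero_smul]⟩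
  push Not at hker
  by_cases hrange : ∃ v, B *ᵥ v = appendZero w
  · obtain ⟨v, hv⟩ := hrange
    refine ⟨w, v, hpair v ?_, hw, 1, by rw [hv, one_smul]⟩
    rintro a rfl
    rw [mulVec_smul, hw, smul_zero] at hv
    apply hw0
    ext q
    simpa using (congrFun hv q.castSucc).symm
  push Not at hrange
  exfalso
  -- What remains to exclude is a kernel equal to `⟨w⟩` with `(w, 0)` outside the image of `B`. Then
  -- replacing column `j`, where `w j ≠ 0`, by `(w, 0)` yields an injective matrix.
  obtain ⟨j, hj⟩ := Function.ne_iff.mp hw0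
  have hupd (x : Fin n → k) : B.updateCol j (appendZero w) *ᵥ x =
      B *ᵥ (Function.update x j 0) + x j • appendZero w := by
    ext p
    simp only [mulVec, dotProduct, Pi.add_apply, Pi.smul_apply, smul_eq_mul]
    rw [← Finset.add_sum_erase _ _ (Finset.mem_univ j),
      ← Finset.add_sum_erase _ (fun q ↦ B p q * Function.update x j 0 q) (Finset.mem_univ j)]
    rw [Finset.sum_congr rfl fun q hq ↦ by
      rw [updateCol_ne (Finset.ne_of_mem_erase hq), ← Function.update_of_ne
        (Finset.ne_of_mem_erase hq) 0 x]]
    simp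
    ring
  obtain ⟨i, hi⟩ := exists_det_ne_zero_of_injective (B.updateCol j (appendZero w)) (by
    intro x hx
    rw [hupd] at hx
    by_cases hxj : x j = 0
    · rw [hxj, zero_smul, add_zero] at hx
      obtain ⟨a, ha⟩ := hker _ hx
      have h1 := congrFun ha j
      rw [Pi.smul_apply, smul_eq_mul, Function.update_self] at h1
      have h2 := (mul_eq_zero.mp h1).resolve_right hj
      rw [h2, zero_smul, ← hxj, Function.update_eq_self] at ha
      exact ha.symm
    · refine absurd ?_ (hrange (-(x j)⁻¹ • Function.update x j 0))
      rw [mulVec_smul, eq_neg_of_add_eq_zero_left hx, smul_neg, neg_smul, neg_neg, smul_smul,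
        inv_mul_cancel₀ hxj, one_smul])
  apply hi
  set M := (shiftMatrix B).submatrix i.succAbove id with hM
  set w' : Fin n → Polynomial k := fun p ↦ Polynomial.C (appendZero w (i.succAbove p)) with hw'
  have hmul : M *ᵥ (fun q ↦ (Polynomial.C (w q) : Polynomial k)) = (Polynomial.X : Polynomial k) • w' := by
    change (fun p ↦ (shiftMatrix B *ᵥ (fun q ↦ Polynomial.C (w q))) (i.succAbove p)) = _
    rw [shiftMatrix_mulVec, hw]
    ext1 p
    simp [w']
  -- Since `M w = y w'`, this reads `y * det (M with column j replaced by w') = det M * w j`.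
  -- Comparing coefficients of `y¹` kills the minor found to be nonzero.
  have hdet := det_updateCol_mulVec M j (fun q ↦ Polynomial.C (w q))
  rw [hmul, det_updateCol_smul] at hdet
  have h1 := congr(Polynomial.coeff $hdet 1)
  rw [Polynomial.coeff_X_mul, Polynomial.coeff_mul_C, hcoeff i 1 one_lt_two,
    zero_mul, Polynomial.coeff_zero_eq_eval_zero, ← Polynomial.coe_evalRingHom, RingHom.map_det,
    RingHom.mapMatrix_apply] at h1
  rw [← h1]
  congr 1
  ext p q
  by_cases hq : q = j
  · subst hq
    simp [w']
  · simp only [submatrix_apply, id, map_apply, updateCol_ne hq]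
    exact congrFun (congrFun (heval i).symm p) q

end minors

/-! ### Specialization of the generic minors. -/

section generic

variable (k : Type u) [Field k] (n : ℕ)

lemma mem_minorIdeal_eval (B : Matrix (Fin (n + 1)) (Fin n) k) :
    (∀ f ∈ minorIdeal.{u} k n, MvPolynomial.eval (fun s ↦ B s.down.1 s.down.2) f = 0) ↔
      MinorsDvd B := by
  set φ : MvPolynomial (MatIdx.{u} n) k →+* k := MvPolynomial.eval (fun s ↦ B s.down.1 s.down.2)
  have hmap (i : Fin (n + 1)) : Polynomial.mapRingHom φ
      ((genericShift k n).submatrix i.succAbove id).det =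
        ((shiftMatrix B).submatrix i.succAbove id).det := by
    rw [RingHom.map_det]
    congr 1
    ext1 p q
    simp only [genericShift, shiftMatrix, RingHom.mapMatrix_apply, Matrix.map_apply,
      Matrix.submatrix_apply, Matrix.of_apply, id, Polynomial.coe_mapRingHom]
    split_ifs <;> simp [φ]
  have hker : (∀ f ∈ minorIdeal.{u} k n, φ f = 0) ↔ minorIdeal.{u} k n ≤ RingHom.ker φ := Iff.rfl
  rw [hker, minorIdeal, Ideal.span_le]
  simp only [MinorsDvd, Polynomial.X_pow_dvd_iff, ← hmap, Polynomial.coe_mapRingHom,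
    Polynomial.coeff_map]
  constructor
  · intro h i d hd
    exact h ⟨i, d, hd, rfl⟩
  · rintro h _ ⟨i, d, hd, rfl⟩
    exact h i d hd

end generic

/-! ### Uniqueness of the incident flag for a generic matrix. -/

section generic_flag

open Matrix

variable {R : Type*} [CommRing R] {m : ℕ} (B : Matrix (Fin (m + 3)) (Fin (m + 2)) R)

/-- The square matrix obtained from `B` by deleting the last two rows and the first column. -/
def cornerBlock : Matrix (Fin (m + 1)) (Fin (m + 1)) R :=
  B.submatrix (fun p ↦ p.castSucc.castSucc) Fin.succ

/-- The vector killed by the first rows of `B`, given by Cramer's rule. -/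
def cornerKer : Fin (m + 2) → R :=
  Fin.cons (cornerBlock B).det
    (-((cornerBlock B).adjugate *ᵥ fun p ↦ B p.castSucc.castSucc 0))

/-- If this polynomial does not vanish at `B`, then `B` is incident with at most one flag. -/
def cornerPoly : R :=
  (cornerBlock B).det * ((cornerBlock B).adjugate *ᵥ fun p ↦ cornerKer B p.castSucc) 0

lemma map_cornerPoly {R' : Type*} [CommRing R'] (f : R →+* R') :
    cornerPoly (B.map f) = f (cornerPoly B) := by
  have hS : cornerBlock (B.map f) = f.mapMatrix (cornerBlock B) := rfl
  have hadj : (cornerBlock (B.map f)).adjugate = (cornerBlock B).adjugate.map f :=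
    (RingHom.map_adjugate f _).symm
  have hk : (cornerKer (B.map f)) = fun p ↦ f (cornerKer B p) := by
    ext p
    refine Fin.cases ?_ (fun q ↦ ?_) p
    · simp only [cornerKer, Fin.cons_zero, hS, RingHom.map_det]
    · simp only [cornerKer, Fin.cons_succ, hadj, Pi.neg_apply, map_neg,
        RingHom.map_mulVec]
      rfl
  rw [cornerPoly, cornerPoly, hk, hadj, hS, ← RingHom.map_det, map_mul,
    RingHom.map_mulVec]
  rfl

variable {B}

/-- All but the last two rows of `B x = 0` form a square system for the entries of `x` after the
first, with right-hand side `-x 0` times column `0`; the adjugate solves it up to the determinant.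
-/
lemma det_mul_eq_of_mulVec_eq_zero {x : Fin (m + 2) → R} (h : B *ᵥ x = 0) (p : Fin (m + 2)) :
    (cornerBlock B).det * x p = x 0 * cornerKer B p := by
  refine Fin.cases ?_ (fun q ↦ ?_) p
  · rw [cornerKer, Fin.cons_zero, mul_comm]
  · have h1 : cornerBlock B *ᵥ (fun q ↦ x q.succ) =
        -(x 0 • fun p : Fin (m + 1) ↦ B p.castSucc.castSucc 0) := by
      ext p
      have := congrFun h p.castSucc.castSucc
      simp only [mulVec, dotProduct, Fin.sum_univ_succ, Pi.zero_apply] at this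
      simp only [mulVec, dotProduct, cornerBlock, submatrix_apply, Pi.neg_apply, Pi.smul_apply,
        smul_eq_mul, Fin.sum_univ_succ]
      linear_combination this
    have h2 := congrFun (congrArg ((cornerBlock B).adjugate *ᵥ ·) h1) q
    simp only [mulVec_mulVec, adjugate_mul, smul_mulVec, one_mulVec, mulVec_neg, mulVec_smul,
      Pi.smul_apply, Pi.neg_apply, smul_eq_mul] at h2
    rw [h2, cornerKer, Fin.cons_succ, Pi.neg_apply, mul_neg]

lemma det_mul_eq_of_mulVec_eq_smul {w v : Fin (m + 2) → R} {c : R} (hv : v 0 = 0)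
    (h : B *ᵥ v = c • appendZero w) (p : Fin (m + 1)) :
    (cornerBlock B).det * v p.succ =
      c * ((cornerBlock B).adjugate *ᵥ fun q ↦ w q.castSucc) p := by
  have h1 : cornerBlock B *ᵥ (fun q ↦ v q.succ) = c • fun p : Fin (m + 1) ↦ w p.castSucc := by
    ext p
    have := congrFun h p.castSucc.castSucc
    simp only [mulVec, dotProduct, Fin.sum_univ_succ, hv, mul_zero, zero_add, Pi.smul_apply,
      appendZero_castSucc] at this
    simp only [mulVec, dotProduct, cornerBlock, submatrix_apply, Pi.smul_apply,
      Fin.sum_univ_succ]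
    exact this
  have h2 := congrFun (congrArg ((cornerBlock B).adjugate *ᵥ ·) h1) p
  simpa only [mulVec_mulVec, adjugate_mul, smul_mulVec, one_mulVec, mulVec_smul,
    Pi.smul_apply, smul_eq_mul] using h2

/-- The system for `v` has right-hand side `c w`; expressing `w` through `cornerKer` costs the
second factor of the determinant. -/
lemma det_sq_mul_eq {w v : Fin (m + 2) → R} {c : R} (hv : v 0 = 0) (h1 : B *ᵥ w = 0)
    (h2 : B *ᵥ v = c • appendZero w) (p : Fin (m + 1)) :
    (cornerBlock B).det ^ 2 * v p.succ =
      w 0 * c * ((cornerBlock B).adjugate *ᵥ fun q ↦ cornerKer B q.castSucc) p := by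
  have h3 : (cornerBlock B).det • (fun q : Fin (m + 1) ↦ w q.castSucc) =
      w 0 • fun q : Fin (m + 1) ↦ cornerKer B q.castSucc :=
    funext fun q ↦ det_mul_eq_of_mulVec_eq_zero h1 _
  have h4 := congrFun (congrArg ((cornerBlock B).adjugate *ᵥ ·) h3) p
  simp only [mulVec_smul, Pi.smul_apply, smul_eq_mul] at h4
  linear_combination (cornerBlock B).det * det_mul_eq_of_mulVec_eq_smul hv h2 p + c * h4

/-- In `det_sq_mul_eq`, the entry `v 1 = 1` determines `c`, since the second factor of `cornerPoly`
is a unit; then `c` determines `v`. An arbitrary ring is allowed because uniqueness is needed for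
morphisms from arbitrary schemes. -/
lemma eq_of_isUnit_cornerPoly (hB : IsUnit (cornerPoly B)) {w v w' v' : Fin (m + 2) → R}
    {c c' : R} (hw : w 0 = 1) (hv : v 0 = 0) (hv1 : v 1 = 1)
    (h1 : B *ᵥ w = 0) (h2 : B *ᵥ v = c • appendZero w)
    (hw' : w' 0 = 1) (hv' : v' 0 = 0) (hv1' : v' 1 = 1)
    (h1' : B *ᵥ w' = 0) (h2' : B *ᵥ v' = c' • appendZero w') :
    w = w' ∧ v = v' := by
  obtain ⟨hd, hg⟩ := IsUnit.mul_iff.mp hB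
  have e1 := det_sq_mul_eq hv h1 h2
  have e2 := det_sq_mul_eq hv' h1' h2'
  rw [hw, one_mul] at e1
  rw [hw', one_mul] at e2
  have hc : c = c' := by
    rw [← hg.mul_left_inj, ← e1, ← e2, Fin.succ_zero_eq_one, hv1, hv1']
  constructor
  · ext p
    rw [← hd.mul_right_inj, det_mul_eq_of_mulVec_eq_zero h1, det_mul_eq_of_mulVec_eq_zero h1', hw,
      hw']
  · ext p
    refine Fin.cases (by rw [hv, hv']) (fun q ↦ ?_) p
    rw [← (hd.pow 2).mul_right_inj, e1, e2, hc]

/-- If `w 0 = 0`, Cramer's rule forces `w = 0`. If the Plücker coordinate vanishes, `w 0 • v - v 0 •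
w` has zero entries `0` and `1`, which forces its scalar, and hence the vector itself, to be zero.
-/
lemma ne_zero_of_cornerPoly_ne_zero {k : Type*} [Field k]
    {B : Matrix (Fin (m + 3)) (Fin (m + 2)) k} (hB : cornerPoly B ≠ 0) {w v : Fin (m + 2) → k}
    (h : LinearIndependent k ![w, v]) {c : k} (h1 : B *ᵥ w = 0)
    (h2 : B *ᵥ v = c • appendZero w) : w 0 ≠ 0 ∧ wedge w v (0, 1) ≠ 0 := by
  obtain ⟨hd, hg⟩ := mul_ne_zero_iff.mp hB
  have hw0 : w 0 ≠ 0 := by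
    intro hw0
    refine h.ne_zero 0 (funext fun p ↦ ?_)
    have := det_mul_eq_of_mulVec_eq_zero h1 p
    rw [hw0, zero_mul] at this
    exact (mul_eq_zero.mp this).resolve_left hd
  refine ⟨hw0, fun hwv ↦ ?_⟩
  set v' : Fin (m + 2) → k := w 0 • v - v 0 • w with hv'
  have hv'0 : v' 0 = 0 := by simp [hv', mul_comm]
  have h3 : B *ᵥ v' = (w 0 * c) • appendZero w := by
    rw [hv', mulVec_sub, mulVec_smul, mulVec_smul, h1, h2, smul_zero, sub_zero, smul_smul]
  have hv'1 : v' (Fin.succ 0) = 0 := by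
    rw [← hwv, Fin.succ_zero_eq_one]
    simp [hv', wedge]
    ring
  have e := det_sq_mul_eq hv'0 h1 h3
  have hc := e 0
  rw [hv'1, mul_zero] at hc
  have hc0 : w 0 * (w 0 * c) = 0 := (mul_eq_zero.mp hc.symm).resolve_right hg
  have hv'z : v' = 0 := by
    ext p
    refine Fin.cases hv'0 (fun q ↦ ?_) p
    have := e q
    rw [hc0, zero_mul] at this
    exact (mul_eq_zero.mp this).resolve_left (pow_ne_zero 2 hd)
  rw [LinearIndependent.pair_iff] at h
  exact hw0 (h (-v 0) (w 0) (by rw [← hv'z, hv', neg_smul, neg_add_eq_sub])).2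

variable (R m) in
/-- The matrix with a single Jordan block and zero last row. -/
def jordanMatrix : Matrix (Fin (m + 3)) (Fin (m + 2)) R :=
  .of fun p q ↦ if p.val + 1 = q.val then 1 else 0

lemma cornerPoly_jordanMatrix : cornerPoly (jordanMatrix R m) = 1 := by
  have h1 : cornerBlock (jordanMatrix R m) = 1 := by
    ext p q
    simp [cornerBlock, jordanMatrix, Matrix.one_apply, Fin.ext_iff]
  simp [cornerPoly, cornerKer, h1]

lemma jordanMatrix_mulVec_single (q : Fin (m + 2)) :
    jordanMatrix R m *ᵥ Pi.single q 1 = fun p ↦ if p.val + 1 = q.val then 1 else 0 := by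
  ext p
  simp [jordanMatrix]

lemma jordanMatrix_mulVec_zero : jordanMatrix R m *ᵥ Pi.single 0 1 = 0 := by
  rw [jordanMatrix_mulVec_single]
  ext p
  simp

lemma jordanMatrix_mulVec_one :
    jordanMatrix R m *ᵥ Pi.single 1 1 = (1 : R) • appendZero (Pi.single 0 1) := by
  rw [jordanMatrix_mulVec_single, one_smul]
  ext p
  refine Fin.lastCases ?_ (fun q ↦ ?_) p
  · simp
  · rw [appendZero_castSucc, Pi.single_apply]
    refine if_congr ?_ rfl rfl
    rw [Fin.ext_iff, Fin.val_castSucc, Fin.val_one, Fin.val_zero]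
    omega

end generic_flag

/-! ### The parametrization in families and its retraction. -/

section bundle

variable {n : ℕ} {i j : Fin n} (hij : i ≠ j)

lemma map_bundleCoords {R S : Type*} [CommRing R] [CommRing S] (f : R →+* S)
    (B : Matrix (Fin (n + 1)) (Fin n) R) (c : R) (b : BundleIdx i j) :
    f (bundleCoords i j B c b) = bundleCoords i j (B.map f) (f c) b := by
  obtain _ | ⟨l, p⟩ := b <;> rfl

/-- A numbering of the coordinates on the fibres of the incidence variety. -/
def bundleEquiv : ULift.{u} (Fin (n ^ 2 - n - 1)) ≃ BundleIdx i j :=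
  Equiv.ulift.trans (Fintype.equivFinOfCardEq (card_bundleIdx hij)).symm

variable {T : Scheme.{u}} (t : FlagIdx.{u} i j → Γ(T, ⊤))

/-- The family of linear maps whose image consists of the matrices incident to the flag with
coordinates `t`. -/
def bundleMap : 𝔸(ULift.{u} (Fin (n ^ 2 - n - 1)); T) ⟶ matSpace n T :=
  AffineSpace.homOfVector (𝔸(ULift.{u} (Fin (n ^ 2 - n - 1)); T) ↘ T) fun s ↦
    ∑ c, (𝔸(ULift.{u} (Fin (n ^ 2 - n - 1)); T) ↘ T).appTop
      (bundleCoeff i j (lineVec i j t) (planeVec i j t) s.down (bundleEquiv hij c)) *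
        AffineSpace.coord T c

lemma map_bundleMap_coord {Γ' : Type*} [CommRing Γ']
    (f : Γ(𝔸(ULift.{u} (Fin (n ^ 2 - n - 1)); T), ⊤) →+* Γ') (p : Fin (n + 1)) (q : Fin n) :
    f ((bundleMap hij t).appTop (AffineSpace.coord T ⟨(p, q)⟩)) = bundleMatrix i j
      (lineVec i j fun s ↦ f ((𝔸(ULift.{u} (Fin (n ^ 2 - n - 1)); T) ↘ T).appTop (t s)))
      (planeVec i j fun s ↦ f ((𝔸(ULift.{u} (Fin (n ^ 2 - n - 1)); T) ↘ T).appTop (t s)))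
      (fun b ↦ f (AffineSpace.coord T ((bundleEquiv hij).symm b))) p q := by
  rw [bundleMap, AffineSpace.homOfVector_appTop_coord, map_sum, bundleMatrix, Matrix.of_apply,
    ← (bundleEquiv.{u} hij).sum_comp]
  refine Finset.sum_congr rfl fun c _ ↦ ?_
  rw [map_mul, Equiv.symm_apply_apply]
  congr 1
  refine (map_bundleCoeff i j (f.comp ((𝔸(ULift.{u} (Fin (n ^ 2 - n - 1)); T) ↘ T).appTop.hom))
    _ _ _ _).trans ?_
  congr 1 <;> ext l
  · exact map_lineVec i j (f.comp ((𝔸(ULift.{u} (Fin (n ^ 2 - n - 1)); T) ↘ T).appTop.hom)) t l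
  · exact map_planeVec i j (f.comp ((𝔸(ULift.{u} (Fin (n ^ 2 - n - 1)); T) ↘ T).appTop.hom)) t l

/-- A retraction of `bundleMap`. -/
def bundleRetraction : matSpace n T ⟶ 𝔸(ULift.{u} (Fin (n ^ 2 - n - 1)); T) :=
  AffineSpace.homOfVector (matSpace n T ↘ T) fun c ↦
    bundleCoords i j (.of fun p q ↦ AffineSpace.coord T ⟨(p, q)⟩)
      (∑ q, AffineSpace.coord T ⟨(i.castSucc, q)⟩ *
        (matSpace n T ↘ T).appTop (planeVec i j t q)) (bundleEquiv hij c)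

lemma bundleMap_retraction : bundleMap hij t ≫ bundleRetraction hij t = 𝟙 _ := by
  have hover : bundleMap hij t ≫ matSpace n T ↘ T =
      𝔸(ULift.{u} (Fin (n ^ 2 - n - 1)); T) ↘ T := AffineSpace.homOfVector_over _ _
  apply AffineSpace.hom_ext
  · rw [Category.assoc, bundleRetraction, AffineSpace.homOfVector_over, hover, Category.id_comp]
  · intro c
    rw [Scheme.Hom.comp_appTop, CommRingCat.comp_apply, bundleRetraction,
      AffineSpace.homOfVector_appTop_coord]
    refine (map_bundleCoords (bundleMap hij t).appTop.hom _ _ _).trans ?_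
    let t' (s : FlagIdx.{u} i j) := (𝔸(ULift.{u} (Fin (n ^ 2 - n - 1)); T) ↘ T).appTop (t s)
    have h := bundleCoords_bundleMatrix (lineVec_self i j t') (planeVec_left i j t')
      (planeVec_right i j hij t') (fun b ↦ AffineSpace.coord T ((bundleEquiv hij).symm b)) (bundleEquiv hij c)
    rw [Equiv.symm_apply_apply] at h
    rw [Scheme.Hom.id_appTop, CommRingCat.id_apply]
    refine Eq.trans ?_ h
    have h1 (p : Fin (n + 1)) (q : Fin n) := map_bundleMap_coord hij t (RingHom.id _) p q
    congr 1
    · ext p q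
      exact h1 p q
    · rw [map_sum]
      refine Finset.sum_congr rfl fun q _ ↦ ?_
      rw [map_mul]
      congr 1
      · exact h1 _ q
      · refine Eq.trans ?_ (map_planeVec i j
          (𝔸(ULift.{u} (Fin (n ^ 2 - n - 1)); T) ↘ T).appTop.hom t q)
        change ((matSpace n T ↘ T).appTop ≫ (bundleMap hij t).appTop) _ = _
        rw [← Scheme.Hom.comp_appTop, hover]

instance : IsClosedImmersion (bundleMap hij t) :=
  have : IsSeparated (bundleRetraction hij t) := by
    have : IsSeparated (bundleRetraction hij t ≫
        𝔸(ULift.{u} (Fin (n ^ 2 - n - 1)); T) ↘ T) := by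
      rw [bundleRetraction, AffineSpace.homOfVector_over]
      infer_instance
    exact .of_comp _ (𝔸(ULift.{u} (Fin (n ^ 2 - n - 1)); T) ↘ T)
  isClosedImmersion_of_comp_eq_id_of_isSeparated _ _ (bundleMap_retraction hij t)

variable {k : Type u} [Field k]

lemma exists_coords_of_point {σ : Type u} (x : Spec (.of k) ⟶ 𝔸(σ; T)) : ∃ c : σ → k,
    ∀ s, x.appTop (AffineSpace.coord T s) = (Scheme.ΓSpecIso (.of k)).inv (c s) := by
  refine ⟨fun s ↦ (Scheme.ΓSpecIso (.of k)).hom (x.appTop (AffineSpace.coord T s)), fun s ↦ ?_⟩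
  rw [← CommRingCat.comp_apply, Iso.hom_inv_id, CommRingCat.id_apply]

lemma comp_bundleMap_map {S : Scheme.{u}} (f : T ⟶ S)
    (x : Spec (.of k) ⟶ 𝔸(ULift.{u} (Fin (n ^ 2 - n - 1)); T)) (τ : FlagIdx.{u} i j → k)
    (z : BundleIdx i j → k)
    (hτ : ∀ s, (x ≫ 𝔸(ULift.{u} (Fin (n ^ 2 - n - 1)); T) ↘ T).appTop (t s) =
      (Scheme.ΓSpecIso (.of k)).inv (τ s))
    (hz : ∀ b, x.appTop (AffineSpace.coord T ((bundleEquiv hij).symm b)) =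
      (Scheme.ΓSpecIso (.of k)).inv (z b)) :
    x ≫ bundleMap hij t ≫ AffineSpace.map (MatIdx n) f =
      matPoint ((x ≫ 𝔸(ULift.{u} (Fin (n ^ 2 - n - 1)); T) ↘ T) ≫ f)
        (bundleMatrix i j (lineVec i j τ) (planeVec i j τ) z) := by
  apply AffineSpace.hom_ext
  · rw [Category.assoc, Category.assoc, AffineSpace.map_over, matPoint,
      AffineSpace.homOfVector_over, bundleMap, AffineSpace.homOfVector_over_assoc, Category.assoc]
  · rintro ⟨p, q⟩
    rw [matPoint, AffineSpace.homOfVector_appTop_coord, Scheme.Hom.comp_appTop,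
      Scheme.Hom.comp_appTop, CommRingCat.comp_apply, CommRingCat.comp_apply,
      AffineSpace.map_appTop_coord]
    refine (map_bundleMap_coord hij t x.appTop.hom p q).trans ?_
    have h1 (s) : x.appTop.hom ((𝔸(ULift.{u} (Fin (n ^ 2 - n - 1)); T) ↘ T).appTop (t s)) =
      (Scheme.ΓSpecIso (.of k)).inv (τ s) := hτ s
    have h2 (b) : x.appTop.hom (AffineSpace.coord T ((bundleEquiv hij).symm b)) =
      (Scheme.ΓSpecIso (.of k)).inv (z b) := hz b
    simp only [h1, h2, bundleMatrix, Matrix.of_apply]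
    refine Eq.trans ?_ (map_sum (Scheme.ΓSpecIso (.of k)).inv.hom _ _).symm
    refine Finset.sum_congr rfl fun b _ ↦ ?_
    refine Eq.trans ?_ (map_mul (Scheme.ΓSpecIso (.of k)).inv.hom _ _).symm
    congr 1
    refine Eq.trans ?_ (map_bundleCoeff i j (Scheme.ΓSpecIso (.of k)).inv.hom _ _ _ _).symm
    congr 1 <;> ext l
    · exact (map_lineVec i j (Scheme.ΓSpecIso (.of k)).inv.hom τ l).symm
    · exact (map_planeVec i j (Scheme.ΓSpecIso (.of k)).inv.hom τ l).symm

lemma matPoint_injective {S : Scheme.{u}} {x x' : Spec (.of k) ⟶ S}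
    {B B' : Matrix (Fin (n + 1)) (Fin n) k} (h : matPoint x B = matPoint x' B') :
    x = x' ∧ B = B' := by
  constructor
  · simpa [matPoint] using congr($h ≫ matSpace n S ↘ S)
  · ext p q
    have h1 := AffineSpace.homOfVector_appTop_coord x
      (fun p : MatIdx.{u} n ↦ (Scheme.ΓSpecIso (.of k)).inv (B p.down.1 p.down.2)) ⟨(p, q)⟩
    have h2 := AffineSpace.homOfVector_appTop_coord x'
      (fun p : MatIdx.{u} n ↦ (Scheme.ΓSpecIso (.of k)).inv (B' p.down.1 p.down.2)) ⟨(p, q)⟩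
    change (matPoint x B).appTop _ = _ at h1
    change (matPoint x' B').appTop _ = _ at h2
    rw [h, h2] at h1
    exact ((Scheme.ΓSpecIso (.of k)).symm.commRingCatIsoToRingEquiv.injective h1).symm

lemma matPoint_over {S : Scheme.{u}} (x : Spec (.of k) ⟶ S)
    (B : Matrix (Fin (n + 1)) (Fin n) k) : matPoint x B ≫ matSpace n S ↘ S = x :=
  AffineSpace.homOfVector_over _ _

lemma incident_flagOf_iff (B : Matrix (Fin (n + 1)) (Fin n) k) (τ : FlagIdx.{u} i j → k) :
    Incident B (flagOf i j hij τ) ↔ B.mulVec (lineVec i j τ) = 0 ∧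
      ∃ c : k, B.mulVec (planeVec i j τ) = c • appendZero (lineVec i j τ) :=
  incident_ofPair_iff B _

lemma incident_flagOf_iff_exists (B : Matrix (Fin (n + 1)) (Fin n) k) (τ : FlagIdx.{u} i j → k) :
    Incident B (flagOf i j hij τ) ↔
      ∃ z, B = bundleMatrix i j (lineVec i j τ) (planeVec i j τ) z := by
  rw [incident_flagOf_iff]
  constructor
  · rintro ⟨h1, c, h2⟩
    exact ⟨_, (bundleMatrix_bundleCoords hij (lineVec_self i j τ) (planeVec_left i j τ)
      (planeVec_right i j hij τ) h1 h2).symm⟩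
  · rintro ⟨z, rfl⟩
    exact ⟨bundleMatrix_mulVec_line (lineVec_self i j τ) z, _,
      bundleMatrix_mulVec_plane (planeVec_left i j τ) (planeVec_right i j hij τ) z⟩

end bundle

/-! ### Smoothness, base change and dimension of relative affine space. -/

section affineSpace

variable {S : Scheme.{u}} {σ : Type u}

/-- Base change from `Spec ℤ`, where it is smoothness of a polynomial algebra in finitely many
variables. -/
instance smooth_affineSpace [Finite σ] : Smooth (𝔸(σ; S) ↘ S) := by
  have h : Smooth (𝔸(σ; Spec (.of (ULift.{u} ℤ))) ↘ Spec (.of (ULift.{u} ℤ))) := by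
    have h1 : Smooth (Spec.map (CommRingCat.ofHom
        (MvPolynomial.C (σ := σ) (R := CommRingCat.of (ULift.{u} ℤ))))) := by
      rw [HasRingHomProperty.Spec_iff (P := @Smooth), CommRingCat.hom_ofHom,
        ← MvPolynomial.algebraMap_eq, RingHom.smooth_algebraMap]
      constructor <;> infer_instance
    rw [← AffineSpace.SpecIso_inv_over] at h1
    rw [← Iso.hom_inv_id_assoc (AffineSpace.SpecIso σ (.of (ULift.{u} ℤ)))
      (𝔸(σ; Spec (.of (ULift.{u} ℤ))) ↘ Spec (.of (ULift.{u} ℤ)))]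
    infer_instance
  exact MorphismProperty.of_isPullback (P := @Smooth)
    (AffineSpace.isPullback_map (n := σ) (specULiftZIsTerminal.from S)) h

instance (T : Scheme.{u}) (f : S ⟶ T) [IsIso f] : IsIso (AffineSpace.map σ f) :=
  MorphismProperty.of_isPullback (P := .isomorphisms _)
    (AffineSpace.isPullback_map (n := σ) f).flip (.infer_property _)

instance (T : Scheme.{u}) (f : S ⟶ T) [IsOpenImmersion f] :
    IsOpenImmersion (AffineSpace.map σ f) :=
  MorphismProperty.of_isPullback (AffineSpace.isPullback_map (n := σ) f).flip inferInstance

instance (T : Scheme.{u}) (f : S ⟶ T) [IsProper f] : IsProper (AffineSpace.map σ f) :=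
  MorphismProperty.of_isPullback (AffineSpace.isPullback_map (n := σ) f).flip inferInstance

lemma opensRange_affineSpace_map {T : Scheme.{u}} (f : S ⟶ T) [IsOpenImmersion f] :
    (AffineSpace.map σ f).opensRange = (𝔸(σ; T) ↘ T) ⁻¹ᵁ f.opensRange := by
  ext x
  constructor
  · rintro ⟨y, rfl⟩
    exact ⟨(𝔸(σ; S) ↘ S) y, congr($((AffineSpace.map_over f).symm) y)⟩
  · rintro ⟨y, hy⟩
    obtain ⟨z, hz, -⟩ := Scheme.exists_preimage_of_isPullback
      (AffineSpace.isPullback_map (n := σ) f) x y hy.symm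
    exact ⟨z, hz⟩

lemma topologicalKrullDim_affineSpace (k : Type u) [Field k] (σ τ : Type u) [Finite σ] [Finite τ] :
    topologicalKrullDim 𝔸(σ; 𝔸(τ; Spec (.of k))) = ((Nat.card τ + Nat.card σ : ℕ) : ℕ∞) := by
  let e : 𝔸(σ; 𝔸(τ; Spec (.of k))) ≅ Spec (.of (MvPolynomial σ (MvPolynomial τ k))) :=
    asIso (AffineSpace.map σ (AffineSpace.SpecIso τ (.of k)).hom) ≪≫ AffineSpace.SpecIso σ _
  rw [IsHomeomorph.topologicalKrullDim_eq _ e.hom.homeomorph.isHomeomorph]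
  refine (PrimeSpectrum.topologicalKrullDim_eq_ringKrullDim _).trans ?_
  rw [MvPolynomial.ringKrullDim_of_isNoetherianRing, MvPolynomial.ringKrullDim_of_isNoetherianRing,
    ringKrullDim_eq_zero_of_field]
  simp

end affineSpace

/-! ### The incidence variety: charts, rational points, irreducibility and dimension. -/

section incidence

variable (k : Type u) [Field k] [IsAlgClosed k] {n : ℕ} (i j : Fin n) (hij : i ≠ j)

/-- The domain of a chart of the flag variety. -/
abbrev flagOpen : (flagVariety k n).Opens :=
  (flagChart k i j hij).opensRange

/-- The coordinates on a chart of the flag variety. -/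
def flagFun (s : FlagIdx.{u} i j) : Γ(flagOpen k i j hij, ⊤) :=
  (flagChart k i j hij).isoOpensRange.inv.appTop (AffineSpace.coord _ s)

/-- The point of `flagOpen k i j hij` with given coordinates. -/
def flagOpenPoint (τ : FlagIdx.{u} i j → k) : Spec (.of k) ⟶ flagOpen k i j hij :=
  affinePoint k τ ≫ (flagChart k i j hij).isoOpensRange.hom

lemma flagOpenPoint_ι (τ : FlagIdx.{u} i j → k) :
    flagOpenPoint k i j hij τ ≫ (flagOpen k i j hij).ι = (flagOf i j hij τ).point := by
  rw [flagOpenPoint, Category.assoc, Scheme.Hom.isoOpensRange_hom_ι, affinePoint_flagChart]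

lemma flagOpenPoint_appTop_flagFun (τ : FlagIdx.{u} i j → k) (s : FlagIdx.{u} i j) :
    (flagOpenPoint k i j hij τ).appTop (flagFun k i j hij s) =
      (Scheme.ΓSpecIso (.of k)).inv (τ s) := by
  rw [flagFun, ← CommRingCat.comp_apply, ← Scheme.Hom.comp_appTop, flagOpenPoint, Category.assoc,
    Iso.hom_inv_id, Category.comp_id, affinePoint_appTop_coord]

lemma exists_flagOpenPoint (x : Spec (.of k) ⟶ flagOpen k i j hij)
    (hx : x ≫ (flagOpen k i j hij).ι ≫ flagStr k n = 𝟙 _) :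
    ∃ τ, x = flagOpenPoint k i j hij τ := by
  obtain ⟨τ, hτ⟩ := exists_affinePoint k (x ≫ (flagChart k i j hij).isoOpensRange.inv) (by
    rw [← flagChart_str k i j hij, Category.assoc, Scheme.Hom.isoOpensRange_inv_comp_assoc, hx])
  exact ⟨τ, by rw [flagOpenPoint, ← hτ, Category.assoc, Iso.inv_hom_id, Category.comp_id]⟩

/-- The trivial bundle on a chart of the flag variety. -/
abbrev bundleChart : Scheme.{u} :=
  𝔸(ULift.{u} (Fin (n ^ 2 - n - 1)); flagOpen k i j hij)

/-- The parametrization of the incident matrices on a chart of the flag variety. -/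
def bundleChartMap : bundleChart k i j hij ⟶ matSpace n (flagVariety k n) :=
  bundleMap hij (flagFun k i j hij) ≫ AffineSpace.map (MatIdx n) (flagOpen k i j hij).ι

/-- The `k`-points of `bundleChart`. -/
def bundlePoint (τ : FlagIdx.{u} i j → k) (z : BundleIdx i j → k) :
    Spec (.of k) ⟶ bundleChart k i j hij :=
  AffineSpace.homOfVector (flagOpenPoint k i j hij τ) fun c ↦
    (Scheme.ΓSpecIso (.of k)).inv (z (bundleEquiv hij c))

lemma bundlePoint_bundleChartMap (τ : FlagIdx.{u} i j → k) (z : BundleIdx i j → k) :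
    bundlePoint k i j hij τ z ≫ bundleChartMap k i j hij = matPoint (flagOf i j hij τ).point
      (bundleMatrix i j (lineVec i j τ) (planeVec i j τ) z) := by
  rw [bundleChartMap, comp_bundleMap_map hij _ _ _ τ z, bundlePoint,
    AffineSpace.homOfVector_over, flagOpenPoint_ι]
  · intro s
    rw [bundlePoint, AffineSpace.homOfVector_over, flagOpenPoint_appTop_flagFun]
  · intro b
    rw [bundlePoint, AffineSpace.homOfVector_appTop_coord, Equiv.apply_symm_apply]

/-- The structure morphism of `bundleChart`. -/
def bundleChartStr : bundleChart k i j hij ⟶ Spec (.of k) :=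
  bundleChart k i j hij ↘ (flagOpen k i j hij : Scheme.{u}) ≫ (flagOpen k i j hij).ι ≫ flagStr k n

lemma flagOpen_str : (flagOpen k i j hij).ι ≫ flagStr k n =
    (flagChart k i j hij).isoOpensRange.inv ≫ 𝔸(FlagIdx.{u} i j; Spec (.of k)) ↘ Spec (.of k) := by
  rw [← flagChart_str k i j hij, Scheme.Hom.isoOpensRange_inv_comp_assoc]

instance : Smooth (bundleChartStr k i j hij) := by
  rw [bundleChartStr, flagOpen_str]
  infer_instance

lemma exists_bundlePoint (x : Spec (.of k) ⟶ bundleChart k i j hij)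
    (hx : x ≫ bundleChartStr k i j hij = 𝟙 _) : ∃ τ z, x = bundlePoint k i j hij τ z := by
  obtain ⟨τ, hτ⟩ := exists_flagOpenPoint k i j hij
    (x ≫ bundleChart k i j hij ↘ (flagOpen k i j hij : Scheme.{u})) (by
      rw [← hx, bundleChartStr, Category.assoc])
  obtain ⟨c, hc⟩ := exists_coords_of_point x
  refine ⟨τ, fun b ↦ c ((bundleEquiv hij).symm b), ?_⟩
  apply AffineSpace.hom_ext
  · rw [hτ, bundlePoint, AffineSpace.homOfVector_over]
  · intro s
    rw [hc, bundlePoint, AffineSpace.homOfVector_appTop_coord, Equiv.symm_apply_apply]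

lemma exists_flagOf_of_point_mem (W : LinePlaneFlag k n)
    (h : W.point (fieldPoint k) ∈ flagOpen k i j hij) : ∃ τ, W = flagOf i j hij τ := by
  rw [point_mem_opensRange_flagChart] at h
  exact exists_flagOf_of_wedge_ne_zero i j hij W
    (W.W₁_eq ▸ Submodule.mem_span_singleton_self _)
    (W.W₂_eq ▸ Submodule.subset_span (Set.mem_insert_of_mem _ rfl)) h.1 h.2

instance : IsIntegral (flagOpen k i j hij : Scheme.{u}) :=
  have : Nonempty (flagOpen k i j hij) :=
    ⟨(flagOpenPoint k i j hij 0) (fieldPoint k)⟩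
  isIntegral_of_isOpenImmersion (flagChart k i j hij).isoOpensRange.inv

/-- The second use of `exists_iso_reducedClosure`: over a flag chart, incident pairs are exactly the
rational points of the trivial bundle. -/
lemma exists_incidenceChart :
    ∃ e : bundleChart k i j hij ≅ ((incidenceι k n ≫ matSpace n (flagVariety k n) ↘
        flagVariety k n) ⁻¹ᵁ flagOpen k i j hij : (incidenceVariety k n).Opens),
      e.hom ≫ ((incidenceι k n ≫ matSpace n (flagVariety k n) ↘
        flagVariety k n) ⁻¹ᵁ flagOpen k i j hij).ι ≫ incidenceι k n = bundleChartMap k i j hij := by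
  have key := exists_iso_reducedClosure (incidenceLocus k n)
    (AffineSpace.map (MatIdx n) (flagOpen k i j hij).ι) (bundleMap hij (flagFun k i j hij)) (by
      rintro y ⟨⟨B, W, hBW, hy⟩, hy'⟩
      rw [range_eq_singleton, Set.mem_singleton_iff] at hy
      subst hy
      change _ ∈ (AffineSpace.map (MatIdx n) (flagOpen k i j hij).ι).opensRange at hy'
      rw [opensRange_affineSpace_map, Scheme.Opens.opensRange_ι] at hy'
      obtain ⟨τ, rfl⟩ := exists_flagOf_of_point_mem k i j hij W (by
        rw [← matPoint_over W.point B]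
        exact hy')
      obtain ⟨z, rfl⟩ := (incident_flagOf_iff_exists hij B τ).mp hBW
      rw [← bundlePoint_bundleChartMap]
      exact ⟨bundlePoint k i j hij τ z (fieldPoint k), rfl⟩) (by
      refine dense_of_forall_point_mem (bundleChartStr k i j hij) fun x hx ↦ ?_
      obtain ⟨τ, z, rfl⟩ := exists_bundlePoint k i j hij x hx
      refine ⟨_, flagOf i j hij τ, (incident_flagOf_iff_exists hij _ τ).mpr ⟨z, rfl⟩,
        fieldPoint k, ?_⟩
      rw [← bundlePoint_bundleChartMap]
      rfl)
  rw [opensRange_affineSpace_map, Scheme.Opens.opensRange_ι] at key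
  exact key

/-- The chart of the incidence variety over a chart of the flag variety. -/
def incidenceChart : bundleChart k i j hij ⟶ incidenceVariety k n :=
  (exists_incidenceChart k i j hij).choose.hom ≫ Scheme.Opens.ι _

instance : IsOpenImmersion (incidenceChart k i j hij) := by
  delta incidenceChart
  infer_instance

lemma incidenceChart_ι : incidenceChart k i j hij ≫ incidenceι k n = bundleChartMap k i j hij :=
  (Category.assoc _ _ _).trans (exists_incidenceChart k i j hij).choose_spec

lemma opensRange_incidenceChart : (incidenceChart k i j hij).opensRange =
    (incidenceι k n ≫ matSpace n (flagVariety k n) ↘ flagVariety k n) ⁻¹ᵁ flagOpen k i j hij := by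
  change ((exists_incidenceChart k i j hij).choose.hom ≫ Scheme.Opens.ι _).opensRange = _
  rw [Scheme.Hom.opensRange_comp_of_isIso, Scheme.Opens.opensRange_ι]

lemma exists_mem_opensRange_incidenceChart (x : incidenceVariety k n) :
    ∃ i j hij, x ∈ (incidenceChart k i j hij).opensRange := by
  simp only [opensRange_incidenceChart]
  exact exists_mem_opensRange_flagChart k
    ((incidenceι k n ≫ matSpace n (flagVariety k n) ↘ flagVariety k n) x)

theorem isVectorSubbundle_incidenceι :
    IsVectorSubbundle (incidenceι k n) (n ^ 2 - n - 1) := by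
  refine ⟨inferInstance, fun b ↦ ?_⟩
  obtain ⟨i, j, hij, hb⟩ := exists_mem_opensRange_flagChart k b
  obtain ⟨e, he⟩ := exists_incidenceChart k i j hij
  refine ⟨flagOpen k i j hij, hb, fun s c ↦ bundleCoeff i j (lineVec i j (flagFun k i j hij))
    (planeVec i j (flagFun k i j hij)) s.down (bundleEquiv hij c), e, he.trans ?_⟩
  apply AffineSpace.hom_ext
  · rw [bundleChartMap, Category.assoc, AffineSpace.map_over, bundleMap,
      AffineSpace.homOfVector_over_assoc, AffineSpace.homOfVector_over]
  · intro s
    rw [bundleChartMap, Scheme.Hom.comp_appTop, CommRingCat.comp_apply,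
      AffineSpace.map_appTop_coord, bundleMap, AffineSpace.homOfVector_appTop_coord,
      AffineSpace.homOfVector_appTop_coord]

lemma flagOf_point_mem (τ : FlagIdx.{u} i j → k) :
    (flagOf i j hij τ).point (fieldPoint k) ∈ flagOpen k i j hij := by
  rw [← flagOpenPoint_ι]
  exact ((flagOpenPoint k i j hij τ) (fieldPoint k)).2

/-- The content is that the closure adds no rational points: each lies in a chart, where its
coordinates exhibit an incident pair. -/
theorem exists_point_iff_incident (B : Matrix (Fin (n + 1)) (Fin n) k) (W : LinePlaneFlag k n) :
    (∃ x : Spec (.of k) ⟶ incidenceVariety k n, x ≫ incidenceι k n = matPoint W.point B) ↔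
      Incident B W := by
  constructor
  · rintro ⟨x, hx⟩
    obtain ⟨i, j, hij, h⟩ := exists_mem_opensRange_incidenceChart k (x (fieldPoint k))
    obtain ⟨y, rfl⟩ := exists_lift_of_mem_range k (incidenceChart k i j hij) x h
    rw [Category.assoc, incidenceChart_ι] at hx
    obtain ⟨τ, z, rfl⟩ := exists_bundlePoint k i j hij y (by
      have h1 : bundleChartMap k i j hij ≫ matSpace n (flagVariety k n) ↘ flagVariety k n ≫
          flagStr k n = bundleChartStr k i j hij := by
        rw [bundleChartMap, Category.assoc, AffineSpace.map_over_assoc, bundleMap,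
          AffineSpace.homOfVector_over_assoc, bundleChartStr]
      rw [← h1, reassoc_of% hx, ← Category.assoc, matPoint_over, LinePlaneFlag.point_str])
    rw [bundlePoint_bundleChartMap] at hx
    obtain ⟨h1, rfl⟩ := matPoint_injective hx
    rw [← point_injective k h1]
    exact (incident_flagOf_iff_exists hij _ τ).mpr ⟨z, rfl⟩
  · intro h
    exact ⟨reducedClosureLift _ (matPoint W.point B) (by
      rintro _ ⟨p, rfl⟩
      exact ⟨B, W, h, p, rfl⟩), reducedClosureLift_ι _ _ _⟩

lemma exists_point_mem_flagOpen [CharZero k] (hn : 2 ≤ n) : ∃ W : LinePlaneFlag k n,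
    ∀ i j hij, W.point (fieldPoint k) ∈ flagOpen k i j hij := by
  -- For `w = (1, …, 1)` and `v = (0, 1, …, n - 1)` the Plücker coordinates are `j - i`, nonzero in
  -- characteristic zero, so this flag lies in every chart.
  have hw (i j : Fin n) (hij : i ≠ j) : wedge (1 : Fin n → k) (fun l ↦ (l.val : k)) (i, j) ≠ 0 := by
    simp only [wedge, Pi.one_apply, one_mul, sub_ne_zero]
    exact fun h ↦ hij (Fin.ext (Nat.cast_injective h).symm)
  have h := linearIndependent_pair_of_wedge_ne_zero
    (hw ⟨0, by omega⟩ ⟨1, by omega⟩ (by simp [Fin.ext_iff]))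
  refine ⟨.ofPair _ _ h, fun i j hij ↦ ?_⟩
  obtain ⟨τ, hτ⟩ := exists_flagOf_of_wedge_ne_zero.{u} i j hij (.ofPair _ _ h)
    (Submodule.mem_span_singleton_self _) (Submodule.subset_span (Set.mem_insert_of_mem _ rfl))
    one_ne_zero (hw i j hij)
  rw [hτ]
  exact flagOf_point_mem k i j hij τ

variable (n) in
theorem irreducibleSpace_incidenceVariety [CharZero k] (hn : 2 ≤ n) :
    IrreducibleSpace (incidenceVariety k n) := by
  obtain ⟨W, hW⟩ := exists_point_mem_flagOpen k hn
  -- The zero matrix over a flag contained in all charts is the common point of the charts of the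
  -- incidence variety.
  obtain ⟨x, hx⟩ := (exists_point_iff_incident k 0 W).mpr (by
    refine ⟨?_, ?_, ?_⟩ <;> simp [topBlock, lastRow])
  refine irreducibleSpace_of_isOpenEmbedding_cover
    (ι := {p : Fin n × Fin n // p.1 ≠ p.2})
    (fun p ↦ incidenceChart k p.1.1 p.1.2 p.2) (fun p ↦ Scheme.Hom.isOpenEmbedding _)
    (fun y ↦ ?_) (x (fieldPoint k)) (fun p ↦ ?_)
  · obtain ⟨i, j, hij, h⟩ := exists_mem_opensRange_incidenceChart k y
    exact ⟨⟨(i, j), hij⟩, h⟩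
  · change _ ∈ (incidenceChart k p.1.1 p.1.2 p.2).opensRange
    rw [opensRange_incidenceChart]
    change ((x ≫ incidenceι k n) ≫ matSpace n (flagVariety k n) ↘ flagVariety k n)
      (fieldPoint k) ∈ flagOpen k p.1.1 p.1.2 p.2
    rw [hx, matPoint_over]
    exact hW p.1.1 p.1.2 p.2

include hij in
lemma card_flagIdx : Nat.card (FlagIdx.{u} i j) = (n - 1) + (n - 2) := by
  rw [Nat.card_eq_fintype_card, Fintype.card_ulift, Fintype.card_sum]
  congr 1
  · rw [Fintype.card_subtype_compl, Fintype.card_subtype_eq, Fintype.card_fin]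
  · exact card_ne_and_ne hij

lemma topologicalKrullDim_bundleChart (hn : 2 ≤ n) : topologicalKrullDim (bundleChart k i j hij) =
    ((n ^ 2 + n - 4 : ℕ) : ℕ∞) := by
  rw [← IsHomeomorph.topologicalKrullDim_eq _ (Scheme.Hom.homeomorph (AffineSpace.map
    (ULift.{u} (Fin (n ^ 2 - n - 1)))
      (flagChart k i j hij).isoOpensRange.hom)).isHomeomorph, topologicalKrullDim_affineSpace,
    card_flagIdx i j hij, Nat.card_eq_fintype_card, Fintype.card_ulift, Fintype.card_fin]
  congr 2
  -- Ensures that no natural subtraction in `(n - 1) + (n - 2) + (n² - n - 1) = n² + n - 4`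
  -- truncates.
  have : n * 2 ≤ n ^ 2 := by nlinarith
  omega

variable (n) in
theorem topologicalKrullDim_incidenceVariety (hn : 2 ≤ n) :
    topologicalKrullDim (incidenceVariety k n) = ((n ^ 2 + n - 4 : ℕ) : ℕ∞) := by
  have : Nonempty {p : Fin n × Fin n // p.1 ≠ p.2} :=
    ⟨(⟨0, by omega⟩, ⟨1, by omega⟩), by simp [Fin.ext_iff]⟩
  refine topologicalKrullDim_eq_of_isOpenEmbedding_cover
    (ι := {p : Fin n × Fin n // p.1 ≠ p.2})
    (fun p ↦ incidenceChart k p.1.1 p.1.2 p.2) (fun p ↦ Scheme.Hom.isOpenEmbedding _)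
    (fun y ↦ ?_) (fun p ↦ topologicalKrullDim_bundleChart k _ _ p.2 hn)
  obtain ⟨i, j, hij, h⟩ := exists_mem_opensRange_incidenceChart k y
  exact ⟨⟨(i, j), hij⟩, h⟩

end incidence

/-! ### Rational points of `𝔛`. -/

section minorVariety

variable (k : Type u) [Field k] (n : ℕ)

instance : IsReduced (minorVariety k n) := by
  have : _root_.IsReduced (MvPolynomial (MatIdx.{u} n) k ⧸ (minorIdeal k n).radical) :=
    (Ideal.isRadical_iff_quotient_reduced _).mp (Ideal.radical_isRadical _)
  infer_instance

instance : IsClosedImmersion (minorVarietyι k n) := by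
  have := IsClosedImmersion.spec_of_surjective
    (CommRingCat.ofHom (Ideal.Quotient.mk (minorIdeal.{u} k n).radical))
    Ideal.Quotient.mk_surjective
  delta minorVarietyι
  infer_instance

variable {n}

/-- The `k`-point of the space of matrices given by `B`. -/
abbrev matrixPoint (B : Matrix (Fin (n + 1)) (Fin n) k) :
    Spec (.of k) ⟶ matSpace.{u} n (Spec (.of k)) :=
  affinePoint k fun s ↦ B s.down.1 s.down.2

lemma matPoint_map {S T : Scheme.{u}} (f : S ⟶ T) (x : Spec (.of k) ⟶ S)
    (B : Matrix (Fin (n + 1)) (Fin n) k) :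
    matPoint x B ≫ AffineSpace.map (MatIdx n) f = matPoint (x ≫ f) B := by
  apply AffineSpace.hom_ext
  · rw [Category.assoc, AffineSpace.map_over, ← Category.assoc, matPoint_over, matPoint_over]
  · intro s
    rw [Scheme.Hom.comp_appTop, CommRingCat.comp_apply, AffineSpace.map_appTop_coord, matPoint,
      matPoint, AffineSpace.homOfVector_appTop_coord, AffineSpace.homOfVector_appTop_coord]

lemma affinePoint_SpecIso_hom {σ : Type u} (c : σ → k) :
    affinePoint k c ≫ (AffineSpace.SpecIso σ (.of k)).hom =
      Spec.map (CommRingCat.ofHom (MvPolynomial.eval c)) := by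
  rw [← Iso.eq_comp_inv]
  apply AffineSpace.hom_ext
  · rw [affinePoint_over, Category.assoc, AffineSpace.SpecIso_inv_over, ← Spec.map_comp,
      ← CommRingCat.ofHom_comp]
    have h : (MvPolynomial.eval c).comp MvPolynomial.C = RingHom.id k :=
      RingHom.ext (MvPolynomial.eval_C (f := c))
    exact (Spec.map_id _).symm.trans congr(Spec.map (CommRingCat.ofHom $h.symm))
  · intro s
    rw [affinePoint_appTop_coord, Scheme.Hom.comp_appTop, CommRingCat.comp_apply,
      AffineSpace.SpecIso_inv_appTop_coord]
    have h := congr($(Scheme.ΓSpecIso_inv_naturality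
      (CommRingCat.ofHom (MvPolynomial.eval c))) (MvPolynomial.X s))
    rw [CommRingCat.comp_apply, CommRingCat.comp_apply] at h
    refine Eq.trans ?_ h
    exact congrArg (fun a : k ↦ (Scheme.ΓSpecIso (.of k)).inv a) (MvPolynomial.eval_X s).symm

lemma exists_point_minorVariety_iff (B : Matrix (Fin (n + 1)) (Fin n) k) :
    (∃ y, y ≫ minorVarietyι k n = matrixPoint k B) ↔ MinorsDvd B := by
  rw [← mem_minorIdeal_eval.{u}]
  set φ : MvPolynomial (MatIdx.{u} n) k →+* k := MvPolynomial.eval (fun s ↦ B s.down.1 s.down.2)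
  have key (g : MvPolynomial (MatIdx.{u} n) k ⧸ (minorIdeal k n).radical →+* k) :
      Spec.map (CommRingCat.ofHom g) ≫ minorVarietyι k n = matrixPoint k B ↔
        g.comp (Ideal.Quotient.mk _) = φ := by
    rw [minorVarietyι, ← Category.assoc, Iso.comp_inv_eq, affinePoint_SpecIso_hom,
      ← Spec.map_comp, Spec.map_inj, ← CommRingCat.ofHom_comp]
    exact ⟨fun h ↦ congr(($h).hom), fun h ↦ by rw [h]⟩
  constructor
  · rintro ⟨y, hy⟩ f hf
    obtain ⟨g, rfl⟩ := Spec.map_surjective y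
    have h := (key g.hom).mp hy
    change φ f = 0
    rw [← h, RingHom.comp_apply, Ideal.Quotient.eq_zero_iff_mem.mpr (Ideal.le_radical hf), map_zero]
  · intro h
    -- The kernel of evaluation is prime, so passing to the radical does not affect rational points.
    have h1 : (minorIdeal.{u} k n).radical ≤ RingHom.ker φ :=
      Ideal.IsRadical.radical_le_iff (RingHom.ker_isPrime φ).isRadical |>.mpr h
    exact ⟨_, (key (Ideal.Quotient.lift _ φ h1)).mpr (Ideal.Quotient.lift_comp_mk _ _ _)⟩

lemma exists_matrixPoint (x : Spec (.of k) ⟶ matSpace n (Spec (.of k)))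
    (hx : x ≫ matSpace n (Spec (.of k)) ↘ Spec (.of k) = 𝟙 _) : ∃ B, x = matrixPoint k B := by
  obtain ⟨c, rfl⟩ := exists_affinePoint k x hx
  exact ⟨.of fun p q ↦ c ⟨(p, q)⟩, rfl⟩

end minorVariety

/-! ### The morphism to `𝔛`: factorization, surjectivity and smoothness of the source. -/

section resolution

variable (k : Type u) [Field k] {n : ℕ}

/-- The structure morphism of the incidence variety. -/
def incidenceStr (n : ℕ) : incidenceVariety k n ⟶ Spec (.of k) :=
  incidenceProj k n ≫ matSpace n (Spec (.of k)) ↘ Spec (.of k)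

lemma incidenceStr_eq : incidenceStr k n =
    incidenceι k n ≫ matSpace n (flagVariety k n) ↘ flagVariety k n ≫ flagStr k n := by
  rw [incidenceStr, incidenceProj, Category.assoc, AffineSpace.map_over]

lemma comp_incidenceProj {x : Spec (.of k) ⟶ incidenceVariety k n} {B : Matrix (Fin (n + 1)) (Fin n) k}
    {W : LinePlaneFlag k n} (h : x ≫ incidenceι k n = matPoint W.point B) :
    x ≫ incidenceProj k n = matrixPoint k B := by
  rw [incidenceProj, ← Category.assoc, h, matPoint_map, W.point_str]
  rfl

variable [IsAlgClosed k]

instance : IsProper (incidenceProj k n) := by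
  delta incidenceProj
  infer_instance

instance : LocallyOfFiniteType (incidenceStr k n) := by
  delta incidenceStr
  infer_instance

lemma exists_incident_of_point (x : Spec (.of k) ⟶ incidenceVariety k n)
    (hx : x ≫ incidenceStr k n = 𝟙 _) :
    ∃ B W, Incident B W ∧ x ≫ incidenceι k n = matPoint W.point B := by
  rw [incidenceStr_eq] at hx
  obtain ⟨W, hW⟩ := exists_flag_of_point k
    (x ≫ incidenceι k n ≫ matSpace n (flagVariety k n) ↘ flagVariety k n) (by
      rw [← hx, Category.assoc, Category.assoc])
  obtain ⟨c, hc⟩ := exists_coords_of_point (x ≫ incidenceι k n)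
  have h : x ≫ incidenceι k n = matPoint W.point (.of fun p q ↦ c ⟨(p, q)⟩) := by
    apply AffineSpace.hom_ext
    · rw [matPoint_over, hW, Category.assoc]
    · intro s
      rw [hc, matPoint, AffineSpace.homOfVector_appTop_coord]
      rfl
  exact ⟨_, W, (exists_point_iff_incident k _ W).mp ⟨x, h⟩, h⟩

lemma minorsDvd_of_incident {B : Matrix (Fin (n + 1)) (Fin n) k} {W : LinePlaneFlag k n}
    (h : Incident B W) : MinorsDvd B := by
  obtain ⟨i, j, hij, h1⟩ := exists_mem_opensRange_flagChart k (W.point (fieldPoint k))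
  obtain ⟨τ, rfl⟩ := exists_flagOf_of_point_mem k i j hij W h1
  obtain ⟨h2, c, h3⟩ := (incident_flagOf_iff hij B τ).mp h
  exact minorsDvd_of_mulVec hij (lineVec_self i j τ) (planeVec_left i j τ)
    (planeVec_right i j hij τ) h2 h3

/-- The preimage of `𝔛` is closed and contains all rational points. As the incidence variety is
reduced, this set-theoretic inclusion suffices for a factorization of schemes. -/
lemma range_incidenceProj_subset :
    Set.range (incidenceProj k n) ⊆ Set.range (minorVarietyι k n) := by
  have h1 : IsClosed (incidenceProj k n ⁻¹' Set.range (minorVarietyι k n)) :=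
    (minorVarietyι k n).isClosedEmbedding.isClosed_range.preimage (incidenceProj k n).continuous
  have h2 : Dense (incidenceProj k n ⁻¹' Set.range (minorVarietyι k n)) := by
    refine dense_of_forall_point_mem (incidenceStr k n) fun x hx ↦ ?_
    obtain ⟨B, W, hBW, h⟩ := exists_incident_of_point k x hx
    obtain ⟨y, hy⟩ := (exists_point_minorVariety_iff k B).mpr (minorsDvd_of_incident k hBW)
    rw [← comp_incidenceProj k h] at hy
    exact ⟨y (fieldPoint k), congr($hy (fieldPoint k))⟩
  rintro _ ⟨x, rfl⟩
  have := h2 x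
  rwa [h1.closure_eq] at this

variable (n) in
/-- The resolution of `𝔛`. -/
def resolution : incidenceVariety k n ⟶ minorVariety k n :=
  IsClosedImmersion.lift (minorVarietyι k n) (incidenceProj k n)
    (ker_le_ker_of_range_subset _ _ (range_incidenceProj_subset k))

lemma resolution_ι : resolution k n ≫ minorVarietyι k n = incidenceProj k n :=
  IsClosedImmersion.lift_fac _ _ _

instance : IsProper (resolution k n) :=
  have : IsProper (resolution k n ≫ minorVarietyι k n) := by
    rw [resolution_ι]
    infer_instance
  .of_comp _ (minorVarietyι k n)

/-- The image is closed by properness, and contains every rational point of `𝔛` by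
`exists_incident_of_minorsDvd`. -/
instance : Surjective (resolution k n) := by
  refine ⟨Set.range_eq_univ.mp ?_⟩
  rw [← (resolution k n).isClosedMap.isClosed_range.closure_eq, ← dense_iff_closure_eq]
  refine dense_of_forall_point_mem
    (minorVarietyι k n ≫ matSpace n (Spec (.of k)) ↘ Spec (.of k)) fun y hy ↦ ?_
  obtain ⟨B, hB⟩ := exists_matrixPoint k (y ≫ minorVarietyι k n) (by rw [Category.assoc, hy])
  obtain ⟨W, hW⟩ := exists_incident_of_minorsDvd B
    ((exists_point_minorVariety_iff k B).mp ⟨y, hB⟩)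
  obtain ⟨x, hx⟩ := (exists_point_iff_incident k B W).mpr hW
  have h : x ≫ resolution k n = y := by
    rw [← cancel_mono (minorVarietyι k n), Category.assoc, resolution_ι, comp_incidenceProj k hx, hB]
  exact ⟨x (fieldPoint k), congr($h (fieldPoint k))⟩

variable (n) in
lemma irreducibleSpace_minorVariety [CharZero k] (hn : 2 ≤ n) :
    IrreducibleSpace (minorVariety k n) := by
  have := irreducibleSpace_incidenceVariety k n hn
  have h := (IrreducibleSpace.isIrreducible_univ _).image (resolution k n)
    (resolution k n).continuous.continuousOn
  rw [Set.image_univ, (resolution k n).surjective.range_eq] at h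
  exact (irreducibleSpace_def _).mpr h

lemma bundleChartMap_over (i j : Fin n) (hij : i ≠ j) : bundleChartMap k i j hij ≫
    matSpace n (flagVariety k n) ↘ flagVariety k n ≫ flagStr k n = bundleChartStr k i j hij := by
  rw [bundleChartMap, Category.assoc, AffineSpace.map_over_assoc, bundleMap,
    AffineSpace.homOfVector_over_assoc, bundleChartStr]

instance : Smooth (incidenceStr k n) := by
  have : IsZariskiLocalAtSource (@Smooth : MorphismProperty Scheme.{u}) :=
    HasRingHomProperty.instIsZariskiLocalAtSource
  rw [IsZariskiLocalAtSource.iff_of_iSup_eq_top (P := @Smooth)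
    (fun p : {p : Fin n × Fin n // p.1 ≠ p.2} ↦ (incidenceChart k p.1.1 p.1.2 p.2).opensRange)]
  · intro p
    rw [← Scheme.Hom.isoOpensRange_inv_comp, Category.assoc, incidenceStr_eq,
      ← Category.assoc (incidenceChart k _ _ _), incidenceChart_ι, bundleChartMap_over]
    infer_instance
  · refine eq_top_iff.mpr fun x _ ↦ ?_
    obtain ⟨i, j, hij, h⟩ := exists_mem_opensRange_incidenceChart k x
    exact TopologicalSpace.Opens.mem_iSup.mpr ⟨⟨(i, j), hij⟩, h⟩

end resolution

/-! ### Birationality. -/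

section birational

lemma eq_of_bundleMatrix_eq {R : Type*} [CommRing R] {m : ℕ}
    {B : Matrix (Fin (m + 3)) (Fin (m + 2)) R} (hB : IsUnit (cornerPoly B))
    {t t' : FlagIdx.{u} (0 : Fin (m + 2)) 1 → R} {z z' : BundleIdx (0 : Fin (m + 2)) 1 → R}
    (h : B = bundleMatrix 0 1 (lineVec 0 1 t) (planeVec 0 1 t) z)
    (h' : B = bundleMatrix 0 1 (lineVec 0 1 t') (planeVec 0 1 t') z') : t = t' ∧ z = z' := by
  have hline (t : FlagIdx.{u} (0 : Fin (m + 2)) 1 → R) (z) :=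
    bundleMatrix_mulVec_line (i := 0) (j := 1) (v := planeVec 0 1 t) (lineVec_self 0 1 t) z
  have hplane (t : FlagIdx.{u} (0 : Fin (m + 2)) 1 → R) (z) :=
    bundleMatrix_mulVec_plane (w := lineVec 0 1 t) (planeVec_left 0 1 t)
      (planeVec_right 0 1 Fin.zero_ne_one t) z
  have hz (t : FlagIdx.{u} (0 : Fin (m + 2)) 1 → R) (z) :=
    funext (bundleCoords_bundleMatrix (lineVec_self 0 1 t) (planeVec_left 0 1 t)
      (planeVec_right 0 1 Fin.zero_ne_one t) z)
  obtain ⟨hw, hv⟩ := eq_of_isUnit_cornerPoly hB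
    (lineVec_self 0 1 t) (planeVec_left 0 1 t) (planeVec_right 0 1 Fin.zero_ne_one t)
    (by rw [h, hline]) (by rw [h, hplane])
    (lineVec_self 0 1 t') (planeVec_left 0 1 t') (planeVec_right 0 1 Fin.zero_ne_one t')
    (by rw [h', hline]) (by rw [h', hplane])
  obtain rfl := FlagIdx.ext_of_vec 0 1 hw hv
  exact ⟨rfl, by rw [← hz t z, ← hz t z', ← h, ← h']⟩

variable (k : Type u) [Field k] (m : ℕ)

/-- The function `cornerPoly` on the space of matrices. -/
def cornerFun : Γ(matSpace.{u} (m + 2) (Spec (.of k)), ⊤) :=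
  cornerPoly (.of fun p q ↦ AffineSpace.coord (Spec (.of k)) ⟨(p, q)⟩)

/-- The open set of matrices where `cornerFun` does not vanish. -/
abbrev cornerOpen : (matSpace.{u} (m + 2) (Spec (.of k))).Opens :=
  Scheme.basicOpen _ (cornerFun k m)

variable {k m}

lemma matrixPoint_mem_cornerOpen (B : Matrix (Fin (m + 3)) (Fin (m + 2)) k) :
    matrixPoint k B (fieldPoint k) ∈ cornerOpen k m ↔ cornerPoly B ≠ 0 := by
  rw [mem_basicOpen_iff_appTop_ne_zero]
  have h : (matrixPoint k B).appTop (cornerFun k m) =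
      (Scheme.ΓSpecIso (.of k)).inv (cornerPoly B) := by
    refine (map_cornerPoly _ (matrixPoint k B).appTop.hom).symm.trans
      (Eq.trans ?_ (map_cornerPoly B (Scheme.ΓSpecIso (.of k)).inv.hom))
    congr 1
    ext p q
    exact affinePoint_appTop_coord k _ _
  rw [h]
  exact map_ne_zero_iff (Scheme.ΓSpecIso (.of k)).symm.commRingCatIsoToRingEquiv
    (Scheme.ΓSpecIso (.of k)).symm.commRingCatIsoToRingEquiv.injective

lemma nonempty_cornerOpen :
    (minorVarietyι k (m + 2) ⁻¹ᵁ cornerOpen k m : Set (minorVariety k (m + 2))).Nonempty := by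
  obtain ⟨y, hy⟩ := (exists_point_minorVariety_iff k (jordanMatrix k m)).mpr
    (minorsDvd_of_mulVec (zero_ne_one (α := Fin (m + 2))) (Pi.single_eq_same _ _)
      (Pi.single_eq_of_ne zero_ne_one _) (Pi.single_eq_same _ _)
      jordanMatrix_mulVec_zero jordanMatrix_mulVec_one)
  refine ⟨y (fieldPoint k), ?_⟩
  change (y ≫ minorVarietyι k (m + 2)) (fieldPoint k) ∈ cornerOpen k m
  rw [hy, matrixPoint_mem_cornerOpen, cornerPoly_jordanMatrix]
  exact one_ne_zero

variable [IsAlgClosed k]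

/-- The `(0,1)`-chart contains the preimage of `cornerOpen`. -/
lemma preimage_cornerOpen_le : incidenceProj k (m + 2) ⁻¹ᵁ cornerOpen k m ≤
    (incidenceChart k 0 1 Fin.zero_ne_one).opensRange := by
  intro x hx
  by_contra hx'
  -- The set of bad points is locally closed, so it would contain a rational point; that case is
  -- covered by `ne_zero_of_cornerPoly_ne_zero`.
  obtain ⟨y, hy, hy1, hy2⟩ := exists_point_mem (incidenceStr k (m + 2))
    (Z := (incidenceProj k (m + 2) ⁻¹ᵁ cornerOpen k m : Set (incidenceVariety k (m + 2))) ∩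
      ((incidenceChart k (0 : Fin (m + 2)) 1 Fin.zero_ne_one).opensRange : Set _)ᶜ)
    ((TopologicalSpace.Opens.isOpen _).isLocallyClosed.inter
      (TopologicalSpace.Opens.isOpen _).isClosed_compl.isLocallyClosed) ⟨x, hx, hx'⟩
  obtain ⟨B, W, hBW, h⟩ := exists_incident_of_point k y hy
  have hB : cornerPoly B ≠ 0 := by
    rw [← matrixPoint_mem_cornerOpen, ← comp_incidenceProj k h]
    exact hy1
  rw [W.eq_ofPair W.linearIndependent (W.W₁_eq ▸ Submodule.mem_span_singleton_self _)
    (W.W₂_eq ▸ Submodule.subset_span (Set.mem_insert_of_mem _ rfl)), incident_ofPair_iff] at hBW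
  obtain ⟨h1, c, h2⟩ := hBW
  refine hy2 ?_
  rw [opensRange_incidenceChart]
  change ((y ≫ incidenceι k (m + 2)) ≫
    matSpace (m + 2) (flagVariety k (m + 2)) ↘ flagVariety k (m + 2)) (fieldPoint k) ∈
      flagOpen k 0 1 Fin.zero_ne_one
  rw [h, matPoint_over, point_mem_opensRange_flagChart]
  exact ne_zero_of_cornerPoly_ne_zero hB W.linearIndependent h1 h2

lemma isUnit_appTop {Z Y : Scheme.{u}} (φ : Z ⟶ Y) (f : Γ(Y, ⊤))
    (h : ∀ z, φ z ∈ Y.basicOpen f) : IsUnit (φ.appTop f) := by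
  refine RingedSpace.isUnit_of_isUnit_germ _ _ _ fun z _ ↦ ?_
  have : z ∈ φ ⁻¹ᵁ Y.basicOpen f := h z
  rw [Scheme.preimage_basicOpen] at this
  exact (Scheme.mem_basicOpen_top _ _ _).mp this

variable {n : ℕ} (i j : Fin n) (hij : i ≠ j) in
lemma bundleChart_hom_ext {Z : Scheme.{u}} {g h : Z ⟶ bundleChart k i j hij}
    (h0 : g ≫ bundleChartStr k i j hij = h ≫ bundleChartStr k i j hij)
    (h1 : ∀ s, g.appTop ((bundleChart k i j hij ↘ (flagOpen k i j hij : Scheme.{u})).appTop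
        (flagFun k i j hij s)) =
      h.appTop ((bundleChart k i j hij ↘ (flagOpen k i j hij : Scheme.{u})).appTop
        (flagFun k i j hij s)))
    (h2 : ∀ c, g.appTop (AffineSpace.coord _ c) = h.appTop (AffineSpace.coord _ c)) : g = h := by
  apply AffineSpace.hom_ext _ h2
  rw [← cancel_mono (flagChart k i j hij).isoOpensRange.inv]
  apply AffineSpace.hom_ext
  · simpa only [bundleChartStr, flagOpen_str, Category.assoc] using h0
  · intro s
    have h3 := h1 s
    simp only [flagFun, ← CommRingCat.comp_apply, ← Scheme.Hom.comp_appTop] at h3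
    simpa only [Category.assoc] using h3

variable {n : ℕ} (i j : Fin n) (hij : i ≠ j) in
lemma appTop_incidenceChart_proj {Z : Scheme.{u}} (g : Z ⟶ bundleChart k i j hij) :
    (.of fun p q ↦ (g ≫ incidenceChart k i j hij ≫ incidenceProj k n).appTop
      (AffineSpace.coord _ ⟨(p, q)⟩) : Matrix (Fin (n + 1)) (Fin n) Γ(Z, ⊤)) =
    bundleMatrix i j
      (lineVec i j fun s ↦ g.appTop ((bundleChart k i j hij ↘
        (flagOpen k i j hij : Scheme.{u})).appTop (flagFun k i j hij s)))
      (planeVec i j fun s ↦ g.appTop ((bundleChart k i j hij ↘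
        (flagOpen k i j hij : Scheme.{u})).appTop (flagFun k i j hij s)))
      (fun b ↦ g.appTop (AffineSpace.coord _ ((bundleEquiv hij).symm b))) := by
  have hproj : incidenceChart k i j hij ≫ incidenceProj k n =
      bundleMap hij (flagFun k i j hij) ≫
        AffineSpace.map (MatIdx n) ((flagOpen k i j hij).ι ≫ flagStr k n) := by
    rw [incidenceProj, ← Category.assoc, incidenceChart_ι, bundleChartMap, Category.assoc,
      AffineSpace.map_comp]
  ext p q
  rw [Matrix.of_apply, hproj, Scheme.Hom.comp_appTop, Scheme.Hom.comp_appTop,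
    CommRingCat.comp_apply, CommRingCat.comp_apply, AffineSpace.map_appTop_coord]
  exact map_bundleMap_coord hij (flagFun k i j hij) g.appTop.hom p q

/-- The morphisms give two parametrizations of one matrix over `Γ(Z, ⊤)`, on which `cornerPoly` is a
unit. The ring-level uniqueness makes their flag and fibre coordinates equal. -/
lemma bundleChart_hom_ext_of_cornerOpen {Z : Scheme.{u}}
    {g h : Z ⟶ bundleChart k (0 : Fin (m + 2)) 1 Fin.zero_ne_one}
    (hgh : g ≫ incidenceChart k 0 1 Fin.zero_ne_one ≫ incidenceProj k (m + 2) =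
      h ≫ incidenceChart k 0 1 Fin.zero_ne_one ≫ incidenceProj k (m + 2))
    (hZ : ∀ z, (g ≫ incidenceChart k 0 1 Fin.zero_ne_one ≫ incidenceProj k (m + 2)) z ∈
      cornerOpen k m) : g = h := by
  have hBg := appTop_incidenceChart_proj 0 1 Fin.zero_ne_one g
  have hBh := appTop_incidenceChart_proj 0 1 Fin.zero_ne_one h
  have hunit := isUnit_appTop _ (cornerFun k m) hZ
  rw [← hgh] at hBh
  obtain ⟨ht, hz⟩ := eq_of_bundleMatrix_eq
    ((map_cornerPoly _ (g ≫ incidenceChart k 0 1 Fin.zero_ne_one ≫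
      incidenceProj k (m + 2)).appTop.hom).symm ▸ hunit) hBg hBh
  refine bundleChart_hom_ext 0 1 Fin.zero_ne_one ?_ (congrFun ht) fun c ↦ ?_
  · have hstr : incidenceChart k (0 : Fin (m + 2)) 1 Fin.zero_ne_one ≫ incidenceProj k (m + 2) ≫
        matSpace (m + 2) (Spec (.of k)) ↘ Spec (.of k) = bundleChartStr k 0 1 Fin.zero_ne_one := by
      rw [← incidenceStr, incidenceStr_eq, ← Category.assoc, incidenceChart_ι, bundleChartMap_over]
    simp only [← hstr, ← Category.assoc] at hgh ⊢
    rw [hgh]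
  · have h1 := congrFun hz (bundleEquiv Fin.zero_ne_one c)
    rwa [Equiv.symm_apply_apply] at h1

/-- Uniqueness of the flag makes the restriction a monomorphism. Being proper it is a closed
immersion, and being surjective onto a reduced scheme it is an isomorphism. -/
instance isIso_resolution_restrict :
    IsIso (resolution k (m + 2) ∣_ (minorVarietyι k (m + 2) ⁻¹ᵁ cornerOpen k m)) := by
  set U := minorVarietyι k (m + 2) ⁻¹ᵁ cornerOpen k m
  set V := resolution k (m + 2) ⁻¹ᵁ U
  have hfac : (resolution k (m + 2) ∣_ U) ≫ U.ι ≫ minorVarietyι k (m + 2) =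
      V.ι ≫ incidenceProj k (m + 2) := by
    rw [← Category.assoc, morphismRestrict_ι, Category.assoc, resolution_ι]
  have hV : (V : Set (incidenceVariety k (m + 2))) =
      incidenceProj k (m + 2) ⁻¹ᵁ cornerOpen k m := by
    rw [← resolution_ι]
    rfl
  have hrange : Set.range V.ι ⊆
      Set.range (incidenceChart k (0 : Fin (m + 2)) 1 Fin.zero_ne_one) := by
    rw [Scheme.Opens.range_ι, hV]
    exact preimage_cornerOpen_le
  set l := IsOpenImmersion.lift (incidenceChart k (0 : Fin (m + 2)) 1 Fin.zero_ne_one) V.ι hrange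
  have hl : l ≫ incidenceChart k (0 : Fin (m + 2)) 1 Fin.zero_ne_one = V.ι :=
    IsOpenImmersion.lift_fac _ _ _
  have hmono : Mono (V.ι ≫ incidenceProj k (m + 2)) := by
    refine ⟨fun {Z} g h hgh ↦ ?_⟩
    rw [← cancel_mono V.ι, ← hl, ← Category.assoc, ← Category.assoc]
    congr 1
    rw [← hl] at hgh
    simp only [Category.assoc] at hgh
    refine bundleChart_hom_ext_of_cornerOpen (by simpa only [Category.assoc] using hgh) fun z ↦ ?_
    have h1 : (g ≫ l) ≫ incidenceChart k 0 1 Fin.zero_ne_one ≫ incidenceProj k (m + 2) =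
        g ≫ V.ι ≫ incidenceProj k (m + 2) := by
      rw [← hl]
      simp only [Category.assoc]
    rw [h1]
    exact hV.le (g z).2
  have : Mono (resolution k (m + 2) ∣_ U) := mono_of_mono_fac hfac
  have : IsClosedImmersion (resolution k (m + 2) ∣_ U) :=
    (IsClosedImmersion.iff_isProper_and_mono _).mpr ⟨inferInstance, this⟩
  have : Surjective (resolution k (m + 2) ∣_ U) :=
    IsZariskiLocalAtTarget.restrict (P := @Surjective) inferInstance U
  exact isIso_of_isClosedImmersion_of_surjective _

theorem isResolutionOfSingularities_resolution [CharZero k] {n : ℕ} (hn : 2 ≤ n) :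
    IsResolutionOfSingularities (resolution k n)
      (minorVarietyι k n ≫ matSpace n (Spec (.of k)) ↘ Spec (.of k)) := by
  obtain ⟨m, rfl⟩ := Nat.exists_eq_add_of_le' hn
  have := irreducibleSpace_incidenceVariety k (m + 2) hn
  have := irreducibleSpace_minorVariety k (m + 2) hn
  refine ⟨inferInstance, ?_, inferInstance, minorVarietyι k (m + 2) ⁻¹ᵁ cornerOpen k m, ?_, ?_,
    inferInstance⟩
  · have h : Smooth (incidenceStr k (m + 2)) := inferInstance
    rwa [incidenceStr, ← resolution_ι, Category.assoc] at h
  · exact (TopologicalSpace.Opens.isOpen _).dense nonempty_cornerOpen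
  · obtain ⟨y, hy⟩ := nonempty_cornerOpen (k := k) (m := m)
    obtain ⟨x, rfl⟩ := (resolution k (m + 2)).surjective y
    exact (TopologicalSpace.Opens.isOpen _).dense ⟨x, hy⟩

end birational

end

end MatrixResolution

theorem mainTheorem8 (k : Type u) [Field k] [IsAlgClosed k] [CharZero k] (n : ℕ) (hn : 4 ≤ n) :
    -- the `k`-points of the flag variety are the flags
    Set.BijOn (fun W : MatrixResolution.LinePlaneFlag k n ↦ W.point) Set.univ
      {x | x ≫ MatrixResolution.flagStr k n = 𝟙 (Spec (.of k))} ∧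
    -- the `k`-points of the incidence variety are the incident tuples
    (∀ (B : Matrix (Fin (n + 1)) (Fin n) k) (W : MatrixResolution.LinePlaneFlag k n),
      (∃ x : Spec (.of k) ⟶ MatrixResolution.incidenceVariety k n,
        x ≫ MatrixResolution.incidenceι k n = MatrixResolution.matPoint W.point B) ↔
      MatrixResolution.Incident B W) ∧
    -- the incidence variety is a vector bundle on the flag variety
    MatrixResolution.IsVectorSubbundle (MatrixResolution.incidenceι k n) (n ^ 2 - n - 1) ∧
    IrreducibleSpace (MatrixResolution.incidenceVariety k n) ∧
    topologicalKrullDim (MatrixResolution.incidenceVariety k n) = ((n ^ 2 + n - 4 : ℕ) : ℕ∞) ∧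
    -- its projection to the space of matrices is a resolution of singularities of `𝔛`
    ∃ ρ : MatrixResolution.incidenceVariety k n ⟶ MatrixResolution.minorVariety k n,
      ρ ≫ MatrixResolution.minorVarietyι k n = MatrixResolution.incidenceProj k n ∧
      MatrixResolution.IsResolutionOfSingularities ρ
        (MatrixResolution.minorVarietyι k n ≫
          MatrixResolution.matSpace n (Spec (.of k)) ↘ Spec (.of k)) := by
  have h2 : 2 ≤ n := le_trans (by norm_num) hn
  exact ⟨MatrixResolution.bijOn_point k, MatrixResolution.exists_point_iff_incident k,
    MatrixResolution.isVectorSubbundle_incidenceι k,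
    MatrixResolution.irreducibleSpace_incidenceVariety k n h2,
    MatrixResolution.topologicalKrullDim_incidenceVariety k n h2,
    MatrixResolution.resolution k n, MatrixResolution.resolution_ι k,
    MatrixResolution.isResolutionOfSingularities_resolution h2⟩
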